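/- Let $n\ge 1$. For $\kappa\in\mathbb R$ let $S^\kappa$ be the class of $a\in C^\infty(\mathbb R^n\times\mathbb R^n\times\mathbb R^n)$ such that for all multi-indices $\alpha,\beta,\gamma$ there is a constant $C_{\alpha\beta\gamma}$ with $$|\partial_x^\alpha\partial_y^\beta\partial_\xi^\gamma a(x,y,\xi)|\le C_{\alpha\beta\gamma}\langle\xi\rangle^{\kappa-|\gamma|}\quad\text{for all }x,y,\xi\in\mathbb R^n,\qquad \langle\xi\rangle=(1+|\xi|^2)^{1/2}.$$ For a real-valued $\Phi\in C^\infty(\mathbb R^n\times\mathbb R^n\times\mathbb R^n)$ and an amplitude $a$ consider the Fourier integral operator $$\mathcal P u(x)=\int_{\mathbb R^n}\int_{\mathbb R^n}e^{i((x-y)\cdot\xi+\Phi(x,y,\xi))}a(x,y,\xi)u(y)\,dy\,d\xi ,\qquad u\in C_c^\infty(\mathbb R^n),$$ understood as an oscillatory integral, that is, as the limit in the sense of distributions in $x$, as $\varepsilon\to0+$, of the integrals with the extra factor $g(\varepsilon\xi)$, where $g\in C_c^\infty(\mathbb R^n)$, $g(0)=1$; the limit is required to exist and to be independent of $g$. Its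 formal adjoint $\mathcal P^*$ is the operator of the same form with $\Phi,a$ replaced by $-\Phi(y,x,\xi)$ and $\overline{a(y,x,\xi)}$. The operator $\mathcal P$ is called $L^p$-bounded if $\mathcal Pu\in L^p(\mathbb R^n)$ and $\|\mathcal Pu\|_{L^p}\le C\|u\|_{L^p}$ for all $u\in C_c^\infty(\mathbb R^n)$, with $C$ independent of $u$. It is called uniformly $H^1_{comp}$-$L^1_{loc}$-bounded if for every compact $K\subset\mathbb R^n$ there is a constant $C_K$ such that for all $h\in\mathbb R^n$ and all $u\in C_c^\infty(\mathbb R^n)\cap H^1(\mathbb R^n)$ supported in $K+h$ the distribution $\mathcal Pu$ is a locally integrable function and $\|\mathcal Pu\|_{L^1(K+h)}\le C_K\|u\|_{H^1}$. Here $H^1(\mathbb R^n)$ is the Fefferman–Stein Hardy space, with the norm $\|f\|_{H^1}=\big\|\sup_{t>0}|\varphi_t*f|\big\|_{L^1}$, $\varphi_t(x)=t^{-n}e^{-\pi|x|^2/t^2}$. **Theorem.** Assume the following conditions on $\Phi$: - (A1) $\Phi$ is a real-valued $C^\infty$-function and $\partial_{\xi_j}\Phi\in S^0$ for $j=1,\dots,n$;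 - (A2) $\mathcal P$ and $\mathcal P^*$ are $L^2(\mathbb R^n)$-bounded for every amplitude $a\in S^0$; - (A3) $\mathcal P$ and $\mathcal P^*$ are uniformly $H^1_{comp}$-$L^1_{loc}$-bounded for every amplitude $a\in S^{-(n-1)/2}$. Then $\mathcal P$ is $L^p(\mathbb R^n)$-bounded whenever $1<p<\infty$, $\kappa\le-(n-1)\left|\frac1p-\frac12\right|$ and $a\in S^\kappa$. -/

import Mathlib

open MeasureTheory Filter Topology
open scoped ContDiff NNReal ENNReal

noncomputable section

namespace FourierInt

/-- Euclidean space `ℝⁿ`. -/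
abbrev E (n : ℕ) : Type := EuclideanSpace ℝ (Fin n)

/-- The domain `ℝⁿ × ℝⁿ × ℝⁿ` of phases and amplitudes; its points are triples `(x, y, ξ)`. -/
abbrev E3 (n : ℕ) : Type := E n × E n × E n

/-- The `j`-th coordinate direction in the variable `x`. -/
def dirX {n : ℕ} (j : Fin n) : E3 n := (EuclideanSpace.single j (1 : ℝ), 0, 0)

/-- The `j`-th coordinate direction in the variable `y`. -/
def dirY {n : ℕ} (j : Fin n) : E3 n := (0, EuclideanSpace.single j (1 : ℝ), 0)

/-- The `j`-th coordinate direction in the variable `ξ`. -/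
def dirXi {n : ℕ} (j : Fin n) : E3 n := (0, 0, EuclideanSpace.single j (1 : ℝ))

/-- The weight `⟨ξ⟩ = (1 + |ξ|²)^{1/2}`. -/
def jap {n : ℕ} (ξ : E n) : ℝ := Real.sqrt (1 + ‖ξ‖ ^ 2)

/-- The iterated partial derivative `∂_x^α ∂_y^β ∂_ξ^γ a` at the point `p`, where multi-indices
of length `r`, `s`, `t` are given as lists `α`, `β`, `γ` of coordinates to differentiate in
(the order is immaterial for smooth `a`). -/
def mixedDeriv {n : ℕ} {F : Type*} [NormedAddCommGroup F] [NormedSpace ℝ F]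
    {r s t : ℕ} (α : Fin r → Fin n) (β : Fin s → Fin n) (γ : Fin t → Fin n)
    (a : E3 n → F) (p : E3 n) : F :=
  iteratedFDeriv ℝ (r + s + t) a p
    (Fin.append (Fin.append (fun i => dirX (α i)) (fun i => dirY (β i)))
      (fun i => dirXi (γ i)))

/-- The symbol class `S^κ`: smooth `a` with
`|∂_x^α ∂_y^β ∂_ξ^γ a(x,y,ξ)| ≤ C_{αβγ} ⟨ξ⟩^{κ - |γ|}` for all `x, y, ξ`. -/
def IsSymbol {n : ℕ} {F : Type*} [NormedAddCommGroup F] [NormedSpace ℝ F]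
    (κ : ℝ) (a : E3 n → F) : Prop :=
  ContDiff ℝ ∞ a ∧
    ∀ (r s t : ℕ) (α : Fin r → Fin n) (β : Fin s → Fin n) (γ : Fin t → Fin n),
      ∃ C : ℝ, ∀ x y ξ : E n,
        ‖mixedDeriv α β γ a (x, y, ξ)‖ ≤ C * jap ξ ^ (κ - (t : ℝ))

/-- The first order partial derivative `∂_{ξ_j} Φ`. -/
def partialXi {n : ℕ} (Φ : E3 n → ℝ) (j : Fin n) (p : E3 n) : ℝ :=
  fderiv ℝ Φ p (dirXi j)

/-- Complex valued test functions, `C_c^∞(ℝⁿ)`. -/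
def IsTest {n : ℕ} (u : E n → ℂ) : Prop :=
  ContDiff ℝ ∞ u ∧ HasCompactSupport u

/-- The integral `∫∫ g(ξ) e^{i((x-y)·ξ + Φ(x,y,ξ))} a(x,y,ξ) u(y) dy dξ`, with an additional
frequency cut-off `g`. -/
def cutOp {n : ℕ} (Φ : E3 n → ℝ) (a : E3 n → ℂ) (g u : E n → ℂ) (x : E n) : ℂ :=
  ∫ ξ : E n, ∫ y : E n,
    g ξ * Complex.exp (Complex.I * ((inner ℝ (x - y) ξ + Φ (x, y, ξ) : ℝ) : ℂ))
      * a (x, y, ξ) * u y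

/-- `𝒫 u = f`, where `𝒫` is the Fourier integral operator with phase `(x-y)·ξ + Φ(x,y,ξ)` and
amplitude `a`. The `ξ`-integral is an oscillatory integral: it is regularised by a factor
`g(εξ)` with `g ∈ C_c^∞`, `g(0) = 1`, and the limit `ε → 0+` is taken in the sense of
distributions in `x`; it must exist, and be the same, for all such `g`. -/
def Represents {n : ℕ} (Φ : E3 n → ℝ) (a : E3 n → ℂ) (u f : E n → ℂ) : Prop :=
  LocallyIntegrable f volume ∧
    ∀ g : E n → ℂ, IsTest g → g 0 = 1 →
      ∀ v : E n → ℂ, IsTest v →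
        Tendsto (fun ε : ℝ => ∫ x : E n, cutOp Φ a (fun ξ => g (ε • ξ)) u x * v x)
          (𝓝[>] 0) (𝓝 (∫ x : E n, f x * v x))

/-- The phase `Φ*(x,y,ξ) = -Φ(y,x,ξ)` of the formal adjoint `𝒫*`. -/
def adjPhase {n : ℕ} (Φ : E3 n → ℝ) (p : E3 n) : ℝ := -Φ (p.2.1, p.1, p.2.2)

/-- The amplitude `a*(x,y,ξ) = conj a(y,x,ξ)` of the formal adjoint `𝒫*`. -/
def adjAmp {n : ℕ} (a : E3 n → ℂ) (p : E3 n) : ℂ := star (a (p.2.1, p.1, p.2.2))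

/-- `𝒫` is `L^p(ℝⁿ)`-bounded: it maps test functions to `L^p`, with an `L^p`-`L^p` estimate
(so that, for `p < ∞`, it extends uniquely to a bounded operator on `L^p`). -/
def LpBounded {n : ℕ} (p : ℝ≥0∞) (Φ : E3 n → ℝ) (a : E3 n → ℂ) : Prop :=
  ∃ C : ℝ≥0, ∀ u : E n → ℂ, IsTest u →
    ∃ f : E n → ℂ, Represents Φ a u f ∧ MemLp f p volume ∧
      eLpNorm f p volume ≤ C * eLpNorm u p volume

/-- The dilated Gaussians `φ_t(x) = t^{-n} φ(x/t)` with `φ(x) = e^{-π|x|²}`, `∫ φ = 1`. -/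
def gauss {n : ℕ} (t : ℝ) (x : E n) : ℝ :=
  (t ^ n)⁻¹ * Real.exp (-Real.pi * ‖x‖ ^ 2 / t ^ 2)

/-- The Hardy space norm through the radial maximal function:
`‖f‖_{H¹} = ∫ sup_{t > 0} |(φ_t * f)(x)| dx`. -/
def hardyNorm {n : ℕ} (f : E n → ℂ) : ℝ≥0∞ :=
  ∫⁻ x : E n, ⨆ (t : ℝ) (_ : 0 < t), ‖∫ y : E n, (gauss t (x - y) : ℂ) * f y‖ₑ

/-- Membership in the (Fefferman–Stein) Hardy space `H¹(ℝⁿ)`. -/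
def MemHardy {n : ℕ} (f : E n → ℂ) : Prop :=
  Integrable f volume ∧ hardyNorm f < ⊤

/-- `𝒫` is uniformly `H¹_comp`-`L¹_loc`-bounded: for every compact `K` there is one constant `C`
such that, for every translate `K + h` and every test function `u ∈ H¹` supported in `K + h`,
the `L¹(K + h)` norm of `𝒫 u` is at most `C ‖u‖_{H¹}`. -/
def UnifLocHardyBounded {n : ℕ} (Φ : E3 n → ℝ) (a : E3 n → ℂ) : Prop :=
  ∀ K : Set (E n), IsCompact K →
    ∃ C : ℝ≥0, ∀ h : E n, ∀ u : E n → ℂ,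
      IsTest u → MemHardy u → tsupport u ⊆ (fun x => x + h) '' K →
        ∃ f : E n → ℂ, Represents Φ a u f ∧
          ∫⁻ x in (fun x => x + h) '' K, ‖f x‖ₑ ≤ C * hardyNorm u

end FourierInt

end

/-! Put m = (n-1)/2. The case p = 2 is (A2), and p > 2 follows from p < 2 applied to the adjoint, so
let 1 < p < 2, θ = 2/p - 1 and q the conjugate exponent. An amplitude of order -mθ lies between
order 0, where L² bounds are assumed, and order -m, where local Hardy bounds are assumed. The proof
is a Stein interpolation between these two endpoints, carried out by hand on absolutely convergent
regularised forms `Bil`, with the factor g(εξ) in the amplitude and constants independent of ε.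

Atoms. By (A1) the derivatives ∂_{ξ_j}Φ are bounded. Hence the phase is non-stationary in ξ_j once
|x_j - y_j| is large, and n + 1 integrations by parts make the kernel O(|x-y|^{-(n+1)}) far from the
diagonal (`far_kernel`). Near an atom (A3) applies, at the same cost for every translate; far from
it the kernel is integrable. So atoms have images bounded in L¹(ℝⁿ) (`exists_atom_bound`). Atoms of
radius at least 1 need no cancellation, because L² boundedness with Cauchy–Schwarz replaces the
Hardy bound near them.

Uniformity. The hypotheses give a constant for each single amplitude, whereas interpolation needs
one constant for all amplitudes e^{-t²}⟨ξ⟩^{-imt} g(εξ) A. This family is bounded in every symbol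
estimate, the Gaussian absorbing the powers of t. Any ℓ¹ series in a bounded family is again a
symbol, so Banach–Steinhaus on ℓ¹ produces the common constant (`uniform_of_forall`).

Decomposition. A dyadic step function f is the sum of the differences between its Calderón–Zygmund
good parts at consecutive heights λ_j = μ2^j. Such a `layer` at height λ is O(λ), lives on the set
Lev(λ) where a dyadic average of |f| exceeds λ, and has mean zero on every stopping cube of side
less than 1. It is thus a combination of atoms, and its form against any |v| ≤ 1 is O(λ|Lev(λ)|) in
order -m (`norm_Bil_layer_le`).

Interpolation. The amplitude a⟨ξ⟩^{m(θ-z)} is paired with ∑ λ_j^{p(1+z)/2-1} layer_j and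
|v|^{q(1-z)/2} sgn v. On Re z = 0 the L² bound applies, on Re z = 1 the atomic bound, and both are
controlled by ∑ λ_j^p |Lev(λ_j)| ≤ C‖f‖_p^p (`integral_sum_layer_sq_le`, `levelSum_le`). At z = θ
the families are a, f and v themselves, and the three lines theorem gives |⟨𝒫f, v⟩| ≤ C‖f‖_p‖v‖_q
(`norm_Bil_le_interp`, `exists_interp_bound`). Approximation, the limit ε → 0 and the converse of
Hölder's inequality finish the proof. -/

noncomputable section

namespace FourierInt

/-! ### Symbol estimates as a recursion over directional derivatives, uniform in a family. -/

section SymbolCalculus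

variable {S : Type*} [NormedAddCommGroup S] [NormedSpace ℝ S]
  {F : Type*} [NormedAddCommGroup F] [NormedSpace ℝ F] {D ι : Type*}

/-- The directional derivative of `a` in the direction `v`. -/
def pd (v : S) (a : S → F) : S → F := fun p => fderiv ℝ a p v

/-- Symbol estimates up to order `k`, uniform in a family: the family `a` is `O(J ^ κ)`, and each
derivative in the direction `e d` lowers the order by `o d`. -/
def SymB (J : S → ℝ) (e : D → S) (o : D → ℝ) : ℕ → ℝ → (ι → S → F) → Prop
  | 0, κ, a => ∃ C : ℝ, ∀ i p, ‖a i p‖ ≤ C * J p ^ κ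
  | k + 1, κ, a => (∃ C : ℝ, ∀ i p, ‖a i p‖ ≤ C * J p ^ κ) ∧
      ∀ d, SymB J e o k (κ - o d) (fun i => pd (e d) (a i))

variable {J : S → ℝ} {e : D → S} {o : D → ℝ}

lemma SymB.bound {k : ℕ} {κ : ℝ} {a : ι → S → F} (h : SymB J e o k κ a) :
    ∃ C : ℝ, ∀ i p, ‖a i p‖ ≤ C * J p ^ κ := by
  cases k with
  | zero => exact h
  | succ k => exact h.1

lemma SymB.bound_nonneg {k : ℕ} {κ : ℝ} {a : ι → S → F} (hJ : ∀ p, 0 < J p)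
    (h : SymB J e o k κ a) : ∃ C : ℝ, 0 ≤ C ∧ ∀ i p, ‖a i p‖ ≤ C * J p ^ κ := by
  obtain ⟨C, hC⟩ := h.bound
  refine ⟨|C|, abs_nonneg _, fun i p => (hC i p).trans ?_⟩
  have := (Real.rpow_pos_of_pos (hJ p) κ).le
  gcongr
  exact le_abs_self C

lemma SymB.pred {k : ℕ} : ∀ {κ : ℝ} {a : ι → S → F}, SymB J e o (k + 1) κ a → SymB J e o k κ a := by
  induction k with
  | zero => intro κ a h; exact h.1
  | succ k ih => intro κ a h; exact ⟨h.1, fun d => ih (h.2 d)⟩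

lemma SymB.mono (hJ : ∀ p, 1 ≤ J p) {k : ℕ} :
    ∀ {κ κ' : ℝ} {a : ι → S → F}, κ ≤ κ' → SymB J e o k κ a → SymB J e o k κ' a := by
  have key : ∀ {κ κ' : ℝ} {a : ι → S → F}, κ ≤ κ' → (∃ C : ℝ, ∀ i p, ‖a i p‖ ≤ C * J p ^ κ) →
      ∃ C : ℝ, ∀ i p, ‖a i p‖ ≤ C * J p ^ κ' := by
    rintro κ κ' a hk ⟨C, hC⟩
    refine ⟨|C|, fun i p => (hC i p).trans ?_⟩
    have h1 := Real.rpow_le_rpow_of_exponent_le (hJ p) hk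
    have h2 : 0 ≤ J p ^ κ := Real.rpow_nonneg (by linarith [hJ p]) _
    calc C * J p ^ κ ≤ |C| * J p ^ κ := by gcongr; exact le_abs_self C
      _ ≤ _ := by gcongr
  induction k with
  | zero => intro κ κ' a hk h; exact key hk h
  | succ k ih => intro κ κ' a hk h; exact ⟨key hk h.1, fun d => ih (by linarith) (h.2 d)⟩

lemma SymB.reindex {ι' : Type*} (f : ι' → ι) {k : ℕ} :
    ∀ {κ : ℝ} {a : ι → S → F}, SymB J e o k κ a → SymB J e o k κ (fun i => a (f i)) := by
  induction k with
  | zero => rintro κ a ⟨C, hC⟩; exact ⟨C, fun i p => hC _ p⟩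
  | succ k ih =>
    rintro κ a ⟨⟨C, hC⟩, h⟩; exact ⟨⟨C, fun i p => hC _ p⟩, fun d => ih (h d)⟩

lemma contDiff_pd {a : S → F} (ha : ContDiff ℝ ∞ a) (v : S) : ContDiff ℝ ∞ (pd v a) := by
  have : ContDiff ℝ ∞ (fderiv ℝ a) := ha.fderiv_right (by simp)
  exact this.clm_apply contDiff_const

lemma contDiff_diff {a : S → F} (ha : ContDiff ℝ ∞ a) : Differentiable ℝ a :=
  ha.differentiable (by simp)

lemma pd_add {a b : S → F} (ha : ContDiff ℝ ∞ a) (hb : ContDiff ℝ ∞ b) (v : S) :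
    pd v (fun p => a p + b p) = fun p => pd v a p + pd v b p := by
  funext p
  simp only [pd]
  rw [fderiv_fun_add (contDiff_diff ha p) (contDiff_diff hb p)]
  rfl

lemma pd_mul {a b : S → ℂ} (ha : ContDiff ℝ ∞ a) (hb : ContDiff ℝ ∞ b) (v : S) :
    pd v (fun p => a p * b p) = fun p => pd v a p * b p + a p * pd v b p := by
  funext p
  simp only [pd]
  rw [fderiv_fun_mul (contDiff_diff ha p) (contDiff_diff hb p)]
  simp only [add_apply, smul_apply, smul_eq_mul]
  ring

lemma SymB.add {k : ℕ} : ∀ {κ : ℝ} {a b : ι → S → F}, (∀ i, ContDiff ℝ ∞ (a i)) →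
    (∀ i, ContDiff ℝ ∞ (b i)) → SymB J e o k κ a → SymB J e o k κ b →
    SymB J e o k κ (fun i p => a i p + b i p) := by
  have key : ∀ {κ : ℝ} {a b : ι → S → F}, (∃ C : ℝ, ∀ i p, ‖a i p‖ ≤ C * J p ^ κ) →
      (∃ C : ℝ, ∀ i p, ‖b i p‖ ≤ C * J p ^ κ) →
      ∃ C : ℝ, ∀ i p, ‖a i p + b i p‖ ≤ C * J p ^ κ := by
    rintro κ a b ⟨C, hC⟩ ⟨C', hC'⟩
    refine ⟨C + C', fun i p => (norm_add_le _ _).trans ?_⟩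
    linarith [hC i p, hC' i p]
  induction k with
  | zero => intro κ a b _ _ ha hb; exact key ha hb
  | succ k ih =>
    intro κ a b sa sb ha hb
    refine ⟨key ha.1 hb.1, fun d => ?_⟩
    simp only [pd_add (sa _) (sb _)]
    exact ih (fun i => contDiff_pd (sa i) _) (fun i => contDiff_pd (sb i) _) (ha.2 d) (hb.2 d)

/-- By the Leibniz rule each derivative falls on one factor and lowers the order of that factor
alone, so orders add. The other factor is then used with one derivative fewer. -/
lemma SymB.mul (hJ : ∀ p, 0 < J p) {k : ℕ} : ∀ {κ μ : ℝ} {a b : ι → S → ℂ},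
    (∀ i, ContDiff ℝ ∞ (a i)) → (∀ i, ContDiff ℝ ∞ (b i)) → SymB J e o k κ a →
    SymB J e o k μ b → SymB J e o k (κ + μ) (fun i p => a i p * b i p) := by
  have key : ∀ {k : ℕ} {κ μ : ℝ} {a b : ι → S → ℂ}, SymB J e o k κ a → SymB J e o k μ b →
      ∃ C : ℝ, ∀ i p, ‖a i p * b i p‖ ≤ C * J p ^ (κ + μ) := by
    intro k κ μ a b ha hb
    obtain ⟨C, hC0, hC⟩ := ha.bound_nonneg hJ
    obtain ⟨C', hC0', hC'⟩ := hb.bound_nonneg hJ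
    refine ⟨C * C', fun i p => ?_⟩
    rw [norm_mul, Real.rpow_add (hJ p)]
    calc _ ≤ (C * J p ^ κ) * (C' * J p ^ μ) := by
          have := (Real.rpow_pos_of_pos (hJ p) κ).le
          gcongr
          exacts [hC i p, hC' i p]
      _ = _ := by ring
  induction k with
  | zero => intro κ μ a b _ _ ha hb; exact key ha hb
  | succ k ih =>
    intro κ μ a b sa sb ha hb
    refine ⟨key ha hb, fun d => ?_⟩
    simp only [pd_mul (sa _) (sb _)]
    refine SymB.add (fun i => (contDiff_pd (sa i) _).mul (sb i)) (fun i => (sa i).mul (contDiff_pd (sb i) _)) ?_ ?_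
    · have := ih (fun i => contDiff_pd (sa i) _) sb (ha.2 d) hb.pred
      rwa [show κ - o d + μ = κ + μ - o d by ring] at this
    · have := ih sa (fun i => contDiff_pd (sb i) _) ha.pred (hb.2 d)
      rwa [show κ + (μ - o d) = κ + μ - o d by ring] at this

lemma symB_const {F : Type*} [NormedAddCommGroup F] [NormedSpace ℝ F] (c : F)
    (κ : ℝ) (hκ : κ = 0 ∨ c = 0) (k : ℕ) :
    SymB J e o k κ (fun (_ : ι) (_ : S) => c) := by
  induction k generalizing κ c with
  | zero =>
    refine ⟨‖c‖, fun i p => ?_⟩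
    rcases hκ with rfl | rfl <;> simp
  | succ k ih =>
    refine ⟨⟨‖c‖, fun i p => ?_⟩, fun d => ?_⟩
    · rcases hκ with rfl | rfl <;> simp
    · have : (fun (_ : ι) => pd (e d) (fun _ : S => c)) = fun _ _ => (0 : F) := by
        funext i p; simp [pd]
      rw [this]
      exact ih _ _ (Or.inr rfl)

lemma SymB.const_mul (hJ : ∀ p, 0 < J p) {k : ℕ} {κ : ℝ} {a : ι → S → ℂ}
    (sa : ∀ i, ContDiff ℝ ∞ (a i)) (ha : SymB J e o k κ a) (c : ℂ) :
    SymB J e o k κ (fun i p => c * a i p) := by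
  have := SymB.mul hJ (fun _ => contDiff_const) sa
    (symB_const (J := J) (e := e) (o := o) (ι := ι) c 0 (Or.inl rfl) k) ha
  rwa [zero_add] at this

/-- Iterated directional derivatives along a list of directions. -/
def pdl (l : List S) (a : S → F) : S → F := l.foldr pd a

lemma pdl_smooth {a : S → F} (ha : ContDiff ℝ ∞ a) (l : List S) : ContDiff ℝ ∞ (pdl l a) := by
  induction l with
  | nil => exact ha
  | cons v l ih => exact contDiff_pd ih v

lemma pd_comm {a : S → F} (ha : ContDiff ℝ ∞ a) (v w : S) : pd v (pd w a) = pd w (pd v a) := by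
  funext p
  have h1 : ContDiff ℝ ∞ (fderiv ℝ a) := ha.fderiv_right (by simp)
  have h2 := (ha.contDiffAt (x := p)).isSymmSndFDerivAt
    (by rw [minSmoothness_of_isRCLikeNormedField]; exact ENat.LEInfty.out)
  have h3 : ∀ w v, pd v (pd w a) p = fderiv ℝ (fderiv ℝ a) p v w := by
    intro w v
    have : HasFDerivAt (fun q => fderiv ℝ a q w) _ p :=
      ((contDiff_diff h1 p).hasFDerivAt.clm_apply (hasFDerivAt_const w p))
    change fderiv ℝ (fun q => fderiv ℝ a q w) p v = _
    rw [this.fderiv]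
    simp
  rw [h3, h3]
  exact h2 v w

/-- Directional derivatives of a smooth function commute. This is needed because `SymB`
differentiates in arbitrary order, while `mixedDeriv` always sorts the directions as x, y, ξ. -/
lemma pdl_perm {a : S → F} (ha : ContDiff ℝ ∞ a) {l l' : List S} (h : l.Perm l') :
    pdl l a = pdl l' a := by
  induction h with
  | nil => rfl
  | cons x _ ih => simp only [pdl, List.foldr_cons] at ih ⊢; rw [ih]
  | swap x y l => exact pd_comm (pdl_smooth ha l) _ _
  | trans _ _ h1 h2 => exact h1.trans h2

lemma iteratedFDeriv_eq_pdl {a : S → F} (ha : ContDiff ℝ ∞ a) :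
    ∀ (k : ℕ) (m : Fin k → S) (p : S), iteratedFDeriv ℝ k a p m = pdl (List.ofFn m) a p := by
  intro k
  induction k with
  | zero => intro m p; simp [pdl]
  | succ k ih =>
    intro m p
    have hd : DifferentiableAt ℝ (iteratedFDeriv ℝ k a) p :=
      (ha.differentiable_iteratedFDeriv (m := k) (by exact_mod_cast WithTop.coe_lt_top _)) p
    rw [iteratedFDeriv_succ_apply_left, List.ofFn_succ]
    simp only [pdl, List.foldr_cons]
    have h1 : (fun q => iteratedFDeriv ℝ k a q (Fin.tail m)) = pdl (List.ofFn (Fin.tail m)) a :=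
      funext fun q => ih _ _
    change _ = pd (m 0) (pdl (List.ofFn (Fin.tail m)) a) p
    rw [← h1]
    simp only [pd]
    rw [fderiv_continuousMultilinear_apply_const_apply hd]

/-- The recursion peels off the innermost derivative, which is the last entry of the list; hence the
induction on lists from the right. -/
lemma symB_iff_pdl {κ : ℝ} {a : ι → S → F} :
    (∀ k, SymB J e o k κ a) ↔
      ∀ l : List D, ∃ C : ℝ, ∀ i p, ‖pdl (l.map e) (a i) p‖ ≤ C * J p ^ (κ - (l.map o).sum) := by
  constructor
  · intro h l
    induction l using List.reverseRecOn generalizing κ a with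
    | nil => simpa [pdl] using (h 0).bound
    | append_singleton l d ih =>
      have := ih (κ := κ - o d) (a := fun i => pd (e d) (a i)) (fun k => (h (k + 1)).2 d)
      obtain ⟨C, hC⟩ := this
      refine ⟨C, fun i p => ?_⟩
      have := hC i p
      simp only [pdl, List.map_append, List.map_cons, List.map_nil, List.foldr_append,
        List.foldr_cons, List.foldr_nil, List.sum_append, List.sum_cons, List.sum_nil] at this ⊢
      rwa [show κ - ((l.map o).sum + (o d + 0)) = κ - o d - (l.map o).sum by ring]
  · intro h k
    induction k generalizing κ a with
    | zero => simpa [pdl, SymB] using h []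
    | succ k ih =>
      refine ⟨by simpa [pdl] using h [], fun d => ih fun l => ?_⟩
      obtain ⟨C, hC⟩ := h (l ++ [d])
      refine ⟨C, fun i p => ?_⟩
      have := hC i p
      simp only [pdl, List.map_append, List.map_cons, List.map_nil, List.foldr_append,
        List.foldr_cons, List.foldr_nil, List.sum_append, List.sum_cons, List.sum_nil] at this ⊢
      rwa [show κ - ((l.map o).sum + (o d + 0)) = κ - o d - (l.map o).sum by ring] at this

end SymbolCalculus

/-! ### The classes S^κ expressed through the recursive estimates. -/

section Symbols

variable {n : ℕ} {F : Type*} [NormedAddCommGroup F] [NormedSpace ℝ F] {ι : Type*}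

/-- Labels for the coordinate directions in `x`, `y` and `ξ`. -/
abbrev Dir (n : ℕ) : Type := Fin n ⊕ Fin n ⊕ Fin n

def dirVec : Dir n → E3 n
  | .inl j => dirX j
  | .inr (.inl j) => dirY j
  | .inr (.inr j) => dirXi j

def dirOrd : Dir n → ℝ
  | .inr (.inr _) => 1
  | _ => 0

/-- Symbol estimates of order `κ` up to `k` derivatives, uniform in a family. -/
abbrev SymE3 (k : ℕ) (κ : ℝ) (a : ι → E3 n → F) : Prop :=
  SymB (fun p : E3 n => jap p.2.2) dirVec dirOrd k κ a

lemma one_le_jap (ξ : E n) : 1 ≤ jap ξ := by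
  rw [jap, Real.one_le_sqrt]; nlinarith [sq_nonneg ‖ξ‖]

lemma jap_pos (ξ : E n) : 0 < jap ξ := one_pos.trans_le (one_le_jap ξ)

lemma exists_sorted_perm (l : List (Dir n)) : ∃ α β γ : List (Fin n),
    l.Perm (α.map Sum.inl ++ β.map (fun j => Sum.inr (Sum.inl j)) ++
      γ.map (fun j => Sum.inr (Sum.inr j))) := by
  induction l with
  | nil => exact ⟨[], [], [], by simp⟩
  | cons d l ih =>
    obtain ⟨α, β, γ, h⟩ := ih
    rcases d with j | j | j
    · exact ⟨j :: α, β, γ, by simpa using h⟩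
    · refine ⟨α, j :: β, γ, (h.cons _).trans ?_⟩
      simp only [List.map_cons, List.append_assoc, List.cons_append]
      exact List.perm_middle.symm
    · refine ⟨α, β, j :: γ, (h.cons _).trans ?_⟩
      simp only [List.map_cons]
      exact List.perm_middle.symm

lemma mixedDeriv_eq_pdl {a : E3 n → F} (ha : ContDiff ℝ ∞ a) {r s t : ℕ} (α : Fin r → Fin n)
    (β : Fin s → Fin n) (γ : Fin t → Fin n) (p : E3 n) :
    mixedDeriv α β γ a p = pdl (((List.ofFn α).map Sum.inl ++
      (List.ofFn β).map (fun j => Sum.inr (Sum.inl j)) ++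
      (List.ofFn γ).map (fun j => Sum.inr (Sum.inr j)) : List (Dir n)).map dirVec) a p := by
  rw [mixedDeriv, iteratedFDeriv_eq_pdl ha]
  congr 1
  simp only [List.ofFn_fin_append, List.map_append, List.map_ofFn]
  rfl

lemma dirOrd_sum (α β γ : List (Fin n)) :
    ((α.map Sum.inl ++ β.map (fun j => Sum.inr (Sum.inl j)) ++
      γ.map (fun j => Sum.inr (Sum.inr j)) : List (Dir n)).map dirOrd).sum = γ.length := by
  simp only [List.map_append, List.map_map, List.sum_append]
  have h1 : (dirOrd ∘ Sum.inl : Fin n → ℝ) = fun _ => 0 := rfl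
  have h2 : (dirOrd ∘ (fun j => Sum.inr (Sum.inl j)) : Fin n → ℝ) = fun _ => 0 := rfl
  have h3 : (dirOrd ∘ (fun j => Sum.inr (Sum.inr j)) : Fin n → ℝ) = fun _ => 1 := rfl
  simp [h1, h2, h3]

/-- Sorting the directions of an iterated derivative turns it into a `mixedDeriv`, and the orders of
the directions add up to the number of ξ-derivatives. All symbol calculus is done on the recursive
side. -/
lemma isSymbol_iff {κ : ℝ} {a : E3 n → F} :
    IsSymbol κ a ↔ ContDiff ℝ ∞ a ∧ ∀ k, SymE3 k κ (fun _ : Unit => a) := by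
  refine ⟨fun h => ⟨h.1, symB_iff_pdl.2 fun l => ?_⟩, fun h => ⟨h.1, fun r s t α β γ => ?_⟩⟩
  · obtain ⟨α, β, γ, hl⟩ := exists_sorted_perm l
    obtain ⟨C, hC⟩ := h.2 α.length β.length γ.length α.get β.get γ.get
    refine ⟨C, fun _ p => ?_⟩
    have := hC p.1 p.2.1 p.2.2
    rw [mixedDeriv_eq_pdl h.1] at this
    simp only [List.ofFn_get] at this
    rw [pdl_perm h.1 (hl.map dirVec), (hl.map dirOrd).sum_eq, dirOrd_sum]
    exact this
  · obtain ⟨C, hC⟩ := symB_iff_pdl.1 h.2 ((List.ofFn α).map Sum.inl ++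
      (List.ofFn β).map (fun j => Sum.inr (Sum.inl j)) ++
      (List.ofFn γ).map (fun j => Sum.inr (Sum.inr j)))
    refine ⟨C, fun x y ξ => ?_⟩
    rw [mixedDeriv_eq_pdl h.1]
    have := hC () (x, y, ξ)
    rw [dirOrd_sum] at this
    simpa using this

lemma IsSymbol.mono {κ κ' : ℝ} {a : E3 n → F} (h : IsSymbol κ a) (hk : κ ≤ κ') :
    IsSymbol κ' a := by
  rw [isSymbol_iff] at h ⊢
  exact ⟨h.1, fun k => (h.2 k).mono (fun p => one_le_jap _) hk⟩

lemma IsSymbol.mul {κ μ : ℝ} {a b : E3 n → ℂ} (ha : IsSymbol κ a) (hb : IsSymbol μ b) :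
    IsSymbol (κ + μ) (fun p => a p * b p) := by
  rw [isSymbol_iff] at ha hb ⊢
  exact ⟨ha.1.mul hb.1, fun k => SymB.mul (fun p => jap_pos _) (fun _ => ha.1) (fun _ => hb.1)
    (ha.2 k) (hb.2 k)⟩

lemma IsSymbol.bound {κ : ℝ} {a : E3 n → F} (ha : IsSymbol κ a) :
    ∃ C : ℝ, 0 ≤ C ∧ ∀ p, ‖a p‖ ≤ C * jap p.2.2 ^ κ := by
  obtain ⟨C, h0, hC⟩ := ((isSymbol_iff.1 ha).2 0).bound_nonneg (fun p => jap_pos _)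
  exact ⟨C, h0, fun p => hC () p⟩

end Symbols

/-! ### Uniform families of symbols: powers of ⟨ξ⟩, dilated cut-offs, interchange and freezing of x
and y. -/

section Families

variable {n : ℕ} {F : Type*} [NormedAddCommGroup F] [NormedSpace ℝ F]
  {F' : Type*} [NormedAddCommGroup F'] [NormedSpace ℝ F'] {ι : Type*}

lemma pd_comp_clm {S S' : Type*} [NormedAddCommGroup S] [NormedSpace ℝ S]
    [NormedAddCommGroup S'] [NormedSpace ℝ S'] {b : S' → F} (hb : ContDiff ℝ ∞ b)
    (L : S →L[ℝ] S') (v : S) : pd v (fun p => b (L p)) = fun p => pd (L v) b (L p) := by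
  funext p
  have := (contDiff_diff hb (L p)).hasFDerivAt.comp p L.hasFDerivAt
  change fderiv ℝ (b ∘ L) p v = _
  rw [this.fderiv]
  rfl

/-- The projection to the frequency variable. -/
def projXi (n : ℕ) : E3 n →L[ℝ] E n :=
  (ContinuousLinearMap.snd ℝ (E n) (E n)).comp (ContinuousLinearMap.snd ℝ (E n) (E n × E n))

@[simp] lemma projXi_apply (p : E3 n) : projXi n p = p.2.2 := rfl

lemma pd_dirXi_lift {b : E n → F} (hb : ContDiff ℝ ∞ b) (j : Fin n) :
    pd (dirXi j) (fun p : E3 n => b p.2.2) =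
      fun p => pd (EuclideanSpace.single j (1 : ℝ)) b p.2.2 :=
  pd_comp_clm hb (projXi n) _

lemma pd_dirX_lift {b : E n → F} (hb : ContDiff ℝ ∞ b) (j : Fin n) :
    pd (dirX j) (fun p : E3 n => b p.2.2) = fun _ => 0 := by
  refine (pd_comp_clm hb (projXi n) _).trans ?_
  funext p; simp [pd, dirX]

lemma pd_dirY_lift {b : E n → F} (hb : ContDiff ℝ ∞ b) (j : Fin n) :
    pd (dirY j) (fun p : E3 n => b p.2.2) = fun _ => 0 := by
  refine (pd_comp_clm hb (projXi n) _).trans ?_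
  funext p; simp [pd, dirY]

lemma contDiff_lift {b : E n → F} (hb : ContDiff ℝ ∞ b) :
    ContDiff ℝ ∞ (fun p : E3 n => b p.2.2) := hb.comp (projXi n).contDiff

/-- For a function of ξ alone the x- and y-derivatives vanish, so only the ξ-derivatives have to be
estimated. -/
lemma symE3_succ_lift {k : ℕ} {κ : ℝ} {b : ι → E n → F} (hb : ∀ i, ContDiff ℝ ∞ (b i))
    (h0 : ∃ C : ℝ, ∀ i ξ, ‖b i ξ‖ ≤ C * jap ξ ^ κ)
    (h1 : ∀ j : Fin n, SymE3 k (κ - 1)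
      (fun i (p : E3 n) => pd (EuclideanSpace.single j (1 : ℝ)) (b i) p.2.2)) :
    SymE3 (k + 1) κ (fun i (p : E3 n) => b i p.2.2) := by
  obtain ⟨C, hC⟩ := h0
  refine ⟨⟨C, fun i p => hC i _⟩, ?_⟩
  rintro (j | j | j)
  · simp only [dirVec, pd_dirX_lift (hb _)]
    exact symB_const (J := fun p : E3 n => jap p.2.2) (0 : F) _ (Or.inr rfl) k
  · simp only [dirVec, pd_dirY_lift (hb _)]
    exact symB_const (J := fun p : E3 n => jap p.2.2) (0 : F) _ (Or.inr rfl) k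
  · simp only [dirVec, pd_dirXi_lift (hb _)]
    exact h1 j

/-- The complex power `⟨ξ⟩ ^ w`. -/
def japC (w : ℂ) (ξ : E n) : ℂ := Complex.exp (w * (Real.log (jap ξ) : ℂ))

lemma norm_japC (w : ℂ) (ξ : E n) : ‖japC w ξ‖ = jap ξ ^ w.re := by
  rw [japC, Complex.norm_exp, Real.rpow_def_of_pos (jap_pos ξ)]
  simp [mul_comm]

lemma japC_add (w z : ℂ) (ξ : E n) : japC (w + z) ξ = japC w ξ * japC z ξ := by
  rw [japC, add_mul, Complex.exp_add]; rfl

lemma log_jap (ξ : E n) : Real.log (jap ξ) = Real.log (1 + ‖ξ‖ ^ 2) / 2 := by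
  rw [jap, Real.log_sqrt (by positivity)]

lemma contDiff_log_jap : ContDiff ℝ ∞ (fun ξ : E n => Real.log (jap ξ)) := by
  simp only [log_jap]
  exact ((contDiff_const.add (contDiff_norm_sq ℝ)).log (fun ξ => by positivity)).div_const _

lemma contDiff_japC (w : ℂ) : ContDiff ℝ ∞ (japC w : E n → ℂ) := by
  have : ContDiff ℝ ∞ (fun ξ : E n => ((Real.log (jap ξ) : ℝ) : ℂ)) :=
    Complex.ofRealCLM.contDiff.comp contDiff_log_jap
  exact (contDiff_const.mul this).cexp

lemma pd_japC (w : ℂ) (j : Fin n) : pd (EuclideanSpace.single j (1 : ℝ)) (japC w : E n → ℂ) =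
    fun ξ => w * ((ξ j : ℝ) : ℂ) * japC (w - 2) ξ := by
  funext ξ
  have hlog : HasFDerivAt (fun ξ : E n => Real.log (1 + ‖ξ‖ ^ 2) / 2)
      ((2 : ℝ)⁻¹ • ((1 + ‖ξ‖ ^ 2)⁻¹ • (2 • innerSL ℝ ξ))) ξ := by
    have h1 := (((hasStrictFDerivAt_norm_sq ξ).hasFDerivAt.const_add (1 : ℝ)).log
      (by positivity)).mul_const (2 : ℝ)⁻¹
    simpa only [div_eq_mul_inv] using h1
  have h2 : HasFDerivAt (fun ξ : E n => ((Real.log (1 + ‖ξ‖ ^ 2) / 2 : ℝ) : ℂ)) _ ξ :=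
    Complex.ofRealCLM.hasFDerivAt.comp ξ hlog
  have h3 := (h2.const_mul w).cexp
  have h4 : (japC w : E n → ℂ) =
      fun ξ => Complex.exp (w * ((Real.log (1 + ‖ξ‖ ^ 2) / 2 : ℝ) : ℂ)) := by
    funext η; rw [japC, log_jap]
  have h5 : Complex.exp (-2 * ((Real.log (jap ξ) : ℝ) : ℂ)) = ((1 + ‖ξ‖ ^ 2 : ℝ) : ℂ)⁻¹ := by
    rw [log_jap]
    have : (-2 * ((Real.log (1 + ‖ξ‖ ^ 2) / 2 : ℝ) : ℂ)) =
      ((-(Real.log (1 + ‖ξ‖ ^ 2)) : ℝ) : ℂ) := by push_cast; ring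
    rw [this, ← Complex.ofReal_exp, Real.exp_neg, Real.exp_log (by positivity)]
    push_cast; rfl
  simp only [pd]
  rw [h4, h3.fderiv, sub_eq_add_neg, japC_add, ← log_jap]
  have h6 : japC (-2) ξ = ((1 + ‖ξ‖ ^ 2 : ℝ) : ℂ)⁻¹ := h5
  rw [h6]
  simp only [japC, smul_apply, smul_eq_mul, ContinuousLinearMap.comp_apply,
    Complex.ofRealCLM_apply, innerSL_apply_apply, EuclideanSpace.inner_single_right]
  simp
  ring

lemma abs_coord_le_jap (ξ : E n) (j : Fin n) : |ξ j| ≤ jap ξ := by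
  refine (PiLp.norm_apply_le ξ j).trans ?_
  rw [jap]
  exact Real.le_sqrt_of_sq_le (by linarith)

lemma symE3_coord (k : ℕ) (j : Fin n) :
    SymE3 k 1 (fun (_ : ι) (p : E3 n) => ((p.2.2 j : ℝ) : ℂ)) := by
  have hs : ContDiff ℝ ∞ (fun ξ : E n => ((ξ j : ℝ) : ℂ)) :=
    Complex.ofRealCLM.contDiff.comp (EuclideanSpace.proj (𝕜 := ℝ) j).contDiff
  have hb : ∃ C : ℝ, ∀ (_ : ι) (ξ : E n), ‖((ξ j : ℝ) : ℂ)‖ ≤ C * jap ξ ^ (1 : ℝ) :=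
    ⟨1, fun _ ξ => by simpa using abs_coord_le_jap ξ j⟩
  cases k with
  | zero => obtain ⟨C, hC⟩ := hb; exact ⟨C, fun i p => hC i _⟩
  | succ k =>
    refine symE3_succ_lift (b := fun (_ : ι) (ξ : E n) => ((ξ j : ℝ) : ℂ)) (fun _ => hs) hb
      fun j' => ?_
    have : pd (EuclideanSpace.single j' (1 : ℝ)) (fun ξ : E n => ((ξ j : ℝ) : ℂ)) =
        fun _ => (((EuclideanSpace.single j' (1 : ℝ) : E n) j : ℝ) : ℂ) := by
      funext ξ
      have := Complex.ofRealCLM.hasFDerivAt.comp ξ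
        (EuclideanSpace.proj j : E n →L[ℝ] ℝ).hasFDerivAt
      exact congrArg (fun L => L (EuclideanSpace.single j' (1 : ℝ))) this.fderiv
    simp only [this, sub_self]
    exact symB_const _ _ (Or.inl rfl) k

/-- Each derivative of ⟨ξ⟩^{ict} costs a factor t, and the Gaussian pays for it. The same bound
later makes Gaussian differences uniform in the scale. -/
lemma exists_pow_mul_exp_bound (q : ℕ) : ∃ C : ℝ, ∀ t : ℝ, |t ^ q * Real.exp (-t ^ 2)| ≤ C := by
  refine ⟨q.factorial * Real.exp 1, fun t => ?_⟩
  rw [abs_mul, abs_pow, abs_of_pos (Real.exp_pos _)]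
  have h1 := Real.pow_div_factorial_le_exp |t| (abs_nonneg t) q
  rw [div_le_iff₀ (by positivity)] at h1
  have h2 : Real.exp |t| * Real.exp (-t ^ 2) ≤ Real.exp 1 := by
    rw [← Real.exp_add]
    apply Real.exp_le_exp.2
    nlinarith [sq_abs t, sq_nonneg (|t| - 1), abs_nonneg t]
  calc |t| ^ q * Real.exp (-t ^ 2) ≤ (Real.exp |t| * q.factorial) * Real.exp (-t ^ 2) := by gcongr
    _ = q.factorial * (Real.exp |t| * Real.exp (-t ^ 2)) := by ring
    _ ≤ _ := by gcongr

/-- The powers `t ^ q e^{-t²} ⟨ξ⟩ ^ {s + i c t}`, uniformly in `t`. -/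
lemma symE3_japC_family (c : ℝ) (k : ℕ) : ∀ (q : ℕ) (s : ℝ), SymE3 k s
    (fun (t : ℝ) (p : E3 n) => ((t ^ q * Real.exp (-t ^ 2) : ℝ) : ℂ) *
      japC (s + Complex.I * c * t) p.2.2) := by
  have hb : ∀ (q : ℕ) (s : ℝ), ∃ C : ℝ, ∀ (t : ℝ) (ξ : E n),
      ‖((t ^ q * Real.exp (-t ^ 2) : ℝ) : ℂ) * japC (s + Complex.I * c * t) ξ‖ ≤
        C * jap ξ ^ s := by
    intro q s
    obtain ⟨C, hC⟩ := exists_pow_mul_exp_bound q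
    refine ⟨C, fun t ξ => ?_⟩
    rw [norm_mul, norm_japC, Complex.norm_real, Real.norm_eq_abs]
    have h1 : (s + Complex.I * c * t : ℂ).re = s := by simp
    rw [h1]
    have := (Real.rpow_pos_of_pos (jap_pos ξ) s).le
    gcongr
    exact hC t
  induction k with
  | zero => intro q s; obtain ⟨C, hC⟩ := hb q s; exact ⟨C, fun i p => hC i _⟩
  | succ k ih =>
    intro q s
    refine symE3_succ_lift (b := fun (t : ℝ) (ξ : E n) => ((t ^ q * Real.exp (-t ^ 2) : ℝ) : ℂ) *
      japC (s + Complex.I * c * t) ξ) (fun t => contDiff_const.mul (contDiff_japC _)) (hb q s)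
      fun j => ?_
    -- The derivative of ⟨ξ⟩^{s+ict} is (s + ict) ξ_j ⟨ξ⟩^{s-2+ict}. The factor t is moved into
    -- t^{q+1}, so both terms belong again to the family; this is why the induction runs over all q
    -- and s.
    have hd : ∀ t : ℝ, pd (EuclideanSpace.single j (1 : ℝ)) (fun ξ : E n =>
        ((t ^ q * Real.exp (-t ^ 2) : ℝ) : ℂ) * japC (s + Complex.I * c * t) ξ) =
        fun ξ => ((ξ j : ℝ) : ℂ) * ((s : ℂ) * (((t ^ q * Real.exp (-t ^ 2) : ℝ) : ℂ) *
          japC ((s - 2 : ℝ) + Complex.I * c * t) ξ) + (Complex.I * c) *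
          (((t ^ (q + 1) * Real.exp (-t ^ 2) : ℝ) : ℂ) *
          japC ((s - 2 : ℝ) + Complex.I * c * t) ξ)) := by
      intro t
      rw [pd_mul contDiff_const (contDiff_japC _), pd_japC]
      funext ξ
      have h0 : pd (EuclideanSpace.single j (1 : ℝ))
        (fun _ : E n => ((t ^ q * Real.exp (-t ^ 2) : ℝ) : ℂ)) ξ = 0 := by simp [pd]
      rw [h0, show ((s - 2 : ℝ) + Complex.I * c * t : ℂ) = s + Complex.I * c * t - 2 by
        push_cast; ring]
      push_cast
      ring
    simp only [hd]
    have hJ : ∀ p : E3 n, 0 < jap p.2.2 := fun p => jap_pos _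
    have sm : ∀ (q : ℕ) (s : ℝ) (t : ℝ), ContDiff ℝ ∞ (fun p : E3 n =>
        ((t ^ q * Real.exp (-t ^ 2) : ℝ) : ℂ) * japC (s + Complex.I * c * t) p.2.2) :=
      fun q s t => contDiff_lift (contDiff_const.mul (contDiff_japC _))
    have := SymB.mul hJ (k := k) (κ := 1) (μ := s - 2)
      (a := fun (_ : ℝ) (p : E3 n) => ((p.2.2 j : ℝ) : ℂ)) (fun _ => contDiff_lift
        (Complex.ofRealCLM.contDiff.comp (EuclideanSpace.proj (𝕜 := ℝ) j).contDiff))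
      (fun t => (contDiff_const.mul (sm q (s - 2) t)).add
        (contDiff_const.mul (sm (q + 1) (s - 2) t)))
      (symE3_coord k j)
      (SymB.add (fun t => contDiff_const.mul (sm q (s - 2) t))
        (fun t => contDiff_const.mul (sm (q + 1) (s - 2) t))
        ((ih q (s - 2)).const_mul hJ (sm q (s - 2)) (s : ℂ))
        ((ih (q + 1) (s - 2)).const_mul hJ (sm (q + 1) (s - 2)) (Complex.I * c)))
    rwa [show 1 + (s - 2) = s - 1 by ring] at this

lemma isSymbol_japC (s : ℝ) : IsSymbol s (fun p : E3 n => japC (s : ℂ) p.2.2) := by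
  rw [isSymbol_iff]
  refine ⟨contDiff_lift (contDiff_japC _), fun k => ?_⟩
  have := (symE3_japC_family (n := n) 0 k 0 s).reindex (fun _ : Unit => (0 : ℝ))
  simpa using this

lemma IsTest.pd {χ : E n → ℂ} (h : IsTest χ) (v : E n) : IsTest (pd v χ) :=
  ⟨contDiff_pd h.1 v, h.2.fderiv_apply ℝ v⟩

lemma IsTest.comp_smul {χ : E n → ℂ} (h : IsTest χ) {ε : ℝ} (hε : ε ≠ 0) :
    IsTest (fun ξ => χ (ε • ξ)) :=
  ⟨h.1.comp (contDiff_const_smul ε), h.2.comp_homeomorph (Homeomorph.smulOfNeZero ε hε)⟩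

lemma IsTest.bounded {χ : E n → ℂ} (h : IsTest χ) : ∃ C : ℝ, 0 ≤ C ∧ ∀ ξ, ‖χ ξ‖ ≤ C := by
  obtain ⟨C, hC⟩ := h.2.exists_bound_of_continuous h.1.continuous
  exact ⟨C, (norm_nonneg _).trans (hC 0), hC⟩

/-- Dilated cut-offs are symbols of order `0`, uniformly in the dilation. -/
lemma symE3_cutoff_family (k : ℕ) : ∀ (q : ℕ) (χ : E n → ℂ), IsTest χ →
    SymE3 k (-(q : ℝ)) (fun (ε : Set.Ioc (0 : ℝ) 1) (p : E3 n) =>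
      ((ε : ℝ) : ℂ) ^ q * χ ((ε : ℝ) • p.2.2)) := by
  have hb : ∀ (q : ℕ) (χ : E n → ℂ), IsTest χ → ∃ C : ℝ, ∀ (ε : Set.Ioc (0 : ℝ) 1) (ξ : E n),
      ‖((ε : ℝ) : ℂ) ^ q * χ ((ε : ℝ) • ξ)‖ ≤ C * jap ξ ^ (-(q : ℝ)) := by
    intro q χ hχ
    obtain ⟨C, hC0, hC⟩ := hχ.bounded
    obtain ⟨R, hR⟩ := hχ.2.isCompact.isBounded.subset_closedBall 0
    refine ⟨C * (1 + |R|) ^ q, fun ε ξ => ?_⟩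
    obtain ⟨ε, h0, h1⟩ := ε
    simp only
    have hj := jap_pos ξ
    rw [Real.rpow_neg hj.le, Real.rpow_natCast, norm_mul, norm_pow, Complex.norm_real,
      Real.norm_eq_abs, abs_of_pos h0]
    by_cases hz : χ (ε • ξ) = 0
    · rw [hz, norm_zero, mul_zero]; positivity
    · have h2 : ε • ξ ∈ Metric.closedBall (0 : E n) R := hR (subset_tsupport _ hz)
      rw [mem_closedBall_zero_iff, norm_smul, Real.norm_eq_abs, abs_of_pos h0] at h2
      have h3 : jap ξ ≤ 1 + ‖ξ‖ := by
        rw [jap]; apply Real.sqrt_le_iff.2; constructor <;> nlinarith [norm_nonneg ξ]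
      have h4 : ε * jap ξ ≤ 1 + |R| := by nlinarith [le_abs_self R]
      have h5 : ε ^ q * jap ξ ^ q ≤ (1 + |R|) ^ q := by
        rw [← mul_pow]; exact pow_le_pow_left₀ (by positivity) h4 q
      rw [← div_eq_mul_inv, le_div_iff₀ (by positivity)]
      calc ε ^ q * ‖χ (ε • ξ)‖ * jap ξ ^ q = ‖χ (ε • ξ)‖ * (ε ^ q * jap ξ ^ q) := by ring
        _ ≤ _ := by gcongr; exact hC _
  induction k with
  | zero => intro q χ hχ; obtain ⟨C, hC⟩ := hb q χ hχ; exact ⟨C, fun i p => hC i _⟩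
  | succ k ih =>
    intro q χ hχ
    have sm : ∀ ε : ℝ, ContDiff ℝ ∞ (fun ξ : E n => χ (ε • ξ)) :=
      fun ε => hχ.1.comp (contDiff_const_smul ε)
    refine symE3_succ_lift (b := fun (ε : Set.Ioc (0 : ℝ) 1) (ξ : E n) =>
      ((ε : ℝ) : ℂ) ^ q * χ ((ε : ℝ) • ξ)) (fun ε => contDiff_const.mul (sm _)) (hb q χ hχ)
      fun j => ?_
    -- The chain rule adds one factor ε, so q counts derivatives. On the support of χ(εξ) one has
    -- ε⟨ξ⟩ ≤ 1 + |R|, which makes each ε worth ⟨ξ⟩^{-1}.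
    have hd : ∀ ε : ℝ, pd (EuclideanSpace.single j (1 : ℝ)) (fun ξ : E n =>
        (ε : ℂ) ^ q * χ (ε • ξ)) =
        fun ξ => (ε : ℂ) ^ (q + 1) * FourierInt.pd (EuclideanSpace.single j (1 : ℝ)) χ (ε • ξ) := by
      intro ε
      rw [pd_mul contDiff_const (sm ε)]
      have := pd_comp_clm hχ.1 (ε • ContinuousLinearMap.id ℝ (E n)) (EuclideanSpace.single j (1 : ℝ))
      simp only [smul_apply, ContinuousLinearMap.id_apply] at this
      rw [this]
      funext ξ
      simp [FourierInt.pd]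
      ring
    simp only [hd]
    have := ih (q + 1) _ (hχ.pd (EuclideanSpace.single j (1 : ℝ)))
    rwa [show (-((q + 1 : ℕ) : ℝ)) = -(q : ℝ) - 1 by push_cast; ring] at this

/-- Interchanging `x` and `y`. -/
def swapXY (n : ℕ) : E3 n →L[ℝ] E3 n :=
  ((ContinuousLinearMap.fst ℝ (E n) (E n)).comp (ContinuousLinearMap.snd ℝ (E n) (E n × E n))).prod
    ((ContinuousLinearMap.fst ℝ (E n) (E n × E n)).prod (projXi n))

@[simp] lemma swapXY_apply (p : E3 n) : swapXY n p = (p.2.1, p.1, p.2.2) := rfl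

def swapDir : Dir n → Dir n
  | .inl j => .inr (.inl j)
  | .inr (.inl j) => .inl j
  | .inr (.inr j) => .inr (.inr j)

/-- Interchanging x and y permutes the directions without changing their orders. The isometry `L`
covers conjugation and negation, for the adjoint, and the inclusion of ℝ in ℂ. -/
lemma SymB.swap (L : F →ₗᵢ[ℝ] F') (k : ℕ) : ∀ {κ : ℝ} {a : ι → E3 n → F},
    (∀ i, ContDiff ℝ ∞ (a i)) → SymE3 k κ a →
    SymE3 k κ (fun i p => L (a i (p.2.1, p.1, p.2.2))) := by
  induction k with
  | zero => rintro κ a _ ⟨C, hC⟩; exact ⟨C, fun i p => by simpa using hC i (p.2.1, p.1, p.2.2)⟩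
  | succ k ih =>
    rintro κ a sa ⟨⟨C, hC⟩, h⟩
    refine ⟨⟨C, fun i p => by simpa using hC i (p.2.1, p.1, p.2.2)⟩, fun d => ?_⟩
    have hd : ∀ i, pd (dirVec d) (fun p : E3 n => L (a i (p.2.1, p.1, p.2.2))) =
        fun p => L (pd (dirVec (swapDir d)) (a i) (p.2.1, p.1, p.2.2)) := by
      intro i
      have h1 := pd_comp_clm (b := fun p => L (a i p)) (L.contDiff.comp (sa i)) (swapXY n) (dirVec d)
      simp only [swapXY_apply] at h1
      rw [h1]
      funext p
      have h2 := L.toContinuousLinearMap.hasFDerivAt.comp (p.2.1, p.1, p.2.2)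
        (contDiff_diff (sa i) (p.2.1, p.1, p.2.2)).hasFDerivAt
      change fderiv ℝ (L.toContinuousLinearMap ∘ a i) (p.2.1, p.1, p.2.2) _ = _
      rw [h2.fderiv]
      rcases d with j | j | j <;> rfl
    simp only [hd]
    have h3 : (dirOrd d : ℝ) = dirOrd (swapDir d) := by rcases d with j | j | j <;> rfl
    rw [h3]
    exact ih (fun i => contDiff_pd (sa i) _) (h _)

lemma IsSymbol.swap (L : F →ₗᵢ[ℝ] F') {κ : ℝ} {a : E3 n → F} (ha : IsSymbol κ a) :
    IsSymbol κ (fun p => L (a (p.2.1, p.1, p.2.2))) := by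
  rw [isSymbol_iff] at ha ⊢
  exact ⟨L.contDiff.comp (ha.1.comp (swapXY n).contDiff),
    fun k => SymB.swap L k (fun _ => ha.1) (ha.2 k)⟩

lemma IsSymbol.adjAmp {κ : ℝ} {a : E3 n → ℂ} (ha : IsSymbol κ a) : IsSymbol κ (adjAmp a) :=
  ha.swap Complex.conjLIE.toLinearIsometry

lemma adjAmp_adjAmp (a : E3 n → ℂ) : FourierInt.adjAmp (FourierInt.adjAmp a) = a := by
  funext p; simp [FourierInt.adjAmp]

lemma isSymbol_partialXi_adjPhase {κ : ℝ} {Φ : E3 n → ℝ} (hΦ : ContDiff ℝ ∞ Φ) (j : Fin n)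
    (h : IsSymbol κ (partialXi Φ j)) : IsSymbol κ (partialXi (adjPhase Φ) j) := by
  have := h.swap (LinearIsometryEquiv.neg ℝ (E := ℝ)).toLinearIsometry
  convert this using 1
  funext p
  have h1 := congrFun (pd_comp_clm (b := fun p => -Φ p) hΦ.neg (swapXY n) (dirXi j)) p
  have h2 : pd (dirXi j) (fun p => -Φ p) (swapXY n p) = - pd (dirXi j) Φ (swapXY n p) := by
    simp [pd]
  exact h1.trans h2

/-- Freezing `x` and `y`: symbol estimates in a single frequency direction. -/
abbrev SymXi (j : Fin n) (k : ℕ) (κ : ℝ) (a : ι → E n → F) : Prop :=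
  SymB (jap : E n → ℝ) (fun _ : Unit => EuclideanSpace.single j (1 : ℝ)) (fun _ => 1) k κ a

lemma contDiff_slice {a : E3 n → F} (ha : ContDiff ℝ ∞ a) (x y : E n) :
    ContDiff ℝ ∞ (fun ξ => a (x, y, ξ)) :=
  ha.comp (contDiff_const.prodMk (contDiff_const.prodMk contDiff_id))

lemma pd_slice {a : E3 n → F} (ha : ContDiff ℝ ∞ a) (x y : E n) (j : Fin n) :
    pd (EuclideanSpace.single j (1 : ℝ)) (fun ξ => a (x, y, ξ)) =
      fun ξ => pd (dirXi j) a (x, y, ξ) := by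
  funext ξ
  have h00 : HasFDerivAt (fun ξ : E n => ((y, ξ) : E n × E n)) _ ξ :=
    (hasFDerivAt_const (𝕜 := ℝ) y ξ).prodMk (hasFDerivAt_id ξ)
  have h0 : HasFDerivAt (fun ξ : E n => ((x, y, ξ) : E3 n)) _ ξ :=
    (hasFDerivAt_const (𝕜 := ℝ) x ξ).prodMk h00
  have := (contDiff_diff ha (x, y, ξ)).hasFDerivAt.comp ξ h0
  change fderiv ℝ (a ∘ fun ξ : E n => ((x, y, ξ) : E3 n)) ξ _ = _
  rw [this.fderiv]
  rfl

/-- The frozen pair (x, y) joins the index of the family, so the estimates in ξ stay uniform in x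
and y. -/
lemma SymB.slice (j : Fin n) (k : ℕ) : ∀ {κ : ℝ} {a : ι → E3 n → F},
    (∀ i, ContDiff ℝ ∞ (a i)) → SymE3 k κ a →
    SymXi j k κ (fun (i : ι × E n × E n) ξ => a i.1 (i.2.1, i.2.2, ξ)) := by
  induction k with
  | zero => rintro κ a _ ⟨C, hC⟩; exact ⟨C, fun i ξ => hC i.1 _⟩
  | succ k ih =>
    rintro κ a sa ⟨⟨C, hC⟩, h⟩
    refine ⟨⟨C, fun i ξ => hC i.1 _⟩, fun _ => ?_⟩
    simp only [pd_slice (sa _)]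
    exact ih (fun i => contDiff_pd (sa i) _) (h (Sum.inr (Sum.inr j)))

end Families

/-! ### Absolutely convergent series of symbols. -/

section Series

variable {n : ℕ} {ι : Type*}

def dirCoord : Dir n → E3 n → ℝ
  | .inl j, v => v.1 j
  | .inr (.inl j), v => v.2.1 j
  | .inr (.inr j), v => v.2.2 j

lemma abs_dirCoord_le (d : Dir n) (v : E3 n) : |dirCoord d v| ≤ ‖v‖ := by
  rcases d with j | j | j
  · exact (PiLp.norm_apply_le v.1 j).trans (norm_fst_le v)
  · exact (PiLp.norm_apply_le v.2.1 j).trans ((norm_fst_le v.2).trans (norm_snd_le v))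
  · exact (PiLp.norm_apply_le v.2.2 j).trans ((norm_snd_le v.2).trans (norm_snd_le v))

lemma sum_single (v : E n) : ∑ j, v j • EuclideanSpace.single j (1 : ℝ) = v := by
  ext i
  simp [Finset.sum_apply, Pi.single_apply]

lemma sum_dirCoord (v : E3 n) : ∑ d, dirCoord d v • dirVec d = v := by
  simp only [Fintype.sum_sum_type, dirCoord, dirVec, dirX, dirY, dirXi]
  refine Prod.ext ?_ (Prod.ext ?_ ?_)
  · simpa [Prod.fst_sum, Prod.snd_sum] using sum_single v.1
  · simpa [Prod.fst_sum, Prod.snd_sum] using sum_single v.2.1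
  · simpa [Prod.fst_sum, Prod.snd_sum] using sum_single v.2.2

lemma clm_eq_sum_dirs (L : E3 n →L[ℝ] ℂ) (v : E3 n) :
    L v = ∑ d, dirCoord d v • L (dirVec d) := by
  conv_lhs => rw [← sum_dirCoord v]
  simp [map_sum]

lemma norm_fderiv_le_sum (a : E3 n → ℂ) (p : E3 n) :
    ‖fderiv ℝ a p‖ ≤ ∑ d, ‖pd (dirVec d) a p‖ := by
  refine ContinuousLinearMap.opNorm_le_bound _ (Finset.sum_nonneg fun _ _ => norm_nonneg _) ?_
  intro v
  rw [clm_eq_sum_dirs]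
  refine (norm_sum_le _ _).trans ?_
  rw [Finset.sum_mul]
  refine Finset.sum_le_sum fun d _ => ?_
  rw [norm_smul, mul_comm]
  exact mul_le_mul_of_nonneg_left (abs_dirCoord_le d v) (norm_nonneg _)

/-- The amplitude `∑ cᵢ bᵢ`. -/
def serAmp (b : ι → E3 n → ℂ) (c : ι → ℂ) (p : E3 n) : ℂ := ∑' i, c i * b i p

/-- A family of smooth functions whose derivatives are all bounded, uniformly in the family. -/
def UnifSmooth (b : ι → E3 n → ℂ) : Prop :=
  (∀ i, ContDiff ℝ ∞ (b i)) ∧ ∀ l : List (Dir n), ∃ C : ℝ, ∀ i p, ‖pdl (l.map dirVec) (b i) p‖ ≤ C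

lemma UnifSmooth.bound {b : ι → E3 n → ℂ} (h : UnifSmooth b) :
    ∃ C : ℝ, 0 ≤ C ∧ ∀ i p, ‖b i p‖ ≤ C := by
  obtain ⟨C, hC⟩ := h.2 []
  exact ⟨|C|, abs_nonneg _, fun i p => (hC i p).trans (le_abs_self C)⟩

lemma UnifSmooth.pd {b : ι → E3 n → ℂ} (h : UnifSmooth b) (d : Dir n) :
    UnifSmooth (fun i => pd (dirVec d) (b i)) := by
  refine ⟨fun i => contDiff_pd (h.1 i) _, fun l => ?_⟩
  obtain ⟨C, hC⟩ := h.2 (l ++ [d])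
  refine ⟨C, fun i p => ?_⟩
  simpa [pdl] using hC i p

lemma unifSmooth_of_symB {b : ι → E3 n → ℂ} (hb : ∀ i, ContDiff ℝ ∞ (b i))
    (h : ∀ k, SymE3 k 0 b) : UnifSmooth b := by
  refine ⟨hb, fun l => ?_⟩
  obtain ⟨C, hC⟩ := symB_iff_pdl.1 h l
  refine ⟨|C|, fun i p => (hC i p).trans ?_⟩
  have h0 : 0 ≤ (l.map (dirOrd (n := n))).sum := by
    apply List.sum_nonneg
    intro x hx
    obtain ⟨d, -, rfl⟩ := List.mem_map.1 hx
    rcases d with j | j | j <;> simp [dirOrd]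
  have h1 : jap p.2.2 ^ (0 - (l.map (dirOrd (n := n))).sum) ≤ 1 :=
    Real.rpow_le_one_of_one_le_of_nonpos (one_le_jap _) (by linarith)
  have h2 : 0 ≤ jap p.2.2 ^ (0 - (l.map (dirOrd (n := n))).sum) :=
    Real.rpow_nonneg (jap_pos _).le _
  nlinarith [le_abs_self C, abs_nonneg C]

lemma UnifSmooth.summable {b : ι → E3 n → ℂ} (h : UnifSmooth b) {c : ι → ℂ}
    (hc : Summable fun i => ‖c i‖) (p : E3 n) : Summable fun i => c i * b i p := by
  obtain ⟨C, -, hC⟩ := h.bound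
  refine Summable.of_norm_bounded (hc.mul_right C) fun i => ?_
  rw [norm_mul]
  exact mul_le_mul_of_nonneg_left (hC i p) (norm_nonneg _)

lemma UnifSmooth.hasFDerivAt {b : ι → E3 n → ℂ} (h : UnifSmooth b) {c : ι → ℂ}
    (hc : Summable fun i => ‖c i‖) (p : E3 n) :
    HasFDerivAt (serAmp b c) (∑' i, c i • fderiv ℝ (b i) p) p := by
  choose C hC using fun d => (h.pd d).bound
  refine hasFDerivAt_tsum (u := fun i => ‖c i‖ * ∑ d, C d) (hc.mul_right _)
    (f' := fun i p => c i • fderiv ℝ (b i) p)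
    (fun i p => (contDiff_diff (h.1 i) p).hasFDerivAt.const_mul (c i)) (fun i p => ?_)
    (h.summable hc 0) p
  rw [norm_smul]
  exact mul_le_mul_of_nonneg_left ((norm_fderiv_le_sum _ _).trans
    (Finset.sum_le_sum fun d _ => (hC d).2 i p)) (norm_nonneg _)

lemma UnifSmooth.pd_serAmp {b : ι → E3 n → ℂ} (h : UnifSmooth b) {c : ι → ℂ}
    (hc : Summable fun i => ‖c i‖) (d : Dir n) :
    FourierInt.pd (dirVec d) (serAmp b c) =
      serAmp (fun i => FourierInt.pd (dirVec d) (b i)) c := by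
  funext p
  choose C hC using fun d => (h.pd d).bound
  have hs : Summable fun i => c i • fderiv ℝ (b i) p := by
    refine Summable.of_norm_bounded (hc.mul_right (∑ d, C d)) fun i => ?_
    rw [norm_smul]
    exact mul_le_mul_of_nonneg_left ((norm_fderiv_le_sum _ _).trans
      (Finset.sum_le_sum fun d _ => (hC d).2 i p)) (norm_nonneg _)
  have := (ContinuousLinearMap.apply ℝ ℂ (dirVec d)).map_tsum hs
  simp only [FourierInt.pd, (h.hasFDerivAt hc p).fderiv, serAmp]
  simpa using this

/-- The partial derivatives of the series are series of the same kind, over the differentiated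
family; hence an induction on the order of differentiability. -/
lemma UnifSmooth.contDiff_serAmp {b : ι → E3 n → ℂ} (h : UnifSmooth b) {c : ι → ℂ}
    (hc : Summable fun i => ‖c i‖) : ContDiff ℝ ∞ (serAmp b c) := by
  have key : ∀ (N : ℕ) (b : ι → E3 n → ℂ), UnifSmooth b → ContDiff ℝ N (serAmp b c) := by
    intro N
    induction N with
    | zero =>
      intro b h
      have : Differentiable ℝ (serAmp b c) := fun p => (h.hasFDerivAt hc p).differentiableAt
      exact contDiff_zero.2 this.continuous
    | succ N ih =>
      intro b h
      have hcast : ((N + 1 : ℕ) : ℕ∞ω) = (N : ℕ∞ω) + 1 := by push_cast; rfl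
      rw [hcast, contDiff_succ_iff_fderiv_apply]
      refine ⟨fun p => (h.hasFDerivAt hc p).differentiableAt, by simp, fun v => ?_⟩
      have : (fun p => fderiv ℝ (serAmp b c) p v) = fun p => ∑ d, dirCoord d v •
          serAmp (fun i => FourierInt.pd (dirVec d) (b i)) c p := by
        funext p
        rw [clm_eq_sum_dirs]
        refine Finset.sum_congr rfl fun d _ => ?_
        rw [← h.pd_serAmp hc d]; rfl
      rw [this]
      exact ContDiff.sum fun d _ => (ih _ (h.pd d)).const_smul (dirCoord d v)
  exact contDiff_infty.2 fun N => key N b h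

lemma symE3_serAmp {c : ι → ℂ} (hc : Summable fun i => ‖c i‖) (k : ℕ) :
    ∀ {κ : ℝ} {b : ι → E3 n → ℂ}, UnifSmooth b → SymE3 k κ b →
    SymE3 k κ (fun _ : Unit => serAmp b c) := by
  have h0 : ∀ {κ : ℝ} {b : ι → E3 n → ℂ}, (∃ C : ℝ, ∀ i p, ‖b i p‖ ≤ C * jap p.2.2 ^ κ) →
      ∃ C : ℝ, ∀ (_ : Unit) p, ‖serAmp b c p‖ ≤ C * jap p.2.2 ^ κ := by
    rintro κ b ⟨C, hC⟩
    refine ⟨(∑' i, ‖c i‖) * C, fun _ p => ?_⟩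
    rw [mul_assoc, ← tsum_mul_right]
    refine tsum_of_norm_bounded ((hc.mul_right _).hasSum) fun i => ?_
    rw [norm_mul]
    exact mul_le_mul_of_nonneg_left (hC i p) (norm_nonneg _)
  induction k with
  | zero => intro κ b _ hb; exact h0 hb
  | succ k ih =>
    intro κ b h hb
    refine ⟨h0 hb.1, fun d => ?_⟩
    simp only [h.pd_serAmp hc]
    exact ih (h.pd d) (hb.2 d)

/-- An absolutely convergent series in a bounded family of symbols of order `0` is a symbol. -/
lemma isSymbol_serAmp {b : ι → E3 n → ℂ} {c : ι → ℂ} (hc : Summable fun i => ‖c i‖)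
    (hs : ∀ i, ContDiff ℝ ∞ (b i)) (hb : ∀ k, SymE3 k 0 b) : IsSymbol 0 (serAmp b c) := by
  have h := unifSmooth_of_symB hs hb
  exact isSymbol_iff.2 ⟨h.contDiff_serAmp hc, fun k => symE3_serAmp hc k h (hb k)⟩

end Series

/-! ### Bilinear forms of the regularised operators. -/

section Forms

variable {n : ℕ}

/-- The oscillating factor `e^{i((x-y)·ξ + Φ(x,y,ξ))}`. -/
def osc (Φ : E3 n → ℝ) (p : E3 n) : ℂ :=
  Complex.exp (Complex.I * ((inner ℝ (p.1 - p.2.1) p.2.2 + Φ p : ℝ) : ℂ))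

lemma norm_osc (Φ : E3 n → ℝ) (p : E3 n) : ‖osc Φ p‖ = 1 := by
  rw [osc, mul_comm, Complex.norm_exp_ofReal_mul_I]

lemma continuous_osc {Φ : E3 n → ℝ} (hΦ : Continuous Φ) : Continuous (osc Φ) := by
  unfold osc
  fun_prop

/-- The integrand of the bilinear form of a Fourier integral operator. -/
def bilInt (Φ : E3 n → ℝ) (A : E3 n → ℂ) (u v : E n → ℂ) (p : E3 n) : ℂ :=
  osc Φ p * A p * u p.2.1 * v p.1

/-- The bilinear form `⟨𝒫 u, v⟩` of a Fourier integral operator with integrable amplitude. -/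
def Bil (Φ : E3 n → ℝ) (A : E3 n → ℂ) (u v : E n → ℂ) : ℂ :=
  ∫ p : E3 n, bilInt Φ A u v p

/-- `A` is a continuous amplitude dominated by the integrable function `G` of the frequency. -/
structure AmpDom (A : E3 n → ℂ) (G : E n → ℝ) : Prop where
  cont : Continuous A
  int : Integrable G
  le : ∀ p, ‖A p‖ ≤ G p.2.2

lemma integrable_triple {u v : E n → ℝ} {G : E n → ℝ} (hv : Integrable v) (hu : Integrable u)
    (hG : Integrable G) : Integrable (fun p : E3 n => v p.1 * (u p.2.1 * G p.2.2)) :=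
  hv.mul_prod (hu.mul_prod hG)

lemma norm_bilInt (Φ : E3 n → ℝ) (A : E3 n → ℂ) (u v : E n → ℂ) (p : E3 n) :
    ‖bilInt Φ A u v p‖ = ‖v p.1‖ * (‖u p.2.1‖ * ‖A p‖) := by
  simp only [bilInt, norm_mul, norm_osc]; ring

lemma aesm_fst {v : E n → ℂ} (hv : AEStronglyMeasurable v) :
    AEStronglyMeasurable (fun p : E3 n => v p.1) volume :=
  hv.comp_quasiMeasurePreserving Measure.quasiMeasurePreserving_fst

lemma aesm_snd_fst {v : E n → ℂ} (hv : AEStronglyMeasurable v) :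
    AEStronglyMeasurable (fun p : E3 n => v p.2.1) volume := by
  have h1 : AEStronglyMeasurable (fun q : E n × E n => v q.1) volume :=
    hv.comp_quasiMeasurePreserving Measure.quasiMeasurePreserving_fst
  exact h1.comp_quasiMeasurePreserving Measure.quasiMeasurePreserving_snd

lemma aesm_bilInt {Φ : E3 n → ℝ} (hΦ : Continuous Φ) {A : E3 n → ℂ} (hA : Continuous A)
    {u v : E n → ℂ} (hu : AEStronglyMeasurable u) (hv : AEStronglyMeasurable v) :
    AEStronglyMeasurable (bilInt Φ A u v) volume :=
  ((((continuous_osc hΦ).mul hA).aestronglyMeasurable).mul (aesm_snd_fst hu)).mul (aesm_fst hv)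

lemma bilInt_le {Φ : E3 n → ℝ} {A : E3 n → ℂ} {G : E n → ℝ} (hA : AmpDom A G)
    {u v : E n → ℂ} (p : E3 n) :
    ‖bilInt Φ A u v p‖ ≤ ‖v p.1‖ * (‖u p.2.1‖ * G p.2.2) := by
  rw [norm_bilInt]
  have := hA.le p
  gcongr

lemma integrable_bilInt {Φ : E3 n → ℝ} (hΦ : Continuous Φ) {A : E3 n → ℂ} {G : E n → ℝ}
    (hA : AmpDom A G) {u v : E n → ℂ} (hu : Integrable u) (hv : Integrable v) :
    Integrable (bilInt Φ A u v) :=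
  (integrable_triple hv.norm hu.norm hA.int).mono' (aesm_bilInt hΦ hA.cont hu.1 hv.1)
    (Eventually.of_forall fun p => bilInt_le hA p)

lemma ae_fst {P : E n → Prop} (h : ∀ᵐ x : E n, P x) : ∀ᵐ p : E3 n, P p.1 :=
  Measure.quasiMeasurePreserving_fst.ae h

lemma ae_snd_fst {P : E n → Prop} (h : ∀ᵐ x : E n, P x) : ∀ᵐ p : E3 n, P p.2.1 := by
  have h1 : ∀ᵐ q : E n × E n, P q.1 := Measure.quasiMeasurePreserving_fst.ae h
  exact Measure.quasiMeasurePreserving_snd.ae h1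

/-- Dominated convergence for the bilinear forms. -/
lemma tendsto_Bil {Φ : E3 n → ℝ} (hΦ : Continuous Φ) {α : Type*} {l : Filter α}
    [l.IsCountablyGenerated] {A : α → E3 n → ℂ} {A₀ : E3 n → ℂ} {G : E n → ℝ}
    {u v : α → E n → ℂ} {u₀ v₀ : E n → ℂ} {U V : E n → ℝ}
    (hA : ∀ᶠ k in l, AmpDom (A k) G) (hG : Integrable G)
    (hAl : ∀ p, Tendsto (fun k => A k p) l (𝓝 (A₀ p)))
    (hu : ∀ k, AEStronglyMeasurable (u k)) (hU : Integrable U) (huU : ∀ k, ∀ᵐ x, ‖u k x‖ ≤ U x)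
    (hul : ∀ᵐ x, Tendsto (fun k => u k x) l (𝓝 (u₀ x)))
    (hv : ∀ k, AEStronglyMeasurable (v k)) (hV : Integrable V) (hvV : ∀ k, ∀ᵐ x, ‖v k x‖ ≤ V x)
    (hvl : ∀ᵐ x, Tendsto (fun k => v k x) l (𝓝 (v₀ x))) :
    Tendsto (fun k => Bil Φ (A k) (u k) (v k)) l (𝓝 (Bil Φ A₀ u₀ v₀)) := by
  refine tendsto_integral_filter_of_dominated_convergence
    (fun p : E3 n => V p.1 * (U p.2.1 * G p.2.2)) ?_ ?_ (integrable_triple hV hU hG) ?_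
  · exact hA.mono fun k hk => aesm_bilInt hΦ hk.cont (hu k) (hv k)
  · refine hA.mono fun k hk => ?_
    filter_upwards [ae_fst (hvV k), ae_snd_fst (huU k)] with p h1 h2
    refine (bilInt_le hk p).trans ?_
    have := (norm_nonneg _).trans (hk.le p)
    have := (norm_nonneg _).trans h1
    gcongr
  · filter_upwards [ae_fst hvl, ae_snd_fst hul] with p h1 h2
    exact ((tendsto_const_nhds.mul (hAl p)).mul h2).mul h1

lemma Bil_smul_left (Φ : E3 n → ℝ) (A : E3 n → ℂ) (c : ℂ) (u v : E n → ℂ) :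
    Bil Φ A (fun y => c * u y) v = c * Bil Φ A u v := by
  rw [Bil, Bil, ← integral_const_mul]
  congr 1; funext p; simp only [bilInt]; ring

lemma Bil_smul_amp (Φ : E3 n → ℝ) (A : E3 n → ℂ) (c : ℂ) (u v : E n → ℂ) :
    Bil Φ (fun p => c * A p) u v = c * Bil Φ A u v := by
  rw [Bil, Bil, ← integral_const_mul]
  congr 1; funext p; simp only [bilInt]; ring

lemma Bil_sum_left {Φ : E3 n → ℝ} (hΦ : Continuous Φ) {A : E3 n → ℂ} {G : E n → ℝ}
    (hA : AmpDom A G) {κ : Type*} (s : Finset κ) {u : κ → E n → ℂ} {v : E n → ℂ}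
    (hu : ∀ i ∈ s, Integrable (u i)) (hv : Integrable v) :
    Bil Φ A (fun y => ∑ i ∈ s, u i y) v = ∑ i ∈ s, Bil Φ A (u i) v := by
  simp only [Bil]
  rw [← integral_finsetSum s fun i hi => integrable_bilInt hΦ hA (hu i hi) hv]
  congr 1; funext p; simp only [bilInt, Finset.mul_sum, Finset.sum_mul]

lemma IsTest.integrable {u : E n → ℂ} (hu : IsTest u) : Integrable u :=
  hu.1.continuous.integrable_of_hasCompactSupport hu.2

/-- The cut-off makes the integral over (x, y, ξ) absolutely convergent, so Fubini identifies the
iterated integral of the definition with `Bil`. -/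
lemma cutOp_mul_integral {Φ : E3 n → ℝ} (hΦ : Continuous Φ) {a : E3 n → ℂ} {g : E n → ℂ}
    {G : E n → ℝ} (hA : AmpDom (fun p => g p.2.2 * a p) G) {u v : E n → ℂ} (hu : IsTest u)
    (hv : IsTest v) :
    ∫ x, cutOp Φ a g u x * v x = Bil Φ (fun p => g p.2.2 * a p) u v := by
  have hi := integrable_bilInt hΦ hA hu.integrable hv.integrable
  rw [Bil, Measure.volume_eq_prod, integral_prod _ hi]
  congr 1; funext x
  have hx : Integrable (fun q : E n × E n => bilInt Φ (fun p => g p.2.2 * a p) u v (x, q)) := by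
    refine ((hu.integrable.norm.mul_prod hA.int).const_mul ‖v x‖).mono' ?_
      (Eventually.of_forall fun q => bilInt_le hA (x, q))
    refine Continuous.aestronglyMeasurable ?_
    have h1 := hA.cont
    have h2 := hu.1.continuous
    have h3 := hv.1.continuous
    have h4 := continuous_osc hΦ
    have : Continuous (bilInt Φ (fun p => g p.2.2 * a p) u v) := by
      unfold bilInt
      exact ((h4.mul h1).mul (h2.comp (by fun_prop))).mul (h3.comp (by fun_prop))
    exact this.comp (by fun_prop)
  rw [Measure.volume_eq_prod, integral_prod_symm _ hx, cutOp, ← integral_mul_const]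
  congr 1; funext ξ
  rw [← integral_mul_const]
  congr 1; funext y
  simp only [bilInt, osc]
  ring

/-- The interchange of `x` and `y` as a measurable equivalence. -/
def swapEquiv (n : ℕ) : E3 n ≃ᵐ E3 n :=
  (MeasurableEquiv.prodAssoc.symm.trans
    (MeasurableEquiv.prodComm.prodCongr (MeasurableEquiv.refl (E n)))).trans
    MeasurableEquiv.prodAssoc

lemma measurePreserving_swapEquiv (n : ℕ) :
    MeasurePreserving (swapEquiv n) volume volume := by
  have h1 : MeasurePreserving (MeasurableEquiv.prodAssoc : (E n × E n) × E n ≃ᵐ E3 n)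
    volume volume := measurePreserving_prodAssoc _ _ _
  have h2 : MeasurePreserving (MeasurableEquiv.prodComm.prodCongr (MeasurableEquiv.refl (E n)) :
    (E n × E n) × E n ≃ᵐ (E n × E n) × E n) volume volume :=
    (Measure.measurePreserving_swap).prod (MeasurePreserving.id _)
  exact (h1.symm.trans h2).trans h1

/-- Conjugate the integrand and interchange x and y. At the level of the forms, passing to the
adjoint is this change of variables. -/
lemma star_Bil (Φ : E3 n → ℝ) (A : E3 n → ℂ) (u v : E n → ℂ) :
    star (Bil Φ A u v) =
      Bil (adjPhase Φ) (adjAmp A) (fun x => star (v x)) (fun x => star (u x)) := by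
  rw [Bil, Bil, ← (measurePreserving_swapEquiv n).integral_comp'
    (g := bilInt (adjPhase Φ) (adjAmp A) (fun x => star (v x)) (fun x => star (u x)))]
  change (starRingEnd ℂ) _ = _
  rw [← integral_conj]
  congr 1; funext p
  have h1 : swapEquiv n p = (p.2.1, p.1, p.2.2) := rfl
  rw [h1]
  simp only [bilInt, map_mul, osc, adjPhase, adjAmp, ← Complex.exp_conj, Complex.conj_ofReal,
    Complex.conj_I, RCLike.star_def]
  have h2 : (inner ℝ (p.2.1 - p.1) p.2.2 : ℝ) = - inner ℝ (p.1 - p.2.1) p.2.2 := by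
    rw [← inner_neg_left, neg_sub]
  rw [h2]
  push_cast
  ring_nf

end Forms

/-! ### Oscillatory integrals as limits of regularised forms. -/

section Cutoffs

variable {n : ℕ}

lemma IsSymbol.bdd {κ : ℝ} (hκ : κ ≤ 0) {a : E3 n → ℂ} (ha : IsSymbol κ a) :
    ∃ C : ℝ, 0 ≤ C ∧ ∀ p, ‖a p‖ ≤ C := by
  obtain ⟨C, h0, hC⟩ := ha.bound
  refine ⟨C, h0, fun p => (hC p).trans ?_⟩
  have := Real.rpow_le_one_of_one_le_of_nonpos (one_le_jap p.2.2) hκ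
  nlinarith

lemma ampDom_cutoff {a : E3 n → ℂ} (hc : Continuous a) {C : ℝ} (hC : ∀ p, ‖a p‖ ≤ C)
    {g : E n → ℂ} (hg : IsTest g) : AmpDom (fun p => g p.2.2 * a p) (fun ξ => C * ‖g ξ‖) where
  cont := (hg.1.continuous.comp (by fun_prop)).mul hc
  int := hg.integrable.norm.const_mul C
  le p := by
    rw [norm_mul, mul_comm]
    exact mul_le_mul_of_nonneg_right (hC p) (norm_nonneg _)

lemma Represents.tendsto {Φ : E3 n → ℝ} (hΦ : Continuous Φ) {κ : ℝ} (hκ : κ ≤ 0) {a : E3 n → ℂ}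
    (ha : IsSymbol κ a) {u f : E n → ℂ} (hf : Represents Φ a u f) (hu : IsTest u) {g : E n → ℂ}
    (hg : IsTest g) (hg0 : g 0 = 1) {v : E n → ℂ} (hv : IsTest v) :
    Tendsto (fun ε : ℝ => Bil Φ (fun p => g (ε • p.2.2) * a p) u v) (𝓝[>] 0)
      (𝓝 (∫ x, f x * v x)) := by
  obtain ⟨C, -, hC⟩ := ha.bdd hκ
  refine (hf.2 g hg hg0 v hv).congr' ?_
  filter_upwards [self_mem_nhdsWithin] with ε hε
  exact cutOp_mul_integral (g := fun ξ => g (ε • ξ)) hΦ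
    (ampDom_cutoff ha.1.continuous hC (hg.comp_smul (ne_of_gt hε))) hu hv

/-- The sequence `1 / (k + 1)` used to approach `0` from the right. -/
lemma tendsto_inv_nhdsGT : Tendsto (fun k : ℕ => 1 / ((k : ℝ) + 1)) atTop (𝓝[>] 0) :=
  tendsto_nhdsWithin_iff.2 ⟨tendsto_one_div_add_atTop_nhds_zero_nat,
    Eventually.of_forall fun k => by simp only [Set.mem_Ioi]; positivity⟩

end Cutoffs

/-! ### From one constant per amplitude to one constant per bounded family of amplitudes. -/

section UniformBoundedness

variable {n : ℕ} {ι : Type*}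

lemma exists_cutoff (n : ℕ) : ∃ g : E n → ℂ, IsTest g ∧ g 0 = 1 ∧ ∀ ξ, ‖g ξ‖ ≤ 1 := by
  let f : ContDiffBump (0 : E n) := ⟨1, 2, by norm_num, by norm_num⟩
  refine ⟨fun ξ => ((f ξ : ℝ) : ℂ), ⟨Complex.ofRealCLM.contDiff.comp f.contDiff, ?_⟩, ?_, ?_⟩
  · exact f.hasCompactSupport.comp_left (g := fun x : ℝ => (x : ℂ)) (by simp)
  · have : f 0 = 1 := f.one_of_mem_closedBall (by simp [f])
    simp [this]
  · intro ξ
    rw [Complex.norm_real, Real.norm_eq_abs, abs_of_nonneg f.nonneg]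
    exact f.le_one

lemma lp_one_summable (c : lp (fun _ : ι => ℂ) 1) : Summable fun i => ‖c i‖ := by
  have := (lp.memℓp c).summable (by simp)
  simpa using this

lemma lp_one_norm (c : lp (fun _ : ι => ℂ) 1) : ‖c‖ = ∑' i, ‖c i‖ := by
  have := lp.norm_eq_tsum_rpow (p := 1) (by simp) c
  simpa using this

lemma Bil_add_amp {Φ : E3 n → ℝ} (hΦ : Continuous Φ) {A A' : E3 n → ℂ} {G G' : E n → ℝ}
    (hA : AmpDom A G) (hA' : AmpDom A' G') {u v : E n → ℂ} (hu : Integrable u)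
    (hv : Integrable v) : Bil Φ (fun p => A p + A' p) u v = Bil Φ A u v + Bil Φ A' u v := by
  rw [Bil, Bil, Bil, ← integral_add (integrable_bilInt hΦ hA hu hv)
    (integrable_bilInt hΦ hA' hu hv)]
  congr 1; funext p; simp only [bilInt]; ring

lemma norm_Bil_le {Φ : E3 n → ℝ} {A : E3 n → ℂ} {G : E n → ℝ} (hA : AmpDom A G)
    {u v : E n → ℂ} (hu : Integrable u) (hv : Integrable v) :
    ‖Bil Φ A u v‖ ≤ ∫ p : E3 n, ‖v p.1‖ * (‖u p.2.1‖ * G p.2.2) :=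
  norm_integral_le_of_norm_le (integrable_triple hv.norm hu.norm hA.int)
    (Eventually.of_forall fun p => bilInt_le hA p)

lemma norm_serAmp_le {b : ι → E3 n → ℂ} {C : ℝ} (hC : ∀ i p, ‖b i p‖ ≤ C)
    (c : lp (fun _ : ι => ℂ) 1) (p : E3 n) : ‖serAmp b c p‖ ≤ ‖c‖ * C := by
  rw [lp_one_norm, ← tsum_mul_right]
  refine tsum_of_norm_bounded (((lp_one_summable c).mul_right _).hasSum) fun i => ?_
  rw [norm_mul]
  exact mul_le_mul_of_nonneg_left (hC i p) (norm_nonneg _)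

/-- The cut-off form as a continuous functional of the coefficients of the amplitude. -/
lemma exists_clm_Bil {Φ : E3 n → ℝ} (hΦ : Continuous Φ) {b : ι → E3 n → ℂ} (hb : UnifSmooth b)
    {A : E3 n → ℂ} (hA : Continuous A) {CA : ℝ} (hCA : ∀ p, ‖A p‖ ≤ CA)
    {g : E n → ℂ} (hg : IsTest g) {u v : E n → ℂ} (hu : IsTest u) (hv : IsTest v) :
    ∃ Λ : lp (fun _ : ι => ℂ) 1 →L[ℂ] ℂ, ∀ c,
      Λ c = Bil Φ (fun p => g p.2.2 * (serAmp b c p * A p)) u v := by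
  obtain ⟨C, hC0, hC⟩ := hb.bound
  have hle : ∀ (c : lp (fun _ : ι => ℂ) 1) p, ‖serAmp b c p * A p‖ ≤ ‖c‖ * C * CA := by
    intro c p
    rw [norm_mul]
    have := norm_serAmp_le hC c p
    have := hCA p
    gcongr
  have hdom : ∀ c : lp (fun _ : ι => ℂ) 1, AmpDom (fun p => g p.2.2 * (serAmp b c p * A p))
      (fun ξ => (‖c‖ * C * CA) * ‖g ξ‖) := fun c =>
    ampDom_cutoff ((hb.contDiff_serAmp (lp_one_summable c)).continuous.mul hA) (hle c) hg
  let L : lp (fun _ : ι => ℂ) 1 →ₗ[ℂ] ℂ :=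
    { toFun := fun c => Bil Φ (fun p => g p.2.2 * (serAmp b c p * A p)) u v
      map_add' := by
        intro c c'
        rw [← Bil_add_amp hΦ (hdom c) (hdom c') hu.integrable hv.integrable]
        congr 1; funext p
        have h1 := hb.summable (lp_one_summable c) p
        have h2 := hb.summable (lp_one_summable c') p
        have : serAmp b (⇑(c + c')) p = serAmp b c p + serAmp b c' p := by
          simp only [serAmp, lp.coeFn_add, Pi.add_apply, add_mul]
          exact h1.tsum_add h2
        rw [this]; ring
      map_smul' := by
        intro r c
        simp only [RingHom.id_apply, smul_eq_mul]
        rw [← Bil_smul_amp]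
        congr 1; funext p
        have : serAmp b (⇑(r • c)) p = r * serAmp b c p := by
          simp only [serAmp, lp.coeFn_smul, Pi.smul_apply, smul_eq_mul, mul_assoc]
          exact tsum_mul_left
        rw [this]; ring }
  refine ⟨L.mkContinuous (C * CA * ∫ p : E3 n, ‖v p.1‖ * (‖u p.2.1‖ * ‖g p.2.2‖)) fun c => ?_,
    fun c => rfl⟩
  refine (norm_Bil_le (hdom c) hu.integrable hv.integrable).trans (le_of_eq ?_)
  rw [← integral_const_mul, ← integral_mul_const]
  congr 1; funext p; ring

/-- For c in ℓ¹ the series ∑ c_i b_i is a symbol of order 0, so its product with `A` has order `μ`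
and the hypothesis applies to it. Thus the functionals c ↦ ⟨𝒫u, v⟩ / N(u, v), over all admissible
pairs (u, v), are bounded at each c, hence uniformly bounded by Banach–Steinhaus. The unit
coordinate vectors return the single members b_i of the family. -/
lemma uniform_of_forall {Φ : E3 n → ℝ} (hΦ : Continuous Φ) {μ : ℝ} (hμ : μ ≤ 0) {A : E3 n → ℂ}
    (hA : IsSymbol μ A) {b : ι → E3 n → ℂ} (hbs : ∀ i, ContDiff ℝ ∞ (b i))
    (hb : ∀ k, SymE3 k 0 b) (hdom : ∀ i, ∃ G, AmpDom (fun p => b i p * A p) G)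
    {𝒰 : Set ((E n → ℂ) × (E n → ℂ))} (h𝒰 : ∀ w ∈ 𝒰, IsTest w.1 ∧ IsTest w.2)
    {N : (E n → ℂ) × (E n → ℂ) → ℝ} (hN : ∀ w, 0 ≤ N w)
    (h : ∀ A' : E3 n → ℂ, IsSymbol μ A' → ∃ C : ℝ, ∀ w ∈ 𝒰, ∃ f, Represents Φ A' w.1 f ∧
      ‖∫ x, f x * w.2 x‖ ≤ C * N w) :
    ∃ C : ℝ, 0 ≤ C ∧ ∀ i, ∀ w ∈ 𝒰, ‖Bil Φ (fun p => b i p * A p) w.1 w.2‖ ≤ C * N w := by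
  classical
  obtain ⟨g, hg, hg0, hg1⟩ := exists_cutoff n
  obtain ⟨CA, -, hCA⟩ := hA.bdd hμ
  have hu := unifSmooth_of_symB hbs hb
  have hsym : ∀ c : lp (fun _ : ι => ℂ) 1, IsSymbol μ (fun p => serAmp b c p * A p) := by
    intro c
    have := (isSymbol_serAmp (lp_one_summable c) hbs hb).mul hA
    rwa [zero_add] at this
  -- For a fixed pair the cut-off forms are continuous in c and converge at every c, so the limit is
  -- continuous as well. Its value does not depend on the function chosen to represent 𝒫u.
  have hex : ∀ w : 𝒰, ∃ Λ : lp (fun _ : ι => ℂ) 1 →L[ℂ] ℂ, ∀ (c : lp (fun _ : ι => ℂ) 1) f,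
      Represents Φ (fun p => serAmp b c p * A p) w.1.1 f → Λ c = ∫ x, f x * w.1.2 x := by
    intro w
    obtain ⟨h1, h2⟩ := h𝒰 w.1 w.2
    have hk : ∀ k : ℕ, (0 : ℝ) < 1 / ((k : ℝ) + 1) := fun k => by positivity
    choose Λ hΛ using fun k : ℕ => exists_clm_Bil hΦ hu hA.1.continuous hCA
      (hg.comp_smul (hk k).ne') h1 h2
    have hlim : ∀ (c : lp (fun _ : ι => ℂ) 1) f, Represents Φ (fun p => serAmp b c p * A p) w.1.1 f →
        Tendsto (fun k => Λ k c) atTop (𝓝 (∫ x, f x * w.1.2 x)) := by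
      intro c f hf
      simp only [hΛ]
      exact (hf.tendsto hΦ hμ (hsym c) h1 hg hg0 h2).comp tendsto_inv_nhdsGT
    choose C hC using fun c : lp (fun _ : ι => ℂ) 1 => h _ (hsym c)
    choose f hf hfC using fun c : lp (fun _ : ι => ℂ) 1 => hC c w.1 w.2
    have hpt : Tendsto (fun k c => Λ k c) atTop (𝓝 (fun c => ∫ x, f c x * w.1.2 x)) :=
      tendsto_pi_nhds.2 fun c => hlim c _ (hf c)
    refine ⟨continuousLinearMapOfTendsto Λ hpt, fun c f' hf' => ?_⟩
    exact tendsto_nhds_unique (hlim c _ (hf c)) (hlim c _ hf')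
  choose Λ hΛ using hex
  -- At a coordinate vector the amplitude b_i A is dominated by an integrable function of ξ, so the
  -- auxiliary cut-off disappears by dominated convergence.
  have hval : ∀ i (w : 𝒰), Λ w (lp.single 1 i 1) = Bil Φ (fun p => b i p * A p) w.1.1 w.1.2 := by
    intro i w
    obtain ⟨h1, h2⟩ := h𝒰 w.1 w.2
    obtain ⟨C, hC⟩ := h _ (hsym (lp.single 1 i 1))
    obtain ⟨f, hf, -⟩ := hC w.1 w.2
    rw [hΛ w _ f hf]
    have hser : serAmp b (⇑(lp.single 1 i (1 : ℂ) : lp (fun _ : ι => ℂ) 1)) = b i := by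
      funext p
      rw [serAmp, tsum_eq_single i]
      · simp
      · intro j hj
        simp [lp.single_apply, hj]
    have hlim := (hf.tendsto hΦ hμ (hsym _) h1 hg hg0 h2).comp tendsto_inv_nhdsGT
    rw [hser] at hlim
    obtain ⟨G, hG⟩ := hdom i
    refine tendsto_nhds_unique hlim ?_
    refine tendsto_Bil hΦ (G := G) (U := fun x => ‖w.1.1 x‖) (V := fun x => ‖w.1.2 x‖)
      (Eventually.of_forall fun k => ⟨?_, hG.int, fun p => ?_⟩) hG.int (fun p => ?_)
      (fun k => h1.integrable.1) h1.integrable.norm (fun k => Eventually.of_forall fun x => le_rfl)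
      (Eventually.of_forall fun x => tendsto_const_nhds)
      (fun k => h2.integrable.1) h2.integrable.norm (fun k => Eventually.of_forall fun x => le_rfl)
      (Eventually.of_forall fun x => tendsto_const_nhds)
    · exact (hg.1.continuous.comp (by fun_prop)).mul hG.cont
    · rw [norm_mul]
      have h3 := hg1 ((1 / ((k : ℝ) + 1)) • p.2.2)
      have h4 := hG.le p
      calc _ ≤ 1 * ‖b i p * A p‖ := by gcongr
        _ ≤ _ := by rw [one_mul]; exact h4
    · have : Tendsto (fun k : ℕ => g ((1 / ((k : ℝ) + 1)) • p.2.2)) atTop (𝓝 (g ((0 : ℝ) • p.2.2))) :=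
        (hg.1.continuous.tendsto _).comp
          (tendsto_one_div_add_atTop_nhds_zero_nat.smul_const p.2.2)
      rw [zero_smul, hg0] at this
      simpa using this.mul_const (b i p * A p)
  -- Where N vanishes the inverse is 0 and the normalised functional carries no information; those
  -- pairs are treated separately below.
  obtain ⟨C, hC⟩ := banach_steinhaus (g := fun w : 𝒰 => ((N w.1)⁻¹ : ℂ) • Λ w) (fun c => by
    obtain ⟨C, hC⟩ := h _ (hsym c)
    refine ⟨|C|, fun w => ?_⟩
    obtain ⟨f, hf, hfC⟩ := hC w.1 w.2
    rw [smul_apply, norm_smul, hΛ w c f hf, norm_inv, Complex.norm_real, Real.norm_eq_abs,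
      abs_of_nonneg (hN _)]
    rcases (hN w.1).eq_or_lt with h0 | h0
    · rw [← h0]; simp
    · rw [inv_mul_le_iff₀ h0, mul_comm]
      exact hfC.trans (mul_le_mul_of_nonneg_right (le_abs_self C) h0.le))
  refine ⟨|C|, abs_nonneg _, fun i w hw => ?_⟩
  rw [← hval i ⟨w, hw⟩]
  rcases (hN w).eq_or_lt with h0 | h0
  · obtain ⟨C', hC'⟩ := h _ (hsym (lp.single 1 i 1))
    obtain ⟨f, hf, hfC⟩ := hC' w hw
    rw [hΛ ⟨w, hw⟩ _ f hf, ← h0, mul_zero]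
    rwa [← h0, mul_zero] at hfC
  · have h1 := (((N w)⁻¹ : ℂ) • Λ ⟨w, hw⟩).le_of_opNorm_le (hC ⟨w, hw⟩) (lp.single 1 i 1)
    have h2 : ‖(lp.single 1 i (1 : ℂ) : lp (fun _ : ι => ℂ) 1)‖ = 1 := by
      simp
    rw [h2, mul_one, smul_apply, norm_smul, norm_inv, Complex.norm_real, Real.norm_eq_abs,
      abs_of_pos h0, inv_mul_le_iff₀ h0, mul_comm] at h1
    exact h1.trans (mul_le_mul_of_nonneg_right (le_abs_self C) h0.le)

end UniformBoundedness

/-! ### Integration by parts and decay of the kernel away from the diagonal. -/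

section FarKernel

variable {n : ℕ}

lemma symB_bddconst {S : Type*} [NormedAddCommGroup S] [NormedSpace ℝ S] {D ι : Type*}
    {J : S → ℝ} {e : D → S} {o : D → ℝ} {c : ι → ℂ} {C : ℝ} (hc : ∀ i, ‖c i‖ ≤ C) (k : ℕ) :
    SymB J e o k 0 (fun i (_ : S) => c i) := by
  cases k with
  | zero => exact ⟨C, fun i p => by simpa using hc i⟩
  | succ k =>
    refine ⟨⟨C, fun i p => by simpa using hc i⟩, fun d => ?_⟩
    have : (fun i => pd (e d) (fun _ : S => c i)) = fun _ _ => (0 : ℂ) := by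
      funext i p; simp [pd]
    rw [this]
    exact symB_const 0 _ (Or.inr rfl) k

lemma jap_rpow_integrable {s : ℝ} (hs : s < -(n : ℝ)) : Integrable (fun ξ : E n => jap ξ ^ s) := by
  have h := integrable_rpow_neg_one_add_norm_sq (E := E n) (μ := volume) (r := -s)
    (by simp only [finrank_euclideanSpace, Fintype.card_fin]; linarith)
  refine h.congr (Eventually.of_forall fun ξ => ?_)
  simp only [jap, Real.sqrt_eq_rpow]
  rw [← Real.rpow_mul (by positivity)]
  congr 1; ring

/-- The derivative `∂_{ξ_j}` of the full phase. -/
def phaseXi (Φ : E3 n → ℝ) (j : Fin n) (x y ξ : E n) : ℂ :=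
  ((x j - y j : ℝ) : ℂ) + (partialXi Φ j (x, y, ξ) : ℂ)

lemma contDiff_osc {Φ : E3 n → ℝ} (hΦ : ContDiff ℝ ∞ Φ) : ContDiff ℝ ∞ (osc Φ) := by
  have h1 : ContDiff ℝ ∞ (fun p : E3 n => (inner ℝ (p.1 - p.2.1) p.2.2 + Φ p : ℝ)) :=
    (((contDiff_fst.sub (contDiff_fst.comp contDiff_snd)).inner ℝ
      (contDiff_snd.comp contDiff_snd))).add hΦ
  exact (contDiff_const.mul (Complex.ofRealCLM.contDiff.comp h1)).cexp

lemma pd_osc {Φ : E3 n → ℝ} (hΦ : ContDiff ℝ ∞ Φ) (x y : E n) (j : Fin n) :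
    pd (EuclideanSpace.single j (1 : ℝ)) (fun ξ => osc Φ (x, y, ξ)) =
      fun ξ => Complex.I * phaseXi Φ j x y ξ * osc Φ (x, y, ξ) := by
  funext ξ
  have h1 : HasFDerivAt (fun ξ : E n => inner ℝ (x - y) ξ) (innerSL ℝ (x - y)) ξ :=
    (innerSL ℝ (x - y)).hasFDerivAt
  have h2 := (contDiff_diff (contDiff_slice hΦ x y) ξ).hasFDerivAt
  have h3 := Complex.ofRealCLM.hasFDerivAt.comp ξ (h1.add h2)
  have h4 := (h3.const_mul Complex.I).cexp
  have h5 : fderiv ℝ (fun ξ => Φ (x, y, ξ)) ξ (EuclideanSpace.single j (1 : ℝ)) =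
      partialXi Φ j (x, y, ξ) := congrFun (pd_slice hΦ x y j) ξ
  have h6 := congrArg (fun L => L (EuclideanSpace.single j (1 : ℝ))) h4.fderiv
  refine h6.trans ?_
  simp only [smul_apply, ContinuousLinearMap.comp_apply, add_apply, h5, innerSL_apply_apply,
    EuclideanSpace.inner_single_right, Complex.ofRealCLM_apply, smul_eq_mul, phaseXi, osc,
    Function.comp_apply, Pi.add_apply]
  simp
  ring

lemma isSymbol_ofReal {κ : ℝ} {a : E3 n → ℝ} (ha : IsSymbol κ a) :
    IsSymbol κ (fun p => (a p : ℂ)) :=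
  IsSymbol.swap Complex.ofRealLI (ha.swap LinearIsometry.id)

/-- Pairs `(x, y)` at distance `≥ 2 M` and `≥ 1` in the `j`-th coordinate. -/
def FarPair (n : ℕ) (j : Fin n) (M : ℝ) : Type :=
  {i : E n × E n // 1 ≤ |i.1 j - i.2 j| ∧ 2 * M ≤ |i.1 j - i.2 j|}

variable {Φ : E3 n → ℝ} {j : Fin n} {M : ℝ} {τ : Type*}

/-- The signed distance in the `j`-th coordinate. -/
def FarPair.gap (i : FarPair n j M) : ℝ := i.1.1 j - i.1.2 j

lemma FarPair.one_le (i : FarPair n j M) : 1 ≤ |i.gap| := i.2.1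

/-- The multiplier gained in an integration by parts. -/
def ibpMul (Φ : E3 n → ℝ) (i : τ × FarPair n j M) (ξ : E n) : ℂ :=
  i.2.gap / (Complex.I * phaseXi Φ j i.2.1.1 i.2.1.2 ξ)

/-- The gap is at least twice the bound on ∂_{ξ_j}Φ, so the perturbation can take away at most half
of it. -/
lemma gap_le_phaseXi (hM : ∀ p, |partialXi Φ j p| ≤ M) (i : FarPair n j M) (ξ : E n) :
    |i.gap| / 2 ≤ ‖phaseXi Φ j i.1.1 i.1.2 ξ‖ := by
  have h1 := hM (i.1.1, i.1.2, ξ)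
  have h2 : 2 * M ≤ |i.gap| := i.2.2
  have h3 : phaseXi Φ j i.1.1 i.1.2 ξ = ((i.gap + partialXi Φ j (i.1.1, i.1.2, ξ) : ℝ) : ℂ) := by
    simp [phaseXi, FarPair.gap]
  rw [h3, Complex.norm_real, Real.norm_eq_abs]
  have := abs_sub_abs_le_abs_sub i.gap (-partialXi Φ j (i.1.1, i.1.2, ξ))
  rw [abs_neg, sub_neg_eq_add] at this
  linarith

lemma phaseXi_ne_zero (hM : ∀ p, |partialXi Φ j p| ≤ M) (i : FarPair n j M) (ξ : E n) :
    phaseXi Φ j i.1.1 i.1.2 ξ ≠ 0 := by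
  have h1 := gap_le_phaseXi hM i ξ
  have h2 := i.one_le
  intro h
  rw [h, norm_zero] at h1
  linarith

lemma contDiff_phaseXi (hs : ContDiff ℝ ∞ (partialXi Φ j)) (x y : E n) :
    ContDiff ℝ ∞ (phaseXi Φ j x y) :=
  contDiff_const.add (Complex.ofRealCLM.contDiff.comp (contDiff_slice hs x y))

lemma contDiff_ibpMul (hs : ContDiff ℝ ∞ (partialXi Φ j)) (hM : ∀ p, |partialXi Φ j p| ≤ M)
    (i : τ × FarPair n j M) : ContDiff ℝ ∞ (ibpMul Φ i) := by
  have h1 : ContDiff ℝ ∞ (fun ξ => Complex.I * phaseXi Φ j i.2.1.1 i.2.1.2 ξ) :=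
    contDiff_const.mul (contDiff_phaseXi hs _ _)
  have h2 := h1.inv fun ξ => mul_ne_zero Complex.I_ne_zero (phaseXi_ne_zero hM i.2 ξ)
  exact (contDiff_const (c := (i.2.gap : ℂ))).mul h2

lemma pd_ibpMul (hs : ContDiff ℝ ∞ (partialXi Φ j)) (hM : ∀ p, |partialXi Φ j p| ≤ M)
    (i : τ × FarPair n j M) : pd (EuclideanSpace.single j (1 : ℝ)) (ibpMul Φ i) =
      fun ξ => (ibpMul Φ i ξ * ibpMul Φ i ξ) * ((-(Complex.I / i.2.gap)) *
        pd (dirXi j) (fun p => (partialXi Φ j p : ℂ)) (i.2.1.1, i.2.1.2, ξ)) := by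
  funext ξ
  have hs' : ContDiff ℝ ∞ (fun p : E3 n => (partialXi Φ j p : ℂ)) :=
    Complex.ofRealCLM.contDiff.comp hs
  have h0 := phaseXi_ne_zero hM i.2 ξ
  have hl : (i.2.gap : ℂ) ≠ 0 := by
    have := i.2.one_le
    intro h
    rw [Complex.ofReal_eq_zero] at h
    rw [h, abs_zero] at this
    linarith
  have h1 : HasFDerivAt (phaseXi Φ j i.2.1.1 i.2.1.2) _ ξ :=
    ((contDiff_diff (contDiff_slice hs' i.2.1.1 i.2.1.2) ξ).hasFDerivAt).const_add _
  have h2 := ((hasFDerivAt_inv' (𝕜 := ℝ) (mul_ne_zero Complex.I_ne_zero h0)).comp ξ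
    (h1.const_mul Complex.I)).const_mul (i.2.gap : ℂ)
  have h3 := congrArg (fun L => L (EuclideanSpace.single j (1 : ℝ))) h2.fderiv
  have h4 : ibpMul Φ i = fun ξ => (i.2.gap : ℂ) *
      (Complex.I * phaseXi Φ j i.2.1.1 i.2.1.2 ξ)⁻¹ := by
    funext ξ; rw [ibpMul, div_eq_mul_inv]
  have h5 := congrFun (pd_slice hs' i.2.1.1 i.2.1.2 j) ξ
  simp only [pd] at h5 ⊢
  rw [← h5]
  conv_lhs => rw [h4]
  refine h3.trans ?_
  simp only [ibpMul, smul_apply, smul_eq_mul, neg_apply, ContinuousLinearMap.comp_apply,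
    ContinuousLinearMap.mulLeftRight_apply]
  have hI : Complex.I ^ 2 = -1 := Complex.I_sq
  field_simp
  try ring

/-- The ξ_j-derivative is the square of the multiplier times ∂_{ξ_j}²Φ times a constant of modulus
1/|gap| ≤ 1. The second derivative of Φ has order -1, so the induction closes. -/
lemma symXi_ibpMul (hA1 : IsSymbol 0 (partialXi Φ j)) (hM : ∀ p, |partialXi Φ j p| ≤ M) (k : ℕ) :
    SymXi j k 0 (fun i : τ × FarPair n j M => ibpMul Φ i) := by
  have hb : ∀ (i : τ × FarPair n j M) (ξ : E n), ‖ibpMul Φ i ξ‖ ≤ 2 * jap ξ ^ (0 : ℝ) := by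
    intro i ξ
    have h1 := gap_le_phaseXi hM i.2 ξ
    have h2 := i.2.one_le
    rw [ibpMul, norm_div, norm_mul, Complex.norm_I, Complex.norm_real, Real.norm_eq_abs, one_mul,
      Real.rpow_zero, mul_one, div_le_iff₀ (by linarith)]
    linarith
  have hs := contDiff_ibpMul (τ := τ) hA1.1 hM
  have hJ : ∀ ξ : E n, 0 < jap ξ := jap_pos
  induction k with
  | zero => exact ⟨2, hb⟩
  | succ k ih =>
    refine ⟨⟨2, hb⟩, fun _ => ?_⟩
    simp only [pd_ibpMul hA1.1 hM]
    have hsym := isSymbol_ofReal hA1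
    have h1 : SymE3 k (0 - 1) (fun _ : Unit => pd (dirXi j) (fun p => (partialXi Φ j p : ℂ))) :=
      ((isSymbol_iff.1 hsym).2 (k + 1)).2 (Sum.inr (Sum.inr j))
    have h2 := (SymB.slice j k (fun _ => contDiff_pd hsym.1 _) h1).reindex
      (fun i : τ × FarPair n j M => ((), i.2.1))
    have h3 : SymXi j k 0 (fun (i : τ × FarPair n j M) (_ : E n) => -(Complex.I / i.2.gap)) :=
      symB_bddconst (C := 1) (fun i => by
        rw [norm_neg, norm_div, Complex.norm_I, Complex.norm_real, Real.norm_eq_abs]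
        exact div_le_one_of_le₀ i.2.one_le (abs_nonneg _)) k
    have h4 := SymB.mul hJ (fun _ => contDiff_const)
      (fun i => contDiff_slice (contDiff_pd hsym.1 _) _ _) h3 h2
    have h5 := SymB.mul hJ (fun i => (hs i).mul (hs i))
      (fun i => contDiff_const.mul (contDiff_slice (contDiff_pd hsym.1 _) _ _))
      (SymB.mul hJ hs hs ih ih) h4
    convert h5 using 1
    norm_num

/-- The oscillating factor equals gap^{-1} times the multiplier times its own ξ_j-derivative;
compact support in ξ removes the boundary term. -/
lemma ibp_step (hΦ : ContDiff ℝ ∞ Φ) (hs : ContDiff ℝ ∞ (partialXi Φ j))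
    (hM : ∀ p, |partialXi Φ j p| ≤ M) (i : τ × FarPair n j M) {b : E n → ℂ}
    (hb : ContDiff ℝ ∞ b) (hc : HasCompactSupport b) :
    ∫ ξ, osc Φ (i.2.1.1, i.2.1.2, ξ) * b ξ = (i.2.gap : ℂ)⁻¹ *
      ∫ ξ, osc Φ (i.2.1.1, i.2.1.2, ξ) *
        (-pd (EuclideanSpace.single j (1 : ℝ)) (fun ξ => b ξ * ibpMul Φ i ξ) ξ) := by
  have hq := contDiff_ibpMul hs hM i
  have hbq : ContDiff ℝ ∞ (fun ξ => b ξ * ibpMul Φ i ξ) := hb.mul hq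
  have hcq : HasCompactSupport (fun ξ => b ξ * ibpMul Φ i ξ) := hc.mul_right
  have hh : ContDiff ℝ ∞ (fun ξ => osc Φ (i.2.1.1, i.2.1.2, ξ)) := contDiff_slice (contDiff_osc hΦ) _ _
  have hpd := pd_osc hΦ i.2.1.1 i.2.1.2 j
  have hl : (i.2.gap : ℂ) ≠ 0 := by
    have := i.2.one_le
    intro h
    rw [Complex.ofReal_eq_zero] at h
    rw [h, abs_zero] at this
    linarith
  have key := integral_bilinear_fderiv_right_eq_neg_left_of_integrable (μ := volume)
    (B := ContinuousLinearMap.mul ℝ ℂ) (f := fun ξ => b ξ * ibpMul Φ i ξ) (g := fun ξ => osc Φ (i.2.1.1, i.2.1.2, ξ))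
    (v := EuclideanSpace.single j (1 : ℝ))
    (Continuous.integrable_of_hasCompactSupport
      ((contDiff_pd hbq _).continuous.mul hh.continuous) ((hcq.fderiv_apply ℝ _).mul_right))
    (Continuous.integrable_of_hasCompactSupport
      (hbq.continuous.mul (contDiff_pd hh _).continuous) hcq.mul_right)
    (Continuous.integrable_of_hasCompactSupport (hbq.continuous.mul hh.continuous) hcq.mul_right)
    (fun ξ _ => contDiff_diff hbq ξ) (fun ξ _ => contDiff_diff hh ξ)
  simp only [ContinuousLinearMap.mul_apply'] at key
  have e1 : ∀ ξ, osc Φ (i.2.1.1, i.2.1.2, ξ) * b ξ = (i.2.gap : ℂ)⁻¹ *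
      ((b ξ * ibpMul Φ i ξ) * fderiv ℝ (fun ξ => osc Φ (i.2.1.1, i.2.1.2, ξ)) ξ
        (EuclideanSpace.single j (1 : ℝ))) := by
    intro ξ
    have h0 := phaseXi_ne_zero hM i.2 ξ
    have := congrFun hpd ξ
    simp only [pd] at this
    rw [this, ibpMul]
    have hI := Complex.I_ne_zero
    field_simp
  simp_rw [e1]
  rw [integral_const_mul, key, ← integral_neg]
  congr 2
  funext ξ
  simp only [pd]
  ring

/-- Each integration by parts trades one order of the symbol for one factor |gap|^{-1}. After N of
them the order is below -n and the ξ-integral converges absolutely, uniformly in the family. -/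
lemma ibp_iterate (hΦ : ContDiff ℝ ∞ Φ) (hA1 : IsSymbol 0 (partialXi Φ j))
    (hM : ∀ p, |partialXi Φ j p| ≤ M) (N : ℕ) : ∀ (κ : ℝ) (b : τ × FarPair n j M → E n → ℂ),
    κ - N < -(n : ℝ) → (∀ i, ContDiff ℝ ∞ (b i)) → (∀ i, HasCompactSupport (b i)) →
    SymXi j N κ b → ∃ C : ℝ, ∀ i, ‖∫ ξ, osc Φ (i.2.1.1, i.2.1.2, ξ) * b i ξ‖ ≤
      C * (|i.2.gap|⁻¹) ^ N := by
  induction N with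
  | zero =>
    rintro κ b hκ - - ⟨C, hC⟩
    refine ⟨∫ ξ : E n, C * jap ξ ^ κ, fun i => ?_⟩
    rw [pow_zero, mul_one]
    refine norm_integral_le_of_norm_le ((jap_rpow_integrable (by simpa using hκ)).const_mul C)
      (Eventually.of_forall fun ξ => ?_)
    rw [norm_mul, norm_osc, one_mul]
    exact hC i ξ
  | succ N ih =>
    intro κ b hκ hb hc hsym
    have hq := contDiff_ibpMul (τ := τ) hA1.1 hM
    have h1 : SymXi j (N + 1) κ (fun i ξ => b i ξ * ibpMul Φ i ξ) := by
      have := SymB.mul (fun ξ : E n => jap_pos ξ) hb hq hsym (symXi_ibpMul hA1 hM (N + 1))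
      rwa [add_zero] at this
    have h2 := h1.2 ()
    have h3 : SymXi j N (κ - 1) (fun i ξ =>
        -pd (EuclideanSpace.single j (1 : ℝ)) (fun ξ => b i ξ * ibpMul Φ i ξ) ξ) := by
      have := h2.const_mul (fun ξ : E n => jap_pos ξ)
        (fun i => contDiff_pd ((hb i).mul (hq i)) _) (-1)
      simpa only [neg_one_mul] using this
    obtain ⟨C, hC⟩ := ih (κ - 1) _ (by push_cast at hκ; linarith)
      (fun i => (contDiff_pd ((hb i).mul (hq i)) _).neg)
      (fun i => by
        have h4 : HasCompactSupport (fun ξ => b i ξ * ibpMul Φ i ξ) := (hc i).mul_right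
        exact (h4.fderiv_apply ℝ (EuclideanSpace.single j (1 : ℝ))).neg) h3
    refine ⟨C, fun i => ?_⟩
    rw [ibp_step hΦ hA1.1 hM i (hb i) (hc i), norm_mul, norm_inv, Complex.norm_real,
      Real.norm_eq_abs, pow_succ, ← mul_assoc, mul_comm]
    exact mul_le_mul_of_nonneg_right (hC i) (by positivity)

lemma exists_coord_large (v : E n) (hv : v ≠ 0) : ∃ j, ‖v‖ ≤ n * |v j| := by
  by_contra! h
  have h1 : ‖v‖ ≤ ∑ j, |v j| := by
    conv_lhs => rw [← sum_single v]
    refine (norm_sum_le _ _).trans (Finset.sum_le_sum fun j _ => ?_)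
    simp [norm_smul]
  have hn : 0 < n := by
    rcases Nat.eq_zero_or_pos n with rfl | h
    · exact absurd (Subsingleton.elim v 0) hv
    · exact h
  have : Nonempty (Fin n) := ⟨⟨0, hn⟩⟩
  have h2 : ∑ j, (n * |v j|) < ∑ _j : Fin n, ‖v‖ :=
    Finset.sum_lt_sum_of_nonempty Finset.univ_nonempty fun j _ => h j
  rw [← Finset.mul_sum, Finset.sum_const, Finset.card_univ, Fintype.card_fin, nsmul_eq_mul] at h2
  have hn' : (0 : ℝ) < n := by exact_mod_cast hn
  nlinarith

/-- Away from the diagonal the kernels of the cut-off operators decay rapidly, uniformly in the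
cut-off. -/
lemma far_kernel (hΦ : ContDiff ℝ ∞ Φ) (hA1 : ∀ j, IsSymbol 0 (partialXi Φ j)) :
    ∃ ρ : ℝ, 1 ≤ ρ ∧ ∀ (μ : ℝ) (A : E3 n → ℂ) (g : E n → ℂ), μ ≤ 0 → IsSymbol μ A → IsTest g →
      ∃ C : ℝ, 0 ≤ C ∧ ∀ ε : ℝ, 0 < ε → ε ≤ 1 → ∀ x y : E n, ρ ≤ ‖x - y‖ →
        ‖∫ ξ, osc Φ (x, y, ξ) * (g (ε • ξ) * A (x, y, ξ))‖ ≤ C * (‖x - y‖⁻¹) ^ (n + 1) := by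
  choose M hM0 hM using fun j => (hA1 j).bound
  have hM1 : ∀ j p, |partialXi Φ j p| ≤ ∑ i, M i := by
    intro j p
    have := hM j p
    rw [Real.rpow_zero, mul_one, Real.norm_eq_abs] at this
    exact this.trans (Finset.single_le_sum (fun i _ => hM0 i) (Finset.mem_univ j))
  set M' := ∑ i, M i
  have hM'0 : 0 ≤ M' := Finset.sum_nonneg fun i _ => hM0 i
  -- Some coordinate satisfies ‖x - y‖ ≤ n |x_j - y_j|, so at this distance |x_j - y_j| ≥ 2M' + 1
  -- and the pair is far in direction j. The threshold depends on Φ only.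
  refine ⟨1 + n * (2 * M' + 1), by nlinarith [(Nat.cast_nonneg n : (0 : ℝ) ≤ n)], ?_⟩
  intro μ A g hμ hA hg
  have hC : ∀ j, ∃ C : ℝ, ∀ i : Set.Ioc (0 : ℝ) 1 × FarPair n j M',
      ‖∫ ξ, osc Φ (i.2.1.1, i.2.1.2, ξ) * (g ((i.1 : ℝ) • ξ) * A (i.2.1.1, i.2.1.2, ξ))‖ ≤
        C * (|i.2.gap|⁻¹) ^ (n + 1) := by
    intro j
    have hg1 : ∀ ε : Set.Ioc (0 : ℝ) 1, ContDiff ℝ ∞ (fun p : E3 n => g ((ε : ℝ) • p.2.2)) :=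
      fun ε => contDiff_lift (b := fun ξ : E n => g ((ε : ℝ) • ξ))
        (hg.1.comp (contDiff_const_smul _))
    have h1 : SymE3 (n + 1) μ (fun (ε : Set.Ioc (0 : ℝ) 1) (p : E3 n) =>
        g ((ε : ℝ) • p.2.2) * A p) := by
      have h2 := symE3_cutoff_family (n + 1) 0 g hg
      simp only [pow_zero, one_mul, Nat.cast_zero, neg_zero] at h2
      have h3 := SymB.mul (fun p : E3 n => jap_pos p.2.2) hg1 (fun _ => hA.1) h2
        (((isSymbol_iff.1 hA).2 (n + 1)).reindex (fun _ : Set.Ioc (0 : ℝ) 1 => ()))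
      rwa [zero_add] at h3
    have h4 := (SymB.slice j (n + 1) (fun ε => (hg1 ε).mul hA.1) h1).reindex
      (fun i : Set.Ioc (0 : ℝ) 1 × FarPair n j M' => (i.1, i.2.1))
    -- With n + 1 steps the order μ - (n + 1) is below -n because μ ≤ 0, and the decay |x -
    -- y|^{-(n+1)} is integrable at infinity.
    exact ibp_iterate hΦ (hA1 j) (hM1 j) (n + 1) μ _ (by push_cast; linarith)
      (fun i => contDiff_slice ((hg1 i.1).mul hA.1) _ _)
      (fun i => ((hg.comp_smul (ne_of_gt i.1.2.1)).2).mul_right) h4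
  choose C hC using hC
  refine ⟨(∑ j, |C j|) * n ^ (n + 1), by positivity, ?_⟩
  intro ε h0 h1 x y hxy
  have hne : x - y ≠ 0 := by
    intro h
    rw [h, norm_zero] at hxy
    nlinarith [(Nat.cast_nonneg n : (0 : ℝ) ≤ n)]
  obtain ⟨j, hj⟩ := exists_coord_large (x - y) hne
  have hn' : (0 : ℝ) < n := by exact_mod_cast (j.pos)
  have hv : 0 < ‖x - y‖ := norm_pos_iff.2 hne
  have hgap : 2 * M' + 1 ≤ |x j - y j| := by
    have h3 : (n : ℝ) * (2 * M' + 1) ≤ n * |x j - y j| := by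
      have : (x - y) j = x j - y j := rfl
      rw [this] at hj
      linarith
    exact le_of_mul_le_mul_left h3 hn'
  have h2 := hC j (⟨ε, h0, h1⟩, ⟨(x, y), by simp only; linarith, by simp only; linarith⟩)
  refine h2.trans ?_
  have h5 : |x j - y j|⁻¹ ≤ n * ‖x - y‖⁻¹ := by
    rw [← div_eq_mul_inv, inv_le_comm₀ (by linarith) (by positivity), inv_div,
      div_le_iff₀ hn', mul_comm]
    exact hj
  have h6 : (|x j - y j|⁻¹) ^ (n + 1) ≤ (n * ‖x - y‖⁻¹) ^ (n + 1) :=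
    pow_le_pow_left₀ (by positivity) h5 _
  calc C j * (|x j - y j|⁻¹) ^ (n + 1) ≤ (∑ j, |C j|) * (n * ‖x - y‖⁻¹) ^ (n + 1) := by
        refine mul_le_mul ?_ h6 (by positivity) (Finset.sum_nonneg fun _ _ => abs_nonneg _)
        exact (le_abs_self _).trans
          (Finset.single_le_sum (f := fun j => |C j|) (fun i _ => abs_nonneg _) (Finset.mem_univ j))
    _ = _ := by rw [mul_pow]; ring

end FarKernel

/-! ### The Hardy norm of atoms. -/

section Hardy

variable {n : ℕ}

/-- The integral of `r ^ (-n) (1 + |x - x₀| / r) ^ (-(n+1))` does not depend on `x₀` and `r`. -/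
def decayConst (n : ℕ) : ℝ := ∫ x : E n, (1 + ‖x‖) ^ (-((n : ℝ) + 1))

lemma integrable_decay : Integrable (fun x : E n => (1 + ‖x‖) ^ (-((n : ℝ) + 1))) :=
  integrable_one_add_norm (by simp)

/-- The `L¹`-normalised decaying bump at scale `r` around `x₀`. -/
def decay (x₀ : E n) (r : ℝ) (x : E n) : ℝ :=
  (r ^ n)⁻¹ * (1 + ‖r⁻¹ • (x - x₀)‖) ^ (-((n : ℝ) + 1))

lemma integrable_decay' (x₀ : E n) {r : ℝ} (hr : 0 < r) : Integrable (decay x₀ r) := by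
  have h1 := (integrable_decay (n := n)).comp_smul (R := r⁻¹) (by positivity)
  exact (h1.comp_sub_right x₀).const_mul _

lemma integral_decay (x₀ : E n) {r : ℝ} (hr : 0 < r) : ∫ x, decay x₀ r x = decayConst n := by
  simp only [decay]
  rw [integral_const_mul, integral_sub_right_eq_self
    (f := fun x : E n => (1 + ‖r⁻¹ • x‖) ^ (-((n : ℝ) + 1))) x₀,
    Measure.integral_comp_inv_smul_of_nonneg volume
      (fun x : E n => (1 + ‖x‖) ^ (-((n : ℝ) + 1))) hr.le]
  simp only [finrank_euclideanSpace, Fintype.card_fin, smul_eq_mul, decayConst]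
  rw [← mul_assoc, inv_mul_cancel₀ (by positivity), one_mul]

lemma decay_eq (x₀ : E n) {r : ℝ} (hr : 0 < r) (x : E n) :
    decay x₀ r x = r * ((r + ‖x - x₀‖) ^ (n + 1))⁻¹ := by
  have h1 : 1 + ‖r⁻¹ • (x - x₀)‖ = r⁻¹ * (r + ‖x - x₀‖) := by
    rw [norm_smul, norm_inv, Real.norm_eq_abs, abs_of_pos hr]; field_simp
  have h2 : (-((n : ℝ) + 1)) = -((n + 1 : ℕ) : ℝ) := by push_cast; ring
  have h3 : 0 < r + ‖x - x₀‖ := by positivity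
  rw [decay, h1, h2, Real.rpow_neg (by positivity), Real.rpow_natCast, mul_pow, mul_inv, inv_pow,
    inv_inv, pow_succ r]
  field_simp

lemma gauss_nonneg {t : ℝ} (ht : 0 < t) (x : E n) : 0 ≤ gauss t x := by
  unfold gauss; positivity

lemma integral_gauss {t : ℝ} (ht : 0 < t) : ∫ x : E n, gauss t x = 1 := by
  have h := GaussianFourier.integral_rexp_neg_mul_sq_norm (V := E n)
    (b := Real.pi / t ^ 2) (by positivity)
  have h1 : ∀ x : E n, gauss t x = (t ^ n)⁻¹ * Real.exp (-(Real.pi / t ^ 2) * ‖x‖ ^ 2) := by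
    intro x; rw [gauss]; congr 2; ring
  simp only [h1]
  rw [integral_const_mul, h]
  have h2 : Real.pi / (Real.pi / t ^ 2) = t ^ 2 := by
    field_simp
  rw [h2, finrank_euclideanSpace, Fintype.card_fin, ← Real.rpow_natCast t 2,
    ← Real.rpow_mul ht.le]
  have h3 : ((2 : ℕ) : ℝ) * ((n : ℝ) / 2) = n := by push_cast; ring
  rw [h3, Real.rpow_natCast, inv_mul_cancel₀ (by positivity)]

lemma integrable_gauss {t : ℝ} (ht : 0 < t) : Integrable (gauss t : E n → ℝ) := by
  by_contra h
  have := integral_gauss (n := n) ht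
  rw [integral_undef h] at this
  exact zero_ne_one this

/-- `u` is bounded by `r ^ (-n)` and supported in the ball of radius `r` around `x₀`. -/
structure SizeCond (x₀ : E n) (r : ℝ) (u : E n → ℂ) : Prop where
  pos : 0 < r
  supp : Function.support u ⊆ Metric.closedBall x₀ r
  le : ∀ x, ‖u x‖ ≤ (r ^ n)⁻¹

/-- The volume of the unit ball. -/
def ballVol (n : ℕ) : ℝ := (volume (Metric.ball (0 : E n) 1)).toReal

lemma volume_closedBall_toReal (x₀ : E n) {r : ℝ} (hr : 0 ≤ r) :
    (volume (Metric.closedBall x₀ r)).toReal = r ^ n * ballVol n := by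
  rw [Measure.addHaar_closedBall _ _ hr, ENNReal.toReal_mul, ENNReal.toReal_ofReal (by positivity),
    finrank_euclideanSpace, Fintype.card_fin, ballVol]

lemma SizeCond.norm_le_indicator {x₀ : E n} {r : ℝ} {u : E n → ℂ} (h : SizeCond x₀ r u) (x : E n) :
    ‖u x‖ ≤ (Metric.closedBall x₀ r).indicator (fun _ => (r ^ n)⁻¹) x := by
  by_cases hx : x ∈ Metric.closedBall x₀ r
  · rw [Set.indicator_of_mem hx]; exact h.le x
  · rw [Set.indicator_of_notMem hx]
    have : u x = 0 := by
      by_contra h0; exact hx (h.supp h0)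
    rw [this, norm_zero]

lemma integrable_ball_const (x₀ : E n) (r c : ℝ) :
    Integrable ((Metric.closedBall x₀ r).indicator (fun _ : E n => c)) :=
  (integrable_indicator_iff Metric.isClosed_closedBall.measurableSet).2
    (integrableOn_const (measure_closedBall_lt_top.ne))

lemma SizeCond.integral_norm_le {x₀ : E n} {r : ℝ} {u : E n → ℂ} (h : SizeCond x₀ r u) :
    ∫ x, ‖u x‖ ≤ ballVol n := by
  have h1 : ∫ x, ‖u x‖ ≤ ∫ x, (Metric.closedBall x₀ r).indicator (fun _ : E n => (r ^ n)⁻¹) x :=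
    integral_mono_of_nonneg (Eventually.of_forall fun x => norm_nonneg _)
      (integrable_ball_const _ _ _) (Eventually.of_forall h.norm_le_indicator)
  refine h1.trans (le_of_eq ?_)
  rw [integral_indicator Metric.isClosed_closedBall.measurableSet, setIntegral_const,
    Measure.real, volume_closedBall_toReal _ h.pos.le, smul_eq_mul]
  have := h.pos
  field_simp

lemma exp_diff_le {a b : ℝ} : |Real.exp (-a) - Real.exp (-b)| ≤
    |a - b| * Real.exp (-(min a b)) := by
  wlog hab : a ≤ b generalizing a b
  · rw [abs_sub_comm, abs_sub_comm a b, min_comm]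
    exact this (le_of_not_ge hab)
  rw [min_eq_left hab, abs_of_nonneg (sub_nonneg.2 (Real.exp_le_exp.2 (by linarith))),
    abs_of_nonpos (by linarith : a - b ≤ 0)]
  have h1 : Real.exp (-b) = Real.exp (-a) * Real.exp (a - b) := by
    rw [← Real.exp_add]; ring_nf
  have h2 := Real.add_one_le_exp (a - b)
  have h3 := Real.exp_pos (-a)
  rw [h1]
  nlinarith

/-- The mean value bound costs t^{-n-2}, and exp(-(d/2t)²) with d = |x - x₀| is at most a constant
times (t/d)^{n+2}. The powers of t cancel, so the bound is uniform over the maximal function. -/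
lemma exists_gauss_diff_le (n : ℕ) : ∃ C : ℝ, 0 ≤ C ∧ ∀ (t r : ℝ) (x y x₀ : E n), 0 < t → 0 < r →
    2 * r < ‖x - x₀‖ → ‖y - x₀‖ ≤ r →
    |gauss t (x - y) - gauss t (x - x₀)| ≤ C * (r * (‖x - x₀‖ ^ (n + 1))⁻¹) := by
  obtain ⟨C, hC⟩ := exists_pow_mul_exp_bound (n + 2)
  have hC0 : 0 ≤ C := (abs_nonneg _).trans (hC 0)
  refine ⟨Real.pi * (5 / 2) * 2 ^ (n + 2) * C, by positivity, ?_⟩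
  intro t r x y x₀ ht hr hx hy
  set d := ‖x - x₀‖ with hd
  have hd0 : 0 < d := by linarith
  set w := ‖x - y‖ with hw
  have h1 : |w - d| ≤ r := by
    refine (abs_norm_sub_norm_le _ _).trans ?_
    rw [show x - y - (x - x₀) = -(y - x₀) by abel, norm_neg]; exact hy
  obtain ⟨h2, h3⟩ := abs_le.1 h1
  have h4 : |w ^ 2 - d ^ 2| ≤ r * (5 / 2 * d) := by
    rw [show w ^ 2 - d ^ 2 = (w - d) * (w + d) by ring, abs_mul, abs_of_pos (by linarith : 0 < w + d)]
    have : w + d ≤ 5 / 2 * d := by linarith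
    gcongr
  have h5 : d ^ 2 / 4 ≤ min (w ^ 2) (d ^ 2) := by
    refine le_min ?_ (by nlinarith)
    nlinarith [sq_nonneg (w - d / 2)]
  have h6 : gauss t (x - y) - gauss t (x - x₀) = (t ^ n)⁻¹ *
      (Real.exp (-(Real.pi / t ^ 2 * w ^ 2)) - Real.exp (-(Real.pi / t ^ 2 * d ^ 2))) := by
    rw [gauss, gauss, mul_sub]
    congr 3 <;> ring
  have h7 : Real.pi / t ^ 2 * (d ^ 2 / 4) ≤
      min (Real.pi / t ^ 2 * w ^ 2) (Real.pi / t ^ 2 * d ^ 2) := by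
    rw [← mul_min_of_nonneg _ _ (by positivity)]
    gcongr
  have h8 : Real.exp (-min (Real.pi / t ^ 2 * w ^ 2) (Real.pi / t ^ 2 * d ^ 2)) ≤
      Real.exp (-(d / (2 * t)) ^ 2) := by
    apply Real.exp_le_exp.2
    have : (d / (2 * t)) ^ 2 ≤ Real.pi / t ^ 2 * (d ^ 2 / 4) := by
      have e : Real.pi / t ^ 2 * (d ^ 2 / 4) = Real.pi * (d / (2 * t)) ^ 2 := by
        field_simp; ring
      rw [e]
      nlinarith [Real.pi_gt_three, sq_nonneg (d / (2 * t))]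
    linarith
  have h9 := (le_abs_self _).trans (hC (d / (2 * t)))
  rw [h6, abs_mul, abs_of_pos (by positivity : 0 < (t ^ n)⁻¹)]
  have h10 := exp_diff_le (a := Real.pi / t ^ 2 * w ^ 2) (b := Real.pi / t ^ 2 * d ^ 2)
  rw [← mul_sub, abs_mul, abs_of_pos (by positivity : 0 < Real.pi / t ^ 2)] at h10
  have h11 : Real.exp (-(d / (2 * t)) ^ 2) ≤ C * ((2 * t) / d) ^ (n + 2) := by
    rw [show (2 * t) / d = (d / (2 * t))⁻¹ by rw [inv_div], inv_pow, ← div_eq_mul_inv,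
      le_div_iff₀ (by positivity), mul_comm]
    exact h9
  calc (t ^ n)⁻¹ * |Real.exp (-(Real.pi / t ^ 2 * w ^ 2)) - Real.exp (-(Real.pi / t ^ 2 * d ^ 2))|
      ≤ (t ^ n)⁻¹ * (Real.pi / t ^ 2 * (r * (5 / 2 * d)) * (C * ((2 * t) / d) ^ (n + 2))) := by
        gcongr
        refine h10.trans ?_
        have := h8.trans h11
        gcongr
    _ = _ := by
        rw [div_pow, mul_pow]
        field_simp
        ring

/-- Smooth atoms have bounded Hardy norm. -/
lemma exists_hardyNorm_atom_le (n : ℕ) : ∃ C : ℝ≥0, ∀ (x₀ : E n) (r : ℝ) (u : E n → ℂ),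
    IsTest u → SizeCond x₀ r u → ∫ x, u x = 0 → hardyNorm u ≤ C := by
  obtain ⟨C, hC0, hC⟩ := exists_gauss_diff_le n
  set C' : ℝ := 3 ^ (n + 1) + C * ballVol n * 2 ^ (n + 1) with hC'
  have hb0 : 0 ≤ ballVol n := ENNReal.toReal_nonneg
  have hC'0 : 0 ≤ C' := by positivity
  refine ⟨(C' * decayConst n).toNNReal, fun x₀ r u hu hs h0 => ?_⟩
  have hr := hs.pos
  have key : ∀ (x : E n) (t : ℝ), 0 < t →
      ‖∫ y : E n, (gauss t (x - y) : ℂ) * u y‖ ≤ C' * decay x₀ r x := by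
    intro x t ht
    rw [decay_eq x₀ hr]
    have hgx : Integrable (fun y : E n => gauss t (x - y)) :=
      (integrable_gauss ht).comp_sub_left x
    -- Near the atom the Gaussian mean is at most the supremum r^{-n}. Far away the zero mean allows
    -- subtracting the Gaussian centred at x₀. Both bounds are multiples of `decay x₀ r`, whose
    -- integral does not depend on x₀ and r.
    by_cases hx : ‖x - x₀‖ ≤ 2 * r
    · have h1 : ‖∫ y : E n, (gauss t (x - y) : ℂ) * u y‖ ≤ ∫ y : E n, gauss t (x - y) * (r ^ n)⁻¹ := by
        refine norm_integral_le_of_norm_le (hgx.mul_const _) (Eventually.of_forall fun y => ?_)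
        rw [norm_mul, Complex.norm_real, Real.norm_eq_abs, abs_of_nonneg (gauss_nonneg ht _)]
        exact mul_le_mul_of_nonneg_left (hs.le y) (gauss_nonneg ht _)
      rw [integral_mul_const, integral_sub_left_eq_self (gauss t) volume x, integral_gauss ht,
        one_mul] at h1
      refine h1.trans ?_
      have h2 : (r ^ n)⁻¹ ≤ 3 ^ (n + 1) * (r * ((r + ‖x - x₀‖) ^ (n + 1))⁻¹) := by
        have h3 : (r + ‖x - x₀‖) ^ (n + 1) ≤ (3 * r) ^ (n + 1) :=
          pow_le_pow_left₀ (by positivity) (by linarith) _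
        have h4 : 0 < (r + ‖x - x₀‖) ^ (n + 1) := by positivity
        rw [← mul_assoc, ← div_eq_mul_inv, le_div_iff₀ h4, inv_mul_le_iff₀ (by positivity)]
        refine h3.trans (le_of_eq ?_)
        rw [mul_pow]; ring
      refine h2.trans ?_
      gcongr
      rw [hC']
      have : 0 ≤ C * ballVol n * 2 ^ (n + 1) := by positivity
      linarith
    · rw [not_le] at hx
      have hux : Integrable (fun y => (gauss t (x - x₀) : ℂ) * u y) := hu.integrable.const_mul _
      have hgu : Integrable (fun y => (gauss t (x - y) : ℂ) * u y) := by
        refine (hgx.mul_const ((r ^ n)⁻¹)).mono' ?_ (Eventually.of_forall fun y => ?_)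
        · exact (Complex.continuous_ofReal.comp_aestronglyMeasurable hgx.1).mul hu.integrable.1
        · rw [norm_mul, Complex.norm_real, Real.norm_eq_abs, abs_of_nonneg (gauss_nonneg ht _)]
          exact mul_le_mul_of_nonneg_left (hs.le y) (gauss_nonneg ht _)
      have h1 : ∫ y : E n, (gauss t (x - y) : ℂ) * u y =
          ∫ y : E n, ((gauss t (x - y) - gauss t (x - x₀) : ℝ) : ℂ) * u y := by
        have h2 : ∫ y : E n, (gauss t (x - x₀) : ℂ) * u y = 0 := by
          rw [integral_const_mul, h0, mul_zero]
        rw [← sub_zero (∫ y : E n, (gauss t (x - y) : ℂ) * u y), ← h2, ← integral_sub hgu hux]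
        congr 1; funext y; push_cast; ring
      have h3 : ‖∫ y : E n, ((gauss t (x - y) - gauss t (x - x₀) : ℝ) : ℂ) * u y‖ ≤
          ∫ y : E n, C * (r * (‖x - x₀‖ ^ (n + 1))⁻¹) * ‖u y‖ := by
        refine norm_integral_le_of_norm_le (hu.integrable.norm.const_mul _)
          (Eventually.of_forall fun y => ?_)
        rw [norm_mul, Complex.norm_real, Real.norm_eq_abs]
        by_cases hy : u y = 0
        · rw [hy, norm_zero, mul_zero, mul_zero]
        · have := hs.supp hy
          rw [mem_closedBall_iff_norm] at this
          exact mul_le_mul_of_nonneg_right (hC t r x y x₀ ht hr hx this) (norm_nonneg _)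
      rw [integral_const_mul] at h3
      rw [h1]
      refine h3.trans ?_
      have h4 := hs.integral_norm_le
      have hd0 : 0 < ‖x - x₀‖ := by linarith
      have h5 : (‖x - x₀‖ ^ (n + 1))⁻¹ ≤ 2 ^ (n + 1) * ((r + ‖x - x₀‖) ^ (n + 1))⁻¹ := by
        have h6 : (r + ‖x - x₀‖) ^ (n + 1) ≤ (2 * ‖x - x₀‖) ^ (n + 1) :=
          pow_le_pow_left₀ (by positivity) (by linarith) _
        rw [← div_eq_mul_inv, le_div_iff₀ (by positivity), inv_mul_le_iff₀ (by positivity)]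
        rwa [mul_pow, mul_comm] at h6
      calc C * (r * (‖x - x₀‖ ^ (n + 1))⁻¹) * ∫ y, ‖u y‖
          ≤ C * (r * (2 ^ (n + 1) * ((r + ‖x - x₀‖) ^ (n + 1))⁻¹)) * ballVol n := by gcongr
        _ = (C * ballVol n * 2 ^ (n + 1)) * (r * ((r + ‖x - x₀‖) ^ (n + 1))⁻¹) := by ring
        _ ≤ _ := by
          gcongr
          rw [hC']
          have : (0 : ℝ) ≤ 3 ^ (n + 1) := by positivity
          linarith
  have h1 : hardyNorm u ≤ ∫⁻ x : E n, ENNReal.ofReal (C' * decay x₀ r x) := by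
    refine lintegral_mono fun x => iSup₂_le fun t ht => ?_
    rw [← ofReal_norm]
    exact ENNReal.ofReal_le_ofReal (key x t ht)
  refine h1.trans (le_of_eq ?_)
  rw [← ofReal_integral_eq_lintegral_ofReal ((integrable_decay' x₀ hr).const_mul C')
    (Eventually.of_forall fun x => ?_), integral_const_mul, integral_decay x₀ hr]
  · rfl
  · have := decay_eq x₀ hr x
    simp only [Pi.zero_apply]
    rw [this]; positivity

end Hardy

/-! ### Uniform L¹ bounds for the images of atoms. -/

section Atoms

variable {n : ℕ} {Φ : E3 n → ℝ}

lemma LocallyIntegrable.integrable_mul_test {f v : E n → ℂ} (hf : LocallyIntegrable f)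
    (hv : IsTest v) : Integrable (fun x => f x * v x) := by
  have := hf.integrable_smul_left_of_hasCompactSupport hv.1.continuous hv.2
  refine this.congr (Eventually.of_forall fun x => ?_)
  simp [mul_comm]

lemma integrable_bilInt_slice (hΦ : Continuous Φ) {A : E3 n → ℂ} {G : E n → ℝ}
    (hA : AmpDom A G) {u v : E n → ℂ} (hu : IsTest u) (hv : IsTest v) (x : E n) :
    Integrable (fun q : E n × E n => bilInt Φ A u v (x, q)) := by
  refine ((hu.integrable.norm.mul_prod hA.int).const_mul ‖v x‖).mono' ?_
    (Eventually.of_forall fun q => bilInt_le hA (x, q))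
  refine Continuous.aestronglyMeasurable ?_
  have : Continuous (bilInt Φ A u v) := by
    unfold bilInt
    exact (((continuous_osc hΦ).mul hA.cont).mul (hu.1.continuous.comp (by fun_prop))).mul
      (hv.1.continuous.comp (by fun_prop))
  exact this.comp (by fun_prop)

lemma Bil_eq_iterated (hΦ : Continuous Φ) {A : E3 n → ℂ} {G : E n → ℝ} (hA : AmpDom A G)
    {u v : E n → ℂ} (hu : IsTest u) (hv : IsTest v) :
    Bil Φ A u v = ∫ x, ∫ y, (∫ ξ, osc Φ (x, y, ξ) * A (x, y, ξ)) * u y * v x := by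
  rw [Bil, Measure.volume_eq_prod, integral_prod _
    (integrable_bilInt hΦ hA hu.integrable hv.integrable)]
  congr 1; funext x
  rw [Measure.volume_eq_prod, integral_prod _ (integrable_bilInt_slice hΦ hA hu hv x)]
  congr 1; funext y
  rw [← integral_mul_const, ← integral_mul_const]
  rfl

/-- Integrating the kernel bound first over the atom, whose L¹ norm is at most `ballVol n`, and then
in x keeps the estimate independent of x₀ and r. -/
lemma norm_Bil_far_le (hΦ : Continuous Φ) {A : E3 n → ℂ} {G : E n → ℝ} (hA : AmpDom A G)
    {u v : E n → ℂ} (hu : IsTest u) (hv : IsTest v) {x₀ : E n} {r : ℝ} (hs : SizeCond x₀ r u)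
    {c R : ℝ} (hc : 0 ≤ c)
    (hK : ∀ x y, R < ‖x - x₀‖ → ‖y - x₀‖ ≤ r →
      ‖∫ ξ, osc Φ (x, y, ξ) * A (x, y, ξ)‖ ≤ c * decay x₀ 1 x)
    (hv1 : ∀ x, ‖v x‖ ≤ 1) (hvR : ∀ x, ‖x - x₀‖ ≤ R → v x = 0) :
    ‖Bil Φ A u v‖ ≤ c * ballVol n * decayConst n := by
  have hd : ∀ x, 0 ≤ decay x₀ 1 x := fun x => by
    rw [decay_eq x₀ one_pos]; positivity
  rw [Bil_eq_iterated hΦ hA hu hv, ← integral_decay x₀ one_pos, ← integral_const_mul]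
  refine norm_integral_le_of_norm_le ((integrable_decay' x₀ one_pos).const_mul _)
    (Eventually.of_forall fun x => ?_)
  by_cases hx : ‖x - x₀‖ ≤ R
  · simp only [hvR x hx, mul_zero, integral_zero, norm_zero]
    have := hd x
    have : 0 ≤ ballVol n := ENNReal.toReal_nonneg
    positivity
  · rw [not_le] at hx
    have h1 : ‖∫ y, (∫ ξ, osc Φ (x, y, ξ) * A (x, y, ξ)) * u y * v x‖ ≤
        ∫ y, c * decay x₀ 1 x * ‖u y‖ := by
      refine norm_integral_le_of_norm_le (hu.integrable.norm.const_mul _)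
        (Eventually.of_forall fun y => ?_)
      rw [norm_mul, norm_mul]
      have h3 : 0 ≤ c * decay x₀ 1 x := mul_nonneg hc (hd x)
      by_cases hy : u y = 0
      · simp [hy]
      · have h2 := hs.supp hy
        rw [mem_closedBall_iff_norm] at h2
        calc _ ≤ (c * decay x₀ 1 x) * ‖u y‖ * 1 := by
              gcongr
              exacts [hK x y hx h2, hv1 x]
          _ = _ := mul_one _
    rw [integral_const_mul] at h1
    refine h1.trans ?_
    have := hs.integral_norm_le
    calc c * decay x₀ 1 x * ∫ y, ‖u y‖ ≤ c * decay x₀ 1 x * ballVol n := by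
          have := hd x
          gcongr
      _ = _ := by ring

lemma volume_ball_ne_top (x₀ : E n) (R : ℝ) : volume (Metric.closedBall x₀ R) ≠ ⊤ :=
  measure_closedBall_lt_top.ne

/-- The near part of the image of an atom. -/
lemma exists_near_bound {μ : ℝ} (hμ : μ ≤ 0)
    (hA2 : ∀ a : E3 n → ℂ, IsSymbol 0 a → LpBounded 2 Φ a)
    (hA3 : ∀ a : E3 n → ℂ, IsSymbol μ a → UnifLocHardyBounded Φ a)
    {A : E3 n → ℂ} (hA : IsSymbol μ A) (R₀ R : ℝ) (hR : R₀ ≤ R) :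
    ∃ D : ℝ≥0, ∀ (u : E n → ℂ) (x₀ : E n) (r : ℝ), IsTest u → SizeCond x₀ r u → r ≤ R₀ →
      (1 ≤ r ∨ ∫ x, u x = 0) → ∃ f, Represents Φ A u f ∧
        ∫⁻ x in Metric.closedBall x₀ R, ‖f x‖ₑ ≤ D := by
  obtain ⟨C2, hC2⟩ := hA2 A (hA.mono hμ)
  obtain ⟨C3, hC3⟩ := hA3 A hA (Metric.closedBall 0 R) (isCompact_closedBall _ _)
  obtain ⟨CH, hCH⟩ := exists_hardyNorm_atom_le n
  set V : ℝ≥0∞ := volume (Metric.closedBall (0 : E n) R) with hV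
  have hVtop : V ≠ ⊤ := volume_ball_ne_top _ _
  have hD1 : (C2 : ℝ≥0∞) * V ^ (1 / 2 : ℝ) * V ^ (1 / 2 : ℝ) ≠ ⊤ := by
    have := ENNReal.rpow_ne_top_of_nonneg (by norm_num : (0 : ℝ) ≤ 1 / 2) hVtop
    exact ENNReal.mul_ne_top (ENNReal.mul_ne_top ENNReal.coe_ne_top this) this
  refine ⟨((C2 : ℝ≥0∞) * V ^ (1 / 2 : ℝ) * V ^ (1 / 2 : ℝ)).toNNReal + C3 * CH, ?_⟩
  intro u x₀ r hu hs hr hor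
  have hVx : volume (Metric.closedBall x₀ R) = V := by
    rw [hV, Measure.addHaar_closedBall_center]
  -- A large atom is bounded by 1 on a ball of bounded radius: its L² norm is bounded, and
  -- Cauchy–Schwarz passes from L² to L¹ on the ball. A small one has mean zero, and (A3) is used
  -- for a fixed ball translated by x₀.
  rcases hor with h1 | h0
  · obtain ⟨f, hf, hf2, hfle⟩ := hC2 u hu
    refine ⟨f, hf, ?_⟩
    have hu2 : eLpNorm u 2 volume ≤ V ^ (1 / 2 : ℝ) := by
      have hle : ∀ x, ‖u x‖ ≤ ‖(Metric.closedBall x₀ R).indicator (fun _ => (1 : ℝ)) x‖ := by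
        intro x
        by_cases hx : x ∈ Metric.closedBall x₀ R
        · rw [Set.indicator_of_mem hx, norm_one]
          refine (hs.le x).trans (inv_le_one_of_one_le₀ (one_le_pow₀ h1))
        · have : u x = 0 := by
            by_contra h
            exact hx (Metric.closedBall_subset_closedBall (hr.trans hR) (hs.supp h))
          rw [this, norm_zero]; exact norm_nonneg _
      refine (eLpNorm_mono hle).trans ?_
      refine (eLpNorm_indicator_const_le _ _).trans ?_
      rw [hVx]
      simp
    have h2 : ∫⁻ x in Metric.closedBall x₀ R, ‖f x‖ₑ ≤
        (C2 : ℝ≥0∞) * V ^ (1 / 2 : ℝ) * V ^ (1 / 2 : ℝ) := by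
      have h3 := eLpNorm_le_eLpNorm_mul_rpow_measure_univ (p := 1) (q := 2)
        (μ := volume.restrict (Metric.closedBall x₀ R)) (f := f) (by norm_num) hf2.1.restrict
      rw [eLpNorm_one_eq_lintegral_enorm, Measure.restrict_apply_univ, hVx] at h3
      refine h3.trans ?_
      have h4 : eLpNorm f 2 (volume.restrict (Metric.closedBall x₀ R)) ≤ C2 * V ^ (1 / 2 : ℝ) :=
        (eLpNorm_mono_measure f Measure.restrict_le_self).trans
          (hfle.trans (mul_le_mul_right hu2 _))
      have h5 : (1 / (1 : ℝ≥0∞).toReal - 1 / (2 : ℝ≥0∞).toReal) = (1 / 2 : ℝ) := by norm_num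
      rw [h5]
      exact mul_le_mul_left h4 _
    refine h2.trans ?_
    rw [ENNReal.coe_add, ENNReal.coe_toNNReal hD1]
    exact le_self_add
  · have himg : (fun x => x + x₀) '' Metric.closedBall (0 : E n) R = Metric.closedBall x₀ R := by
      ext x
      simp only [Set.mem_image, mem_closedBall_iff_norm, sub_zero]
      constructor
      · rintro ⟨y, hy, rfl⟩; simpa using hy
      · intro hx; exact ⟨x - x₀, hx, by abel⟩
    have hH := hCH x₀ r u hu hs h0
    have hsub : tsupport u ⊆ (fun x => x + x₀) '' Metric.closedBall (0 : E n) R := by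
      rw [himg]
      exact (closure_minimal hs.supp Metric.isClosed_closedBall).trans
        (Metric.closedBall_subset_closedBall (hr.trans hR))
    obtain ⟨f, hf, hfle⟩ := hC3 x₀ u hu ⟨hu.integrable, hH.trans_lt ENNReal.coe_lt_top⟩ hsub
    refine ⟨f, hf, ?_⟩
    rw [himg] at hfle
    refine hfle.trans ?_
    rw [ENNReal.coe_add, ENNReal.coe_mul]
    exact (mul_le_mul_right hH _).trans le_add_self

/-- An operator of order `μ` maps atoms to `L¹` with uniform bounds. -/
lemma exists_atom_bound (hΦ : ContDiff ℝ ∞ Φ) (hA1 : ∀ j, IsSymbol 0 (partialXi Φ j))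
    {μ : ℝ} (hμ : μ ≤ 0)
    (hA2 : ∀ a : E3 n → ℂ, IsSymbol 0 a → LpBounded 2 Φ a)
    (hA3 : ∀ a : E3 n → ℂ, IsSymbol μ a → UnifLocHardyBounded Φ a)
    {A : E3 n → ℂ} (hA : IsSymbol μ A) {R₀ : ℝ} (hR₀ : 0 ≤ R₀) :
    ∃ C : ℝ, ∀ (u v : E n → ℂ) (x₀ : E n) (r : ℝ), IsTest u → IsTest v → SizeCond x₀ r u →
      r ≤ R₀ → (1 ≤ r ∨ ∫ x, u x = 0) → (∀ x, ‖v x‖ ≤ 1) →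
      ∃ f, Represents Φ A u f ∧ ‖∫ x, f x * v x‖ ≤ C := by
  obtain ⟨ρ, hρ, hfar⟩ := far_kernel hΦ hA1
  obtain ⟨g, hg, hg0, hg1⟩ := exists_cutoff n
  obtain ⟨CK, hCK0, hCK⟩ := hfar μ A g hμ hA hg
  obtain ⟨CA, hCA0, hCA⟩ := hA.bdd hμ
  -- For |x - x₀| > 2R₀ + ρ and y in the atom, |x - y| exceeds ρ and is comparable to 1 + |x - x₀|.
  -- The bump η, equal to 1 up to radius R₁, splits v into a near part and a far part.
  set R₁ : ℝ := 2 * R₀ + ρ with hR₁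
  have hR₁pos : 0 < R₁ := by linarith
  obtain ⟨D, hD⟩ := exists_near_bound hμ hA2 hA3 hA R₀ (R₁ + 1) (by linarith)
  let η : ContDiffBump (0 : E n) := ⟨R₁, R₁ + 1, hR₁pos, by linarith⟩
  refine ⟨D + (CK * 4 ^ (n + 1)) * ballVol n * decayConst n, ?_⟩
  intro u v x₀ r hu hv hs hr hor hv1
  obtain ⟨f, hf, hfD⟩ := hD u x₀ r hu hs hr hor
  refine ⟨f, hf, ?_⟩
  have hη : ContDiff ℝ ∞ (fun x => (((η (x - x₀) : ℝ)) : ℂ)) :=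
    Complex.ofRealCLM.contDiff.comp (η.contDiff.comp (contDiff_id.sub contDiff_const))
  have hv1' : IsTest (fun x => ((η (x - x₀) : ℝ) : ℂ) * v x) := ⟨hη.mul hv.1, hv.2.mul_left⟩
  have hv2' : IsTest (fun x => (1 - ((η (x - x₀) : ℝ) : ℂ)) * v x) :=
    ⟨(contDiff_const.sub hη).mul hv.1, hv.2.mul_left⟩
  have hsplit : ∫ x, f x * v x = (∫ x, f x * (((η (x - x₀) : ℝ) : ℂ) * v x)) +
      ∫ x, f x * ((1 - ((η (x - x₀) : ℝ) : ℂ)) * v x) := by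
    rw [← integral_add (LocallyIntegrable.integrable_mul_test hf.1 hv1')
      (LocallyIntegrable.integrable_mul_test hf.1 hv2')]
    congr 1; funext x; ring
  have hnear : ‖∫ x, f x * (((η (x - x₀) : ℝ) : ℂ) * v x)‖ ≤ D := by
    have h1 : ‖∫ x, f x * (((η (x - x₀) : ℝ) : ℂ) * v x)‖ₑ ≤
        ∫⁻ x in Metric.closedBall x₀ (R₁ + 1), ‖f x‖ₑ := by
      refine (enorm_integral_le_lintegral_enorm _).trans ?_
      rw [← lintegral_indicator Metric.isClosed_closedBall.measurableSet]
      refine lintegral_mono fun x => ?_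
      by_cases hx : x ∈ Metric.closedBall x₀ (R₁ + 1)
      · rw [Set.indicator_of_mem hx, enorm_mul]
        have h2 : ‖((η (x - x₀) : ℝ) : ℂ) * v x‖ ≤ 1 := by
          rw [norm_mul, Complex.norm_real, Real.norm_eq_abs, abs_of_nonneg η.nonneg]
          exact mul_le_one₀ η.le_one (norm_nonneg _) (hv1 x)
        have h3 : ‖((η (x - x₀) : ℝ) : ℂ) * v x‖ₑ ≤ 1 := by
          rw [← ofReal_norm]
          exact (ENNReal.ofReal_le_ofReal h2).trans (by simp)
        calc _ ≤ ‖f x‖ₑ * 1 := mul_le_mul_right h3 _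
          _ = _ := mul_one _
      · have h2 : η (x - x₀) = 0 := by
          apply η.zero_of_le_dist
          rw [mem_closedBall_iff_norm, not_le] at hx
          simpa [η] using hx.le
        simp [h2]
    have h2 := h1.trans hfD
    rw [← ofReal_norm, ← ENNReal.ofReal_coe_nnreal] at h2
    exact (ENNReal.ofReal_le_ofReal_iff D.2).1 h2
  have hfarb : ‖∫ x, f x * ((1 - ((η (x - x₀) : ℝ) : ℂ)) * v x)‖ ≤
      (CK * 4 ^ (n + 1)) * ballVol n * decayConst n := by
    -- The far part is estimated before the limit, where 𝒫 has a kernel; the bounds of that kernel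
    -- do not depend on ε.
    refine le_of_tendsto ((hf.tendsto hΦ.continuous hμ hA hu hg hg0 hv2').norm) ?_
    filter_upwards [Ioc_mem_nhdsGT (zero_lt_one' ℝ)] with ε hε
    refine norm_Bil_far_le hΦ.continuous (R := R₁)
      (ampDom_cutoff hA.1.continuous hCA (hg.comp_smul (ne_of_gt hε.1))) hu hv2' hs
      (by positivity) (fun x y hx hy => ?_) (fun x => ?_) (fun x hx => ?_)
    · have h1 : ‖x - x₀‖ - R₀ ≤ ‖x - y‖ := by
        have := norm_sub_norm_le (x - x₀) (y - x₀)
        rw [show x - x₀ - (y - x₀) = x - y by abel] at this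
        linarith
      have h2 : (1 + ‖x - x₀‖) / 4 ≤ ‖x - y‖ := by linarith
      refine (hCK ε hε.1 hε.2 x y (by linarith)).trans ?_
      rw [decay_eq x₀ one_pos, one_mul, mul_assoc]
      refine mul_le_mul_of_nonneg_left ?_ hCK0
      have h3 : ‖x - y‖⁻¹ ≤ 4 * (1 + ‖x - x₀‖)⁻¹ := by
        have := inv_anti₀ (by positivity) h2
        rwa [inv_div, div_eq_mul_inv] at this
      calc _ ≤ (4 * (1 + ‖x - x₀‖)⁻¹) ^ (n + 1) := pow_le_pow_left₀ (by positivity) h3 _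
        _ = _ := by rw [mul_pow, inv_pow]
    · have h1 : ‖1 - ((η (x - x₀) : ℝ) : ℂ)‖ ≤ 1 := by
        have h2 := η.nonneg (x := x - x₀)
        have h3 := η.le_one (x := x - x₀)
        rw [show (1 - ((η (x - x₀) : ℝ) : ℂ)) = ((1 - η (x - x₀) : ℝ) : ℂ) by push_cast; ring,
          Complex.norm_real, Real.norm_eq_abs, abs_of_nonneg (by linarith)]
        linarith
      rw [norm_mul]
      exact mul_le_one₀ h1 (norm_nonneg _) (hv1 x)
    · have h2 : η (x - x₀) = 1 := by
        apply η.one_of_mem_closedBall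
        simpa [η] using hx
      simp [h2]
  rw [hsplit]
  exact (norm_add_le _ _).trans (add_le_add hnear hfarb)

end Atoms

/-! ### From test functions to bounded functions of bounded support. -/

section Mollification

variable {n : ℕ}

open scoped Convolution in
/-- Bounded functions supported in a ball are bounded limits of test functions with the same bound
and integral, supported in a slightly larger ball. -/
lemma exists_mollify {u : E n → ℂ} (hm : AEStronglyMeasurable u) {M : ℝ} (hM : ∀ x, ‖u x‖ ≤ M)
    {x₀ : E n} {r s : ℝ} (hs : 0 < s) (hr : Function.support u ⊆ Metric.closedBall x₀ r) :
    ∃ U : ℕ → E n → ℂ, (∀ k, IsTest (U k)) ∧ (∀ k x, ‖U k x‖ ≤ M) ∧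
      (∀ k, Function.support (U k) ⊆ Metric.closedBall x₀ (r + s)) ∧
      (∀ k, ∫ x, U k x = ∫ x, u x) ∧ ∀ᵐ x, Tendsto (fun k => U k x) atTop (𝓝 (u x)) := by
  have hui : Integrable u := by
    refine Integrable.mono' (integrable_ball_const x₀ r M) hm (Eventually.of_forall fun x => ?_)
    by_cases hx : x ∈ Metric.closedBall x₀ r
    · rw [Set.indicator_of_mem hx]; exact hM x
    · rw [Set.indicator_of_notMem hx]
      have : u x = 0 := by
        by_contra h; exact hx (hr h)
      simp [this]
  let φ : ℕ → ContDiffBump (0 : E n) := fun k =>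
    ⟨s / (2 * (k + 1)), s / (k + 1), by positivity, by
      apply div_lt_div_of_pos_left hs (by positivity)
      have : (0 : ℝ) ≤ k := Nat.cast_nonneg k
      linarith⟩
  have hφ : Tendsto (fun k => (φ k).rOut) atTop (𝓝 0) := by
    have := (tendsto_one_div_add_atTop_nhds_zero_nat (𝕜 := ℝ)).const_mul s
    simpa [φ, div_eq_mul_inv] using this
  have hsupp : ∀ k, Function.support ((φ k).normed volume ⋆[ContinuousLinearMap.lsmul ℝ ℝ, volume] u)
      ⊆ Metric.closedBall x₀ (r + s) := by
    intro k
    refine (support_convolution_subset (μ := volume) (ContinuousLinearMap.lsmul ℝ ℝ)).trans ?_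
    rw [(φ k).support_normed_eq]
    rintro _ ⟨a, ha, b, hb, rfl⟩
    have h1 := hr hb
    rw [mem_ball_zero_iff] at ha
    rw [mem_closedBall_iff_norm] at h1 ⊢
    have h2 : (φ k).rOut ≤ s := by
      apply div_le_self hs.le
      have : (0 : ℝ) ≤ k := Nat.cast_nonneg k
      linarith
    calc ‖a + b - x₀‖ = ‖a + (b - x₀)‖ := by congr 1; abel
      _ ≤ ‖a‖ + ‖b - x₀‖ := norm_add_le _ _
      _ ≤ _ := by linarith
  refine ⟨fun k => (φ k).normed volume ⋆[ContinuousLinearMap.lsmul ℝ ℝ, volume] u,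
    fun k => ⟨?_, ?_⟩, fun k x => ?_, hsupp, fun k => ?_, ?_⟩
  · exact (φ k).hasCompactSupport_normed.contDiff_convolution_left _ (φ k).contDiff_normed
      hui.locallyIntegrable
  · exact HasCompactSupport.intro (isCompact_closedBall x₀ (r + s)) fun x hx => by
      by_contra h; exact hx (hsupp k h)
  · beta_reduce
    rw [convolution_def]
    have h1 : ‖∫ t, (ContinuousLinearMap.lsmul ℝ ℝ) ((φ k).normed volume t) (u (x - t))‖ ≤
        ∫ t, (φ k).normed volume t * M := by
      refine norm_integral_le_of_norm_le ((φ k).integrable_normed.mul_const M)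
        (Eventually.of_forall fun t => ?_)
      rw [ContinuousLinearMap.lsmul_apply, norm_smul, Real.norm_eq_abs,
        abs_of_nonneg ((φ k).nonneg_normed t)]
      exact mul_le_mul_of_nonneg_left (hM _) ((φ k).nonneg_normed t)
    rwa [integral_mul_const, (φ k).integral_normed, one_mul] at h1
  · rw [integral_convolution (μ := volume) (ν := volume) _ (φ k).integrable_normed hui,
      (φ k).integral_normed]
    simp
  · refine ContDiffBump.ae_convolution_tendsto_right_of_locallyIntegrable (K := 2) hφ
      (Eventually.of_forall fun k => le_of_eq ?_) hui.locallyIntegrable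
    simp only [φ]
    field_simp

/-- Bounded measurable functions with bounded support. -/
structure BddSupp (u : E n → ℂ) : Prop where
  meas : AEStronglyMeasurable u
  bdd : ∃ M R : ℝ, (∀ x, ‖u x‖ ≤ M) ∧ Function.support u ⊆ Metric.closedBall (0 : E n) R

lemma norm_le_ball_indicator {u : E n → ℂ} {M R : ℝ} {x₀ : E n} (hM : ∀ x, ‖u x‖ ≤ M)
    (hR : Function.support u ⊆ Metric.closedBall x₀ R) (x : E n) :
    ‖u x‖ ≤ (Metric.closedBall x₀ R).indicator (fun _ => M) x := by
  by_cases hx : x ∈ Metric.closedBall x₀ R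
  · rw [Set.indicator_of_mem hx]; exact hM x
  · rw [Set.indicator_of_notMem hx]
    have : u x = 0 := by
      by_contra h; exact hx (hR h)
    simp [this]

lemma BddSupp.integrable {u : E n → ℂ} (hu : BddSupp u) : Integrable u := by
  obtain ⟨M, R, hM, hR⟩ := hu.bdd
  exact Integrable.mono' (integrable_ball_const 0 R M) hu.meas
    (Eventually.of_forall (norm_le_ball_indicator hM hR))

lemma IsTest.bddSupp {u : E n → ℂ} (hu : IsTest u) : BddSupp u := by
  obtain ⟨M, -, hM⟩ := hu.bounded
  obtain ⟨R, hR⟩ := hu.2.isCompact.isBounded.subset_closedBall 0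
  exact ⟨hu.1.continuous.aestronglyMeasurable, M, R, hM, (subset_tsupport u).trans hR⟩

/-- The `L^p` norm as a real number. -/
def nrm (p : ℝ) (u : E n → ℂ) : ℝ := (∫ x, ‖u x‖ ^ p) ^ (1 / p)

lemma nrm_nonneg (p : ℝ) (u : E n → ℂ) : 0 ≤ nrm p u :=
  Real.rpow_nonneg (integral_nonneg fun _ => Real.rpow_nonneg (norm_nonneg _) _) _

lemma BddSupp.memLp {u : E n → ℂ} (hu : BddSupp u) (p : ℝ≥0∞) : MemLp u p volume := by
  obtain ⟨M, R, hM, hR⟩ := hu.bdd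
  have h1 : MemLp ((Metric.closedBall (0 : E n) R).indicator (fun _ : E n => M)) p volume :=
    memLp_indicator_const p Metric.isClosed_closedBall.measurableSet M
      (Or.inr (volume_ball_ne_top 0 R))
  refine h1.of_le hu.meas (Eventually.of_forall fun x => ?_)
  exact (norm_le_ball_indicator hM hR x).trans (Real.le_norm_self _)

lemma MemLp.eLpNorm_eq_nrm {p : ℝ} (hp : 0 < p) {u : E n → ℂ}
    (hu : MemLp u (ENNReal.ofReal p) volume) :
    eLpNorm u (ENNReal.ofReal p) volume = ENNReal.ofReal (nrm p u) := by
  rw [hu.eLpNorm_eq_integral_rpow_norm (by simpa using hp) ENNReal.ofReal_ne_top,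
    ENNReal.toReal_ofReal hp.le, nrm, one_div]

lemma BddSupp.integrable_rpow {u : E n → ℂ} (hu : BddSupp u) {p : ℝ} (hp : 0 < p) :
    Integrable (fun x => ‖u x‖ ^ p) := by
  have := (hu.memLp (ENNReal.ofReal p)).integrable_norm_rpow (by simpa using hp)
    ENNReal.ofReal_ne_top
  rwa [ENNReal.toReal_ofReal hp.le] at this

lemma tendsto_nrm {p : ℝ} (hp : 0 < p) {U : ℕ → E n → ℂ} {u : E n → ℂ} {M R : ℝ} {x₀ : E n}
    (hm : ∀ k, AEStronglyMeasurable (U k)) (hM : ∀ k x, ‖U k x‖ ≤ M)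
    (hR : ∀ k, Function.support (U k) ⊆ Metric.closedBall x₀ R)
    (hl : ∀ᵐ x, Tendsto (fun k => U k x) atTop (𝓝 (u x))) :
    Tendsto (fun k => nrm p (U k)) atTop (𝓝 (nrm p u)) := by
  have hM0 : 0 ≤ M := (norm_nonneg _).trans (hM 0 0)
  have h1 : Tendsto (fun k => ∫ x, ‖U k x‖ ^ p) atTop (𝓝 (∫ x, ‖u x‖ ^ p)) := by
    refine tendsto_integral_of_dominated_convergence
      (fun x => (Metric.closedBall x₀ R).indicator (fun _ => M ^ p) x)
      (fun k => ?_) (integrable_ball_const x₀ R (M ^ p)) (fun k => Eventually.of_forall fun x => ?_) ?_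
    · exact ((Real.continuous_rpow_const hp.le).comp_aestronglyMeasurable (hm k).norm)
    · rw [Real.norm_eq_abs, abs_of_nonneg (Real.rpow_nonneg (norm_nonneg _) _)]
      by_cases hx : x ∈ Metric.closedBall x₀ R
      · rw [Set.indicator_of_mem hx]
        exact Real.rpow_le_rpow (norm_nonneg _) (hM k x) hp.le
      · rw [Set.indicator_of_notMem hx]
        have : U k x = 0 := by
          by_contra h; exact hx (hR k h)
        rw [this, norm_zero, Real.zero_rpow hp.ne']
    · filter_upwards [hl] with x hx
      exact ((Real.continuous_rpow_const hp.le).tendsto _).comp hx.norm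
  exact h1.rpow_const (Or.inr (by positivity))

lemma tendsto_Bil_bdd {Φ : E3 n → ℝ} (hΦ : Continuous Φ) {A : E3 n → ℂ} {G : E n → ℝ}
    (hA : AmpDom A G) {U V : ℕ → E n → ℂ} {u v : E n → ℂ} {M R M' R' : ℝ} {x₀ x₀' : E n}
    (hm : ∀ k, AEStronglyMeasurable (U k)) (hM : ∀ k x, ‖U k x‖ ≤ M)
    (hR : ∀ k, Function.support (U k) ⊆ Metric.closedBall x₀ R)
    (hl : ∀ᵐ x, Tendsto (fun k => U k x) atTop (𝓝 (u x)))
    (hm' : ∀ k, AEStronglyMeasurable (V k)) (hM' : ∀ k x, ‖V k x‖ ≤ M')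
    (hR' : ∀ k, Function.support (V k) ⊆ Metric.closedBall x₀' R')
    (hl' : ∀ᵐ x, Tendsto (fun k => V k x) atTop (𝓝 (v x))) :
    Tendsto (fun k => Bil Φ A (U k) (V k)) atTop (𝓝 (Bil Φ A u v)) :=
  tendsto_Bil hΦ (Eventually.of_forall fun _ => hA) hA.int (fun _ => tendsto_const_nhds)
    hm (integrable_ball_const x₀ R M)
    (fun k => Eventually.of_forall (norm_le_ball_indicator (hM k) (hR k))) hl
    hm' (integrable_ball_const x₀' R' M')
    (fun k => Eventually.of_forall (norm_le_ball_indicator (hM' k) (hR' k))) hl'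

/-- A bound for test functions in terms of `L^p` norms extends to bounded functions. -/
lemma Bil_le_of_test {Φ : E3 n → ℝ} (hΦ : Continuous Φ) {A : E3 n → ℂ} {G : E n → ℝ}
    (hA : AmpDom A G) {p q C : ℝ} (hp : 0 < p) (hq : 0 < q)
    (h : ∀ u v, IsTest u → IsTest v → ‖Bil Φ A u v‖ ≤ C * (nrm p u * nrm q v))
    {u v : E n → ℂ} (hu : BddSupp u) (hv : BddSupp v) :
    ‖Bil Φ A u v‖ ≤ C * (nrm p u * nrm q v) := by
  obtain ⟨M, R, hM, hR⟩ := hu.bdd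
  obtain ⟨M', R', hM', hR'⟩ := hv.bdd
  obtain ⟨U, hU1, hU2, hU3, -, hU4⟩ := exists_mollify hu.meas hM one_pos hR
  obtain ⟨V, hV1, hV2, hV3, -, hV4⟩ := exists_mollify hv.meas hM' one_pos hR'
  have hUm := fun k => (hU1 k).1.continuous.aestronglyMeasurable (μ := volume)
  have hVm := fun k => (hV1 k).1.continuous.aestronglyMeasurable (μ := volume)
  refine le_of_tendsto_of_tendsto'
    (tendsto_Bil_bdd hΦ hA hUm hU2 hU3 hU4 hVm hV2 hV3 hV4).norm
    (((tendsto_nrm hp hUm hU2 hU3 hU4).mul (tendsto_nrm hq hVm hV2 hV3 hV4)).const_mul C)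
    fun k => h _ _ (hU1 k) (hV1 k)

/-- The atomic bound extends from smooth atoms to bounded ones. -/
lemma Bil_atom_le_of_test {Φ : E3 n → ℝ} (hΦ : Continuous Φ) {A : E3 n → ℂ} {G : E n → ℝ}
    (hA : AmpDom A G) {R₀ C : ℝ}
    (h : ∀ (u v : E n → ℂ) (x₀ : E n) (r : ℝ), IsTest u → IsTest v → SizeCond x₀ r u →
      r ≤ R₀ → (1 ≤ r ∨ ∫ x, u x = 0) → (∀ x, ‖v x‖ ≤ 1) → ‖Bil Φ A u v‖ ≤ C)
    {u v : E n → ℂ} {x₀ : E n} {r : ℝ} (hm : AEStronglyMeasurable u) (hs : SizeCond x₀ r u)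
    (hr : 2 * r ≤ R₀) (hor : 1 ≤ 2 * r ∨ ∫ x, u x = 0) (hv : BddSupp v) (hv1 : ∀ x, ‖v x‖ ≤ 1) :
    ‖Bil Φ A u v‖ ≤ 2 ^ n * C := by
  obtain ⟨M', R', hM', hR'⟩ := hv.bdd
  obtain ⟨U, hU1, hU2, hU3, hU5, hU4⟩ := exists_mollify hm hs.le hs.pos hs.supp
  obtain ⟨V, hV1, hV2, hV3, -, hV4⟩ := exists_mollify hv.meas hv1 one_pos hR'
  have hUm := fun k => (hU1 k).1.continuous.aestronglyMeasurable (μ := volume)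
  have hVm := fun k => (hV1 k).1.continuous.aestronglyMeasurable (μ := volume)
  refine le_of_tendsto' (tendsto_Bil_bdd hΦ hA hUm hU2 hU3 hU4 hVm hV2 hV3 hV4).norm fun k => ?_
  have hpos := hs.pos
  -- Mollifying at scale r doubles the radius of the support while the bound r^{-n} stays. Division
  -- by 2^n restores the normalisation at radius 2r; this is the 2^n of the statement. The mean
  -- value is preserved.
  have h1 := h (fun x => ((2 : ℂ) ^ n)⁻¹ * U k x) (V k) x₀ (2 * r)
    ⟨contDiff_const.mul (hU1 k).1, (hU1 k).2.mul_left⟩ (hV1 k)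
    ⟨by linarith, fun x hx => by
      have : x ∈ Function.support (U k) := fun h0 => hx (by simp [h0])
      have := hU3 k this
      rwa [← two_mul] at this, fun x => by
      rw [norm_mul, norm_inv, norm_pow, mul_pow, mul_inv, Complex.norm_ofNat]
      exact mul_le_mul_of_nonneg_left (hU2 k x) (by positivity)⟩ hr
    (hor.imp id fun h0 => by rw [integral_const_mul, hU5 k, h0, mul_zero]) (hV2 k)
  rw [Bil_smul_left, norm_mul, norm_inv, norm_pow, Complex.norm_ofNat,
    inv_mul_le_iff₀ (by positivity)] at h1
  exact h1

end Mollification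

/-! ### Dyadic cubes of side at most 1 and averages over them. -/

section Dyadic

variable {n : ℕ}

/-- The index of the dyadic cube of side `2 ^ (-k)` containing `x`. -/
def cell (k : ℕ) (x : E n) : Fin n → ℤ := fun i => ⌊(2 : ℝ) ^ k * x i⌋

/-- The dyadic cube of side `2 ^ (-k)` with index `c`. -/
def cube (k : ℕ) (c : Fin n → ℤ) : Set (E n) := {x | cell k x = c}

@[simp] lemma mem_cube {k : ℕ} {c : Fin n → ℤ} {x : E n} : x ∈ cube k c ↔ cell k x = c := Iff.rfl

lemma measurable_cell (k : ℕ) : Measurable (cell k : E n → Fin n → ℤ) := by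
  refine measurable_pi_lambda _ fun i => ?_
  have : Measurable fun x : E n => x i := (EuclideanSpace.proj (𝕜 := ℝ) i).continuous.measurable
  exact Int.measurable_floor.comp (this.const_mul _)

lemma measurableSet_cell_preimage (k : ℕ) (T : Set (Fin n → ℤ)) :
    MeasurableSet (cell k ⁻¹' T : Set (E n)) := measurable_cell k (Set.to_countable T).measurableSet

lemma measurableSet_cube (k : ℕ) (c : Fin n → ℤ) : MeasurableSet (cube k c : Set (E n)) :=
  measurableSet_cell_preimage k {c}

lemma volume_cube (k : ℕ) (c : Fin n → ℤ) :
    volume (cube k c : Set (E n)) = ENNReal.ofReal ((((2 : ℝ) ^ k) ^ n)⁻¹) := by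
  have h1 : (cube k c : Set (E n)) = (MeasurableEquiv.toLp 2 (Fin n → ℝ)).symm ⁻¹'
      (Set.pi Set.univ fun i => Set.Ico ((c i : ℝ) / 2 ^ k) ((c i + 1 : ℝ) / 2 ^ k)) := by
    ext x
    simp only [mem_cube, cell, funext_iff, Int.floor_eq_iff, Set.mem_preimage, Set.mem_pi,
      Set.mem_univ, forall_true_left, Set.mem_Ico]
    refine forall_congr' fun i => ?_
    have h2 : (0 : ℝ) < 2 ^ k := by positivity
    rw [div_le_iff₀ h2, lt_div_iff₀ h2, mul_comm]
    rfl
  rw [h1, (EuclideanSpace.volume_preserving_symm_measurableEquiv_toLp (Fin n)).measure_preimage_equiv,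
    Real.volume_pi_Ico]
  have h3 : ∀ i, (c i + 1 : ℝ) / 2 ^ k - (c i : ℝ) / 2 ^ k = (2 ^ k)⁻¹ := fun i => by ring
  simp only [h3, Finset.prod_const, Finset.card_univ, Fintype.card_fin]
  rw [← ENNReal.ofReal_pow (by positivity), inv_pow]

lemma volume_cube_ne_top (k : ℕ) (c : Fin n → ℤ) : volume (cube k c : Set (E n)) ≠ ⊤ := by
  rw [volume_cube]; exact ENNReal.ofReal_ne_top

lemma volume_real_cube (k : ℕ) (c : Fin n → ℤ) :
    volume.real (cube k c : Set (E n)) = (((2 : ℝ) ^ k) ^ n)⁻¹ := by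
  rw [Measure.real, volume_cube, ENNReal.toReal_ofReal (by positivity)]

lemma cell_succ (k : ℕ) (x : E n) (i : Fin n) : cell k x i = cell (k + 1) x i / 2 := by
  simp only [cell]
  set c := ⌊(2 : ℝ) ^ (k + 1) * x i⌋ with hc
  obtain ⟨h1, h2⟩ := Int.floor_eq_iff.1 hc.symm
  rw [pow_succ] at h1 h2
  have h3 : 2 * (c / 2) ≤ c := by omega
  have h4 : c + 1 ≤ 2 * (c / 2) + 2 := by omega
  have h3' : (2 : ℝ) * ((c / 2 : ℤ) : ℝ) ≤ c := by exact_mod_cast h3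
  have h4' : (c : ℝ) + 1 ≤ 2 * ((c / 2 : ℤ) : ℝ) + 2 := by exact_mod_cast h4
  rw [Int.floor_eq_iff]
  constructor <;> linarith

lemma cell_eq_of_le {j k : ℕ} (h : j ≤ k) {x y : E n} (hxy : cell k x = cell k y) :
    cell j x = cell j y := by
  induction k, h using Nat.le_induction with
  | base => exact hxy
  | succ k _ ih =>
    refine ih (funext fun i => ?_)
    rw [cell_succ k x, cell_succ k y, hxy]

lemma norm_sub_le_of_cell_eq {k : ℕ} {x y : E n} (h : cell k x = cell k y) :
    ‖x - y‖ ≤ n * ((2 : ℝ) ^ k)⁻¹ := by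
  have h1 : ‖x - y‖ ≤ ∑ j, |(x - y) j| := by
    conv_lhs => rw [← sum_single (x - y)]
    refine (norm_sum_le _ _).trans (Finset.sum_le_sum fun j _ => ?_)
    simp [norm_smul]
  refine h1.trans ((Finset.sum_le_card_nsmul _ _ ((2 : ℝ) ^ k)⁻¹ fun j _ => ?_).trans (by simp))
  have h2 := congrFun h j
  simp only [cell] at h2
  have h3 := Int.abs_sub_lt_one_of_floor_eq_floor h2
  rw [← mul_sub, abs_mul, abs_of_pos (by positivity : (0 : ℝ) < 2 ^ k)] at h3
  have h4 : (x - y) j = x j - y j := rfl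
  rw [h4, ← one_div, le_div_iff₀ (by positivity), mul_comm]
  exact h3.le

lemma finite_cells (k : ℕ) (R : ℝ) : (cell k '' Metric.closedBall (0 : E n) R).Finite := by
  refine (Set.finite_Icc (fun _ => ⌊-(2 ^ k * R)⌋) (fun _ => ⌊2 ^ k * R⌋)).subset ?_
  rintro _ ⟨x, hx, rfl⟩
  rw [mem_closedBall_zero_iff] at hx
  have h1 : ∀ i, |x i| ≤ R := fun i => (PiLp.norm_apply_le x i).trans hx
  have h0 : (0 : ℝ) < 2 ^ k := by positivity
  refine ⟨fun i => Int.floor_le_floor ?_, fun i => Int.floor_le_floor ?_⟩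
  · have := (abs_le.1 (h1 i)).1; nlinarith
  · have := (abs_le.1 (h1 i)).2; nlinarith

variable {F : Type*} [NormedAddCommGroup F] [NormedSpace ℝ F]

/-- `g` is constant on dyadic cubes of side `2 ^ (-k)`. -/
def CellConst {α : Type*} (k : ℕ) (g : E n → α) : Prop := ∀ x y, cell k x = cell k y → g x = g y

lemma CellConst.measurable {α : Type*} [MeasurableSpace α] [Nonempty α] {k : ℕ} {g : E n → α}
    (hg : CellConst k g) : Measurable g := by
  have h1 : Function.FactorsThrough g (cell k) := fun x y h => hg x y h
  have h2 : g = Function.extend (cell k) g (fun _ => Classical.arbitrary α) ∘ cell k := by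
    funext x; exact (h1.extend_apply _ x).symm
  rw [h2]
  exact (measurable_of_countable _).comp (measurable_cell k)

lemma CellConst.eq_preimage {k : ℕ} {S : Set (E n)} (hS : CellConst k (· ∈ S)) :
    S = cell k ⁻¹' (cell k '' S) := by
  ext x
  refine ⟨fun hx => ⟨x, hx, rfl⟩, ?_⟩
  rintro ⟨y, hy, hxy⟩
  exact (hS y x hxy).mp hy

lemma CellConst.measurableSet {k : ℕ} {S : Set (E n)} (hS : CellConst k (· ∈ S)) :
    MeasurableSet S := by
  rw [hS.eq_preimage]; exact measurableSet_cell_preimage _ _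

/-- The average over the dyadic cube of side `2 ^ (-k)`. -/
def avg (k : ℕ) (f : E n → F) (x : E n) : F :=
  (((2 : ℝ) ^ k) ^ n) • ∫ y in cube k (cell k x), f y

lemma cellConst_avg (k : ℕ) (f : E n → F) : CellConst k (avg k f) := by
  intro x y h; simp only [avg, h]

lemma setIntegral_cube_avg [CompleteSpace F] (k : ℕ) (f : E n → F) (c : Fin n → ℤ) :
    ∫ y in cube k c, avg k f y = ∫ y in cube k c, f y := by
  have h1 : ∫ y in cube k c, avg k f y =
      ∫ _y in cube k c, (((2 : ℝ) ^ k) ^ n) • ∫ y in cube k c, f y := by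
    refine setIntegral_congr_fun (measurableSet_cube k c) fun x hx => ?_
    rw [mem_cube] at hx
    simp only [avg, hx]
  rw [h1, setIntegral_const, volume_real_cube, smul_smul, inv_mul_cancel₀ (by positivity), one_smul]

/-- A set that is a union of cubes of level k is a countable disjoint union of them, and averaging
preserves the integral on each one. -/
lemma setIntegral_avg [CompleteSpace F] {k : ℕ} {f : E n → F} (hf : Integrable f) (ha : Integrable (avg k f))
    {S : Set (E n)} (hS : CellConst k (· ∈ S)) : ∫ y in S, avg k f y = ∫ y in S, f y := by
  have h1 : S = ⋃ c : cell k '' S, cube k c.1 := by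
    ext x
    simp only [Set.mem_iUnion, mem_cube, Subtype.exists, exists_prop, exists_eq_right']
    exact Set.ext_iff.1 hS.eq_preimage x
  have hd : Pairwise (Function.onFun Disjoint fun c : cell k '' S => (cube k c.1 : Set (E n))) := by
    intro c c' hcc
    refine Set.disjoint_left.2 fun x hx hx' => hcc (Subtype.ext ?_)
    rw [mem_cube] at hx hx'
    exact hx.symm.trans hx'
  conv_lhs => rw [h1]
  conv_rhs => rw [h1]
  rw [integral_iUnion (s := fun c : cell k '' S => (cube k c.1 : Set (E n)))
      (fun c => measurableSet_cube k c.1) hd ha.integrableOn,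
    integral_iUnion (s := fun c : cell k '' S => (cube k c.1 : Set (E n)))
      (fun c => measurableSet_cube k c.1) hd hf.integrableOn]
  exact tsum_congr fun c => setIntegral_cube_avg k f c.1

lemma norm_avg_le (k : ℕ) (f : E n → F) (x : E n) : ‖avg k f x‖ ≤ avg k (fun y => ‖f y‖) x := by
  rw [avg, avg, norm_smul, Real.norm_eq_abs, abs_of_pos (by positivity), smul_eq_mul]
  exact mul_le_mul_of_nonneg_left (norm_integral_le_integral_norm _) (by positivity)

lemma avg_nonneg {k : ℕ} {f : E n → ℝ} (h : ∀ x, 0 ≤ f x) (x : E n) : 0 ≤ avg k f x :=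
  mul_nonneg (by positivity) (integral_nonneg h)

lemma avg_of_cellConst [CompleteSpace F] {k : ℕ} {f : E n → F} (hf : CellConst k f) (x : E n) : avg k f x = f x := by
  have h1 : ∫ y in cube k (cell k x), f y = ∫ _y in cube k (cell k x), f x :=
    setIntegral_congr_fun (measurableSet_cube k _) fun y hy => hf y x hy
  rw [avg, h1, setIntegral_const, volume_real_cube, smul_smul, mul_inv_cancel₀ (by positivity),
    one_smul]

/-- The parent cube has 2^n times the volume and contains the child. This is the doubling that
bounds averages on stopping cubes. -/
lemma avg_succ_le {k : ℕ} {f : E n → ℝ} (hf : Integrable f) (h : ∀ x, 0 ≤ f x) (x : E n) :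
    avg (k + 1) f x ≤ 2 ^ n * avg k f x := by
  have h1 : ∫ y in cube (k + 1) (cell (k + 1) x), f y ≤ ∫ y in cube k (cell k x), f y := by
    refine setIntegral_mono_set hf.integrableOn (Eventually.of_forall h) ?_
    exact Eventually.of_forall fun y hy => cell_eq_of_le (Nat.le_succ k) hy
  rw [avg, avg, smul_eq_mul, smul_eq_mul, ← mul_assoc, ← mul_pow, mul_comm (2 : ℝ), ← pow_succ]
  exact mul_le_mul_of_nonneg_left h1 (by positivity)

lemma avg_ne_zero {k : ℕ} {f : E n → F} {x : E n} (h : avg k f x ≠ 0) :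
    ∃ y, cell k y = cell k x ∧ f y ≠ 0 := by
  by_contra! h0
  apply h
  have : ∫ y in cube k (cell k x), f y = 0 :=
    setIntegral_eq_zero_of_forall_eq_zero fun y hy => h0 y hy
  rw [avg, this, smul_zero]

lemma avg_const_le (k : ℕ) {f : E n → ℝ} {M : ℝ} (hf : Integrable f) (h : ∀ x, f x ≤ M) (x : E n) :
    avg k f x ≤ M := by
  have h1 : ∫ y in cube k (cell k x), f y ≤ ∫ _y in cube k (cell k x), M := by
    refine setIntegral_mono hf.integrableOn ?_ h
    exact integrableOn_const (volume_cube_ne_top _ _)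
  rw [setIntegral_const, volume_real_cube, smul_eq_mul] at h1
  rw [avg, smul_eq_mul]
  have h2 : (0 : ℝ) < (2 ^ k) ^ n := by positivity
  calc _ ≤ ((2 : ℝ) ^ k) ^ n * ((((2 : ℝ) ^ k) ^ n)⁻¹ * M) := mul_le_mul_of_nonneg_left h1 h2.le
    _ = M := by rw [← mul_assoc, mul_inv_cancel₀ h2.ne', one_mul]

lemma support_avg_subset {k : ℕ} {f : E n → F} {R : ℝ}
    (hR : Function.support f ⊆ Metric.closedBall 0 R) :
    Function.support (avg k f) ⊆ Metric.closedBall 0 (R + n) := by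
  intro x hx
  obtain ⟨y, hy, hfy⟩ := avg_ne_zero hx
  have h1 := hR hfy
  rw [mem_closedBall_zero_iff] at h1 ⊢
  have h2 := norm_sub_le_of_cell_eq hy.symm
  have h3 : (n : ℝ) * ((2 : ℝ) ^ k)⁻¹ ≤ n :=
    mul_le_of_le_one_right (Nat.cast_nonneg n) (inv_le_one_of_one_le₀ (one_le_pow₀ (by norm_num)))
  calc ‖x‖ = ‖y + (x - y)‖ := by congr 1; abel
    _ ≤ ‖y‖ + ‖x - y‖ := norm_add_le _ _
    _ ≤ _ := by linarith

lemma BddSupp.avg {f : E n → ℂ} (hf : BddSupp f) (k : ℕ) : BddSupp (avg k f) := by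
  obtain ⟨M, R, hM, hR⟩ := hf.bdd
  exact ⟨(cellConst_avg k f).measurable.aestronglyMeasurable, M, R + n,
    fun x => (norm_avg_le k f x).trans (avg_const_le k hf.integrable.norm hM x),
    support_avg_subset hR⟩

end Dyadic

/-! ### Stopping cubes, good parts and layers. -/

section Stopping

variable {n : ℕ} {f : E n → ℂ} {D : ℕ} {lam : ℝ}

/-- The average of `|f|` over the dyadic cube of side `2 ^ (-k)`. -/
def avgN (f : E n → ℂ) (k : ℕ) : E n → ℝ := avg k fun y => ‖f y‖

/-- The points where the dyadic averages of `|f|` exceed `lam` for the first time at level `k`. -/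
def Sel (f : E n → ℂ) (lam : ℝ) (k : ℕ) : Set (E n) :=
  {x | lam < avgN f k x ∧ ∀ j < k, avgN f j x ≤ lam}

/-- The points where some dyadic average of `|f|` up to level `D` exceeds `lam`. -/
def Lev (f : E n → ℂ) (D : ℕ) (lam : ℝ) : Set (E n) := {x | ∃ k ≤ D, lam < avgN f k x}

/-- The good part of `f` at height `lam`. -/
def good (f : E n → ℂ) (D : ℕ) (lam : ℝ) (x : E n) : ℂ :=
  ∑ k ∈ Finset.Icc 1 D, (Sel f lam k).indicator (avg k f) x + (Lev f D lam)ᶜ.indicator f x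

/-- The difference of the good parts at heights `2 lam` and `lam`. -/
def layer (f : E n → ℂ) (D : ℕ) (lam : ℝ) (x : E n) : ℂ := good f D (2 * lam) x - good f D lam x

lemma cellConst_avgN (k : ℕ) : CellConst k (avgN f k) := cellConst_avg k _

lemma cellConst_Sel (k : ℕ) : CellConst k (· ∈ Sel f lam k) := by
  intro x y h
  simp only [Sel, Set.mem_ofPred_eq, eq_iff_iff]
  rw [cellConst_avgN k x y h]
  refine and_congr Iff.rfl (forall₂_congr fun j hj => ?_)
  rw [cellConst_avgN j x y (cell_eq_of_le hj.le h)]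

lemma measurableSet_Sel (k : ℕ) : MeasurableSet (Sel f lam k) := (cellConst_Sel k).measurableSet

lemma Sel_unique {x : E n} {j k : ℕ} (hj : x ∈ Sel f lam j) (hk : x ∈ Sel f lam k) : j = k := by
  rcases lt_trichotomy j k with h | h | h
  · exact absurd hj.1 (not_lt.2 (hk.2 j h))
  · exact h
  · exact absurd hk.1 (not_lt.2 (hj.2 k h))

lemma mem_Lev_iff {x : E n} : x ∈ Lev f D lam ↔ ∃ k ≤ D, x ∈ Sel f lam k := by
  classical
  constructor
  · rintro ⟨k, hk, h⟩
    have hex : ∃ k, lam < avgN f k x := ⟨k, h⟩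
    exact ⟨Nat.find hex, (Nat.find_min' hex h).trans hk, Nat.find_spec hex,
      fun j hj => not_lt.1 (Nat.find_min hex hj)⟩
  · rintro ⟨k, hk, h⟩; exact ⟨k, hk, h.1⟩

lemma Lev_eq_biUnion : Lev f D lam = ⋃ k ∈ Finset.range (D + 1), Sel f lam k := by
  ext x; simp [mem_Lev_iff]

lemma measurableSet_Lev : MeasurableSet (Lev f D lam) := by
  rw [Lev_eq_biUnion]
  exact Finset.measurableSet_biUnion _ fun k _ => measurableSet_Sel k

lemma Lev_anti {lam' : ℝ} (h : lam ≤ lam') : Lev f D lam' ⊆ Lev f D lam :=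
  fun _ ⟨k, hk, hx⟩ => ⟨k, hk, h.trans_lt hx⟩

lemma good_of_notMem {x : E n} (hx : x ∉ Lev f D lam) : good f D lam x = f x := by
  rw [good, Set.indicator_of_mem (by exact hx), Finset.sum_eq_zero, zero_add]
  intro k hk
  refine Set.indicator_of_notMem (fun h => hx (mem_Lev_iff.2 ⟨k, (Finset.mem_Icc.1 hk).2, h⟩)) _

lemma good_of_mem {x : E n} {k : ℕ} (hk : 1 ≤ k) (hkD : k ≤ D) (hx : x ∈ Sel f lam k) :
    good f D lam x = avg k f x := by
  have h1 : x ∈ Lev f D lam := mem_Lev_iff.2 ⟨k, hkD, hx⟩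
  rw [good, Set.indicator_of_notMem (by simpa using h1), add_zero,
    Finset.sum_eq_single_of_mem k (Finset.mem_Icc.2 ⟨hk, hkD⟩), Set.indicator_of_mem hx]
  exact fun j _ hj => Set.indicator_of_notMem (fun h => hj (Sel_unique h hx)) _

/-- Unit cubes have no parent controlling their average, so the sum in `good` starts at level 1 and
drops f on them. The price is the loss of cancellation on unit cubes, where atoms do not need it. -/
lemma good_of_mem_zero {x : E n} (hx : x ∈ Sel f lam 0) : good f D lam x = 0 := by
  have h1 : x ∈ Lev f D lam := mem_Lev_iff.2 ⟨0, Nat.zero_le _, hx⟩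
  rw [good, Set.indicator_of_notMem (by simpa using h1), add_zero, Finset.sum_eq_zero]
  intro j hj
  refine Set.indicator_of_notMem (fun h => ?_) _
  have := Sel_unique h hx
  have := (Finset.mem_Icc.1 hj).1
  omega

lemma avgN_eq_norm (hc : CellConst D f) (x : E n) : avgN f D x = ‖f x‖ :=
  avg_of_cellConst (fun x y h => by rw [hc x y h]) x

/-- On a stopping cube of level at least 1 the parent was not selected, so the average of |f| is at
most 2^n lam. Off the stopping cubes |f| is itself the average at level D, where f is constant on
cells. -/
lemma norm_good_le (hc : CellConst D f) (hf : Integrable f) (hl : 0 ≤ lam) (x : E n) :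
    ‖good f D lam x‖ ≤ 2 ^ n * lam := by
  have h2 : (1 : ℝ) ≤ 2 ^ n := one_le_pow₀ (by norm_num)
  by_cases hx : x ∈ Lev f D lam
  · obtain ⟨k, hkD, hk⟩ := mem_Lev_iff.1 hx
    rcases k with _ | k
    · rw [good_of_mem_zero hk, norm_zero]; positivity
    · rw [good_of_mem (Nat.succ_pos k) hkD hk]
      refine (norm_avg_le _ _ _).trans ((avg_succ_le hf.norm (fun _ => norm_nonneg _) x).trans ?_)
      exact mul_le_mul_of_nonneg_left (hk.2 k (Nat.lt_succ_self k)) (by positivity)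
  · rw [good_of_notMem hx, ← avgN_eq_norm hc]
    have h3 : avgN f D x ≤ lam := by
      by_contra h; exact hx ⟨D, le_rfl, not_le.1 h⟩
    nlinarith

lemma Lev_subset_ball (hl : 0 ≤ lam) {R : ℝ} (hR : Function.support f ⊆ Metric.closedBall 0 R) :
    Lev f D lam ⊆ Metric.closedBall 0 (R + n) := by
  rintro x ⟨k, -, hk⟩
  refine support_avg_subset (k := k) (f := fun y => ‖f y‖) ?_ (hl.trans_lt hk).ne'
  exact fun y hy => hR fun h => hy (by simp [h])

lemma BddSupp.good (hc : CellConst D f) (hf : BddSupp f) (hl : 0 ≤ lam) :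
    BddSupp (good f D lam) := by
  obtain ⟨M, R, hM, hR⟩ := hf.bdd
  refine ⟨?_, 2 ^ n * lam, R + n, norm_good_le hc hf.integrable hl, fun x hx => ?_⟩
  · unfold FourierInt.good
    refine AEStronglyMeasurable.add (Finset.aestronglyMeasurable_fun_sum _ fun k _ => ?_)
      (hf.meas.indicator measurableSet_Lev.compl)
    exact (cellConst_avg k f).measurable.aestronglyMeasurable.indicator (measurableSet_Sel k)
  · by_cases h : x ∈ Lev f D lam
    · exact Lev_subset_ball hl hR h
    · have hx' : x ∈ Function.support f := by
        intro h0; exact hx (by rw [good_of_notMem h, h0])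
      exact Metric.closedBall_subset_closedBall (by
        have : (0 : ℝ) ≤ n := Nat.cast_nonneg n
        linarith) (hR hx')

lemma BddSupp.sub {u v : E n → ℂ} (hu : BddSupp u) (hv : BddSupp v) :
    BddSupp (fun x => u x - v x) := by
  obtain ⟨M, R, hM, hR⟩ := hu.bdd
  obtain ⟨M', R', hM', hR'⟩ := hv.bdd
  refine ⟨hu.meas.sub hv.meas, M + M', max R R',
    fun x => (norm_sub_le _ _).trans (add_le_add (hM x) (hM' x)), fun x hx => ?_⟩
  by_cases h : u x = 0
  · have : v x ≠ 0 := fun h' => hx (by simp [h, h'])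
    exact Metric.closedBall_subset_closedBall (le_max_right _ _) (hR' this)
  · exact Metric.closedBall_subset_closedBall (le_max_left _ _) (hR h)

lemma BddSupp.layer (hc : CellConst D f) (hf : BddSupp f) (hl : 0 ≤ lam) :
    BddSupp (layer f D lam) :=
  (hf.good hc (by linarith)).sub (hf.good hc hl)

lemma norm_layer_le (hc : CellConst D f) (hf : BddSupp f) (hl : 0 ≤ lam) (x : E n) :
    ‖layer f D lam x‖ ≤ 3 * 2 ^ n * lam := by
  refine (norm_sub_le _ _).trans ?_
  have h1 := norm_good_le hc hf.integrable (by linarith : 0 ≤ 2 * lam) x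
  have h2 := norm_good_le hc hf.integrable hl x
  linarith

lemma layer_of_notMem (hl : 0 ≤ lam) {x : E n} (hx : x ∉ Lev f D lam) : layer f D lam x = 0 := by
  rw [layer, good_of_notMem hx, good_of_notMem (fun h => hx (Lev_anti (by linarith) h)), sub_self]

/-- Integrals of the good part over selected cubes. -/
lemma setIntegral_good (hf : BddSupp f) {lam' : ℝ} (h : lam ≤ lam') {k : ℕ} (hk : 1 ≤ k)
    {c : Fin n → ℤ} (hQ : cube k c ⊆ Sel f lam k) :
    ∫ x in cube k c, good f D lam' x = ∫ x in cube k c, f x := by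
  have hint : ∀ j, Integrable ((Sel f lam' j).indicator (avg j f)) := fun j =>
    (hf.avg j).integrable.indicator (measurableSet_Sel j)
  have hint' : Integrable ((Lev f D lam')ᶜ.indicator f) :=
    hf.integrable.indicator measurableSet_Lev.compl
  have hsplit : ∀ x, f x = ∑ j ∈ Finset.range (D + 1), (Sel f lam' j).indicator f x +
      (Lev f D lam')ᶜ.indicator f x := by
    intro x
    by_cases hx : x ∈ Lev f D lam'
    · obtain ⟨j, hj, hjx⟩ := mem_Lev_iff.1 hx
      rw [Set.indicator_of_notMem (by simpa using hx), add_zero,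
        Finset.sum_eq_single_of_mem j (Finset.mem_range.2 (by omega)), Set.indicator_of_mem hjx]
      exact fun i _ hi => Set.indicator_of_notMem (fun h => hi (Sel_unique h hjx)) _
    · rw [Set.indicator_of_mem (by simpa using hx), Finset.sum_eq_zero, zero_add]
      intro j hj
      exact Set.indicator_of_notMem (fun h => hx (mem_Lev_iff.2
        ⟨j, by simpa [Nat.lt_succ_iff] using hj, h⟩)) _
  -- No average at a level below k exceeds lam on this cube, so the stopping cubes of the larger
  -- height lam' that meet it have level at least k and are contained in it. In particular no
  -- dropped unit cube interferes.
  have hlow : ∀ j < k, ∀ x ∈ cube k c, x ∉ Sel f lam' j := fun j hj x hx hjx =>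
    absurd hjx.1 (not_lt.2 (((hQ hx).2 j hj).trans h))
  have heq : ∀ j, ∫ x in cube k c, (Sel f lam' j).indicator (avg j f) x =
      ∫ x in cube k c, (Sel f lam' j).indicator f x := by
    intro j
    rcases lt_or_ge j k with hj | hj
    · refine setIntegral_congr_fun (measurableSet_cube k c) fun x hx => ?_
      simp only [Set.indicator_of_notMem (hlow j hj x hx)]
    · rw [setIntegral_indicator (measurableSet_Sel j), setIntegral_indicator (measurableSet_Sel j)]
      refine setIntegral_avg hf.integrable (hf.avg j).integrable fun x y hxy => ?_
      have h1 := cellConst_Sel (f := f) (lam := lam') j x y hxy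
      simp only [Set.mem_inter_iff, mem_cube, cell_eq_of_le hj hxy]
      simp only at h1
      rw [h1]
  have hzero : ∫ x in cube k c, (Sel f lam' 0).indicator f x = 0 :=
    setIntegral_eq_zero_of_forall_eq_zero fun x hx =>
      Set.indicator_of_notMem (hlow 0 (by omega) x hx) _
  have hR : ∫ x in cube k c, f x = ∑ j ∈ Finset.range (D + 1),
      (∫ x in cube k c, (Sel f lam' j).indicator f x) +
      ∫ x in cube k c, (Lev f D lam')ᶜ.indicator f x := by
    have h1 : ∀ j, Integrable ((Sel f lam' j).indicator f) := fun j =>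
      hf.integrable.indicator (measurableSet_Sel j)
    rw [← integral_finsetSum _ fun j _ => (h1 j).integrableOn, ← integral_add
      (integrable_finsetSum _ fun j _ => (h1 j).integrableOn) hint'.integrableOn]
    congr 1; funext x; exact hsplit x
  simp only [good]
  rw [integral_add (integrable_finsetSum _ fun j _ => (hint j).integrableOn) hint'.integrableOn,
    integral_finsetSum _ fun j _ => (hint j).integrableOn, hR]
  congr 1
  rw [Finset.sum_congr rfl fun j _ => heq j, Finset.range_eq_Ico,
    Finset.sum_eq_sum_Ico_succ_bot (Nat.succ_pos D), hzero, zero_add]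
  rfl

/-- Both good parts have the same integral as f over a stopping cube of the lower height. This is
the cancellation that makes the restricted layer an atom. -/
lemma setIntegral_layer (hc : CellConst D f) (hf : BddSupp f) (hl : 0 ≤ lam) {k : ℕ} (hk : 1 ≤ k)
    {c : Fin n → ℤ} (hQ : cube k c ⊆ Sel f lam k) : ∫ x in cube k c, layer f D lam x = 0 := by
  simp only [layer]
  rw [integral_sub (hf.good hc (by linarith)).integrable.integrableOn
    (hf.good hc hl).integrable.integrableOn, setIntegral_good hf (by linarith) hk hQ,
    setIntegral_good hf le_rfl hk hQ, sub_self]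

lemma volume_Lev_lt_top (hf : BddSupp f) (hl : 0 ≤ lam) : volume (Lev f D lam) < ⊤ := by
  obtain ⟨M, R, hM, hR⟩ := hf.bdd
  exact (measure_mono (Lev_subset_ball hl hR)).trans_lt measure_closedBall_lt_top

lemma Sel_subset_Lev {k : ℕ} (hk : k ≤ D) : Sel f lam k ⊆ Lev f D lam :=
  fun _ hx => mem_Lev_iff.2 ⟨k, hk, hx⟩

lemma pairwiseDisjoint_Sel (s : Set ℕ) : s.PairwiseDisjoint (Sel f lam) :=
  fun _ _ _ _ hjk => Set.disjoint_left.2 fun _ h h' => hjk (Sel_unique h h')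

lemma volume_Lev_eq_sum (hf : BddSupp f) (hl : 0 ≤ lam) :
    volume.real (Lev f D lam) = ∑ k ∈ Finset.range (D + 1), volume.real (Sel f lam k) := by
  rw [Lev_eq_biUnion]
  refine measureReal_biUnion_finset (pairwiseDisjoint_Sel _) (fun k _ => measurableSet_Sel k)
    fun k hk => ?_
  refine ne_top_of_le_ne_top (volume_Lev_lt_top (D := D) hf hl).ne (measure_mono ?_)
  exact Sel_subset_Lev (by simpa [Nat.lt_succ_iff] using hk)

/-- The weak type inequality for the dyadic maximal function. -/
lemma volume_Lev_le (hf : BddSupp f) (hl : 0 < lam) :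
    lam * volume.real (Lev f D lam) ≤
      2 * ∫ x, {x | lam < 2 * ‖f x‖}.indicator (fun x => ‖f x‖) x := by
  obtain ⟨f', hf', hff'⟩ := hf.meas
  -- Cutting f off at lam/2 costs at most lam/2 in every average, so the average of the truncation
  -- still exceeds lam/2 on each stopping cube; these are disjoint and their contributions add up.
  set h : E n → ℝ := {x | lam < 2 * ‖f x‖}.indicator (fun x => ‖f x‖) with hh
  have hh0 : ∀ x, 0 ≤ h x := fun x => Set.indicator_nonneg (fun _ _ => norm_nonneg _) x
  have hhle : ∀ x, h x ≤ ‖f x‖ := fun x => Set.indicator_le_self' (fun _ _ => norm_nonneg _) x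
  have hhm : AEStronglyMeasurable h := by
    refine ⟨{x | lam < 2 * ‖f' x‖}.indicator (fun x => ‖f' x‖), ?_, ?_⟩
    · exact (hf'.norm.indicator (measurableSet_lt measurable_const
        (hf'.norm.measurable.const_mul 2)))
    · filter_upwards [hff'] with x hx
      simp only [hh, Set.indicator, Set.mem_ofPred_eq, hx]
  have hhi : Integrable h := hf.integrable.norm.mono' hhm
    (Eventually.of_forall fun x => by rw [Real.norm_eq_abs, abs_of_nonneg (hh0 x)]; exact hhle x)
  have hle : ∀ x, ‖f x‖ - lam / 2 ≤ h x := by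
    intro x
    by_cases hx : lam < 2 * ‖f x‖
    · rw [hh, Set.indicator_of_mem (by exact hx)]; linarith
    · have := hh0 x
      rw [not_lt] at hx
      linarith
  have havg : ∀ k x, avgN f k x ≤ avg k h x + lam / 2 := by
    intro k x
    have h1 : ∫ y in cube k (cell k x), (‖f y‖ - lam / 2) ≤ ∫ y in cube k (cell k x), h y :=
      setIntegral_mono (hf.integrable.norm.integrableOn.sub
        (integrableOn_const (volume_cube_ne_top _ _))) hhi.integrableOn hle
    rw [integral_sub hf.integrable.norm.integrableOn (integrableOn_const (volume_cube_ne_top _ _)),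
      setIntegral_const, volume_real_cube, smul_eq_mul] at h1
    have h2 : (0 : ℝ) < (2 ^ k) ^ n := by positivity
    have h3 := mul_le_mul_of_nonneg_left h1 h2.le
    rw [mul_sub, ← mul_assoc, mul_inv_cancel₀ h2.ne', one_mul] at h3
    simp only [avgN, avg, smul_eq_mul]
    linarith
  obtain ⟨M, R, hM, hR⟩ := hf.bdd
  have hai : ∀ k, Integrable (avg k h) := by
    intro k
    have hsupp : Function.support h ⊆ Metric.closedBall 0 R := fun x hx => hR fun h0 => hx (by
      have := hhle x
      rw [h0, norm_zero] at this
      exact le_antisymm this (hh0 x))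
    refine Integrable.mono' (integrable_ball_const 0 (R + n) M)
      (cellConst_avg k h).measurable.aestronglyMeasurable (Eventually.of_forall fun x => ?_)
    rw [Real.norm_eq_abs, abs_of_nonneg (avg_nonneg hh0 x)]
    by_cases hx : x ∈ Metric.closedBall (0 : E n) (R + n)
    · rw [Set.indicator_of_mem hx]
      exact avg_const_le k hhi (fun x => (hhle x).trans (hM x)) x
    · rw [Set.indicator_of_notMem hx]
      by_contra h0
      exact hx (support_avg_subset (k := k) hsupp (fun h1 => h0 (by rw [h1])))
  have hSel : ∀ k ∈ Finset.range (D + 1), lam / 2 * volume.real (Sel f lam k) ≤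
      ∫ x in Sel f lam k, h x := by
    intro k hk
    have hfin : volume (Sel f lam k) ≠ ⊤ := ne_top_of_le_ne_top
      (volume_Lev_lt_top (D := D) hf hl.le).ne (measure_mono (Sel_subset_Lev
        (by simpa [Nat.lt_succ_iff] using hk)))
    rw [← setIntegral_avg hhi (hai k) (cellConst_Sel k), mul_comm, ← smul_eq_mul,
      ← setIntegral_const]
    refine setIntegral_mono_on (integrableOn_const hfin) (hai k).integrableOn
      (measurableSet_Sel k) fun x hx => ?_
    have := havg k x
    have := hx.1
    linarith
  have h1 : ∑ k ∈ Finset.range (D + 1), ∫ x in Sel f lam k, h x ≤ ∫ x, h x := by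
    rw [← integral_biUnion_finset _ (fun k _ => measurableSet_Sel k)
      (pairwiseDisjoint_Sel _) (fun k _ => hhi.integrableOn)]
    exact setIntegral_le_integral hhi (Eventually.of_forall hh0)
  have h2 := (Finset.sum_le_sum hSel).trans h1
  rw [← Finset.mul_sum, ← volume_Lev_eq_sum hf hl.le] at h2
  linarith

end Stopping

/-! ### Layers at dyadic heights: summation, the L² bound and the atomic bound. -/

section Layers

variable {n : ℕ} {f : E n → ℂ} {D : ℕ} {lam μ : ℝ}

lemma avgN_le_zero (hf : Integrable f) (x : E n) (h : avgN f 0 x ≤ 0) (k : ℕ) : avgN f k x ≤ 0 := by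
  induction k with
  | zero => exact h
  | succ k ih =>
    refine (avg_succ_le hf.norm (fun _ => norm_nonneg _) x).trans ?_
    exact mul_nonpos_of_nonneg_of_nonpos (by positivity) ih

/-- Decomposition of a dyadic step function into layers at dyadic heights. -/
lemma exists_sum_layer (hc : CellConst D f) (hf : BddSupp f) :
    ∃ (μ : ℝ) (N : ℕ), 0 < μ ∧ ∀ x, f x = ∑ j ∈ Finset.range N, layer f D (μ * 2 ^ j) x := by
  obtain ⟨M, R, hM, hR⟩ := hf.bdd
  have hfin : (Set.range (avgN f 0)).Finite := by
    have h1 := (finite_cells (n := n) 0 (R + n)).image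
      (fun c => ((2 : ℝ) ^ 0) ^ n * ∫ y in cube 0 c, ‖f y‖)
    refine (h1.union (Set.finite_singleton 0)).subset ?_
    rintro _ ⟨x, rfl⟩
    by_cases hx : avgN f 0 x = 0
    · exact Or.inr hx
    · refine Or.inl ⟨cell 0 x, ⟨x, ?_, rfl⟩, rfl⟩
      refine support_avg_subset (k := 0) (f := fun y => ‖f y‖) ?_ hx
      exact fun y hy => hR fun h => hy (by simp [h])
  obtain ⟨μ, hμ0, hμ⟩ : ∃ μ : ℝ, 0 < μ ∧ ∀ t ∈ Set.range (avgN f 0), 0 < t → μ < t := by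
    have h1 : ∀ᶠ μ : ℝ in 𝓝[>] 0, ∀ t ∈ Set.range (avgN f 0), 0 < t → μ < t := by
      refine (Filter.eventually_all_finite hfin).2 fun t _ => ?_
      by_cases ht : 0 < t
      · filter_upwards [Ioo_mem_nhdsGT ht] with μ hμ _ using hμ.2
      · exact Eventually.of_forall fun _ h => absurd h ht
    obtain ⟨μ, h2, h3⟩ := (h1.and self_mem_nhdsWithin).exists
    exact ⟨μ, h3, h2⟩
  obtain ⟨N, hN⟩ := pow_unbounded_of_one_lt (M / μ) (one_lt_two : (1 : ℝ) < 2)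
  refine ⟨μ, N, hμ0, fun x => ?_⟩
  -- The layers telescope. The top height exceeds sup |f|, so nothing is stopped and the good part
  -- there is f.
  have htel : ∑ j ∈ Finset.range N, layer f D (μ * 2 ^ j) x =
      good f D (μ * 2 ^ N) x - good f D (μ * 2 ^ 0) x := by
    rw [← Finset.sum_range_sub (fun j => good f D (μ * 2 ^ j) x)]
    refine Finset.sum_congr rfl fun j _ => ?_
    rw [layer, pow_succ]; congr 2; ring
  have htop : good f D (μ * 2 ^ N) x = f x := by
    refine good_of_notMem ?_
    rintro ⟨k, -, hk⟩
    have h1 : avgN f k x ≤ M := avg_const_le k hf.integrable.norm hM x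
    rw [div_lt_iff₀ hμ0] at hN
    linarith
  have hbot : good f D (μ * 2 ^ 0) x = 0 := by
    rw [pow_zero, mul_one]
    by_cases hx : 0 < avgN f 0 x
    · exact good_of_mem_zero ⟨hμ _ ⟨x, rfl⟩ hx, fun j hj => absurd hj (Nat.not_lt_zero j)⟩
    · have h1 := avgN_le_zero hf.integrable x (not_lt.1 hx)
      rw [good_of_notMem]
      · have := h1 D
        rw [avgN_eq_norm hc] at this
        exact norm_le_zero_iff.1 this
      · rintro ⟨k, -, hk⟩
        have := h1 k
        linarith
  rw [htel, htop, hbot, sub_zero]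

/-- The constant of the geometric sums with exponent `s`. -/
def geomConst (s : ℝ) : ℝ := 2 ^ s / (2 ^ s - 1)

lemma one_lt_two_rpow {s : ℝ} (hs : 0 < s) : (1 : ℝ) < 2 ^ s :=
  Real.one_lt_rpow (by norm_num) hs

lemma geomConst_pos {s : ℝ} (hs : 0 < s) : 0 < geomConst s :=
  div_pos (by positivity) (sub_pos.2 (one_lt_two_rpow hs))

/-- A sum of powers of dyadic heights is dominated by its largest term. -/
lemma sum_rpow_le {s : ℝ} (hs : 0 < s) (hμ : 0 < μ) {S : Finset ℕ} (hS : S.Nonempty) :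
    ∃ L ∈ S, ∑ j ∈ S, (μ * 2 ^ j) ^ s ≤ geomConst s * (μ * 2 ^ L) ^ s := by
  refine ⟨S.max' hS, S.max'_mem hS, ?_⟩
  set L := S.max' hS
  have h1 := one_lt_two_rpow hs
  have h2 : ∀ j : ℕ, (μ * 2 ^ j) ^ s = μ ^ s * (2 ^ s) ^ j := by
    intro j
    rw [Real.mul_rpow hμ.le (by positivity), ← Real.rpow_natCast, ← Real.rpow_natCast,
      ← Real.rpow_mul (by norm_num), ← Real.rpow_mul (by norm_num), mul_comm (j : ℝ)]
  have h3 : S ⊆ Finset.range (L + 1) := fun j hj =>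
    Finset.mem_range.2 (Nat.lt_succ_of_le (S.le_max' j hj))
  calc ∑ j ∈ S, (μ * 2 ^ j) ^ s ≤ ∑ j ∈ Finset.range (L + 1), (μ * 2 ^ j) ^ s :=
        Finset.sum_le_sum_of_subset_of_nonneg h3 fun j _ _ => by positivity
    _ = μ ^ s * ∑ j ∈ Finset.range (L + 1), ((2 : ℝ) ^ s) ^ j := by
        rw [Finset.mul_sum]; exact Finset.sum_congr rfl fun j _ => h2 j
    _ ≤ μ ^ s * (((2 : ℝ) ^ s) ^ (L + 1) / (2 ^ s - 1)) := by
        rw [geom_sum_eq h1.ne']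
        have : 0 < (2 : ℝ) ^ s - 1 := by linarith
        gcongr
        linarith
    _ = geomConst s * (μ * 2 ^ L) ^ s := by
        rw [h2, geomConst, pow_succ]; ring

/-- The sum of the measures of the level sets, weighted by the `p`-th powers of the heights. -/
def levelSum (f : E n → ℂ) (D : ℕ) (μ : ℝ) (N : ℕ) (p : ℝ) : ℝ :=
  ∑ j ∈ Finset.range N, (μ * 2 ^ j) ^ p * volume.real (Lev f D (μ * 2 ^ j))

lemma levelSum_nonneg (hμ : 0 < μ) (N : ℕ) (p : ℝ) : 0 ≤ levelSum f D μ N p :=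
  Finset.sum_nonneg fun j _ => by positivity

/-- Insert the weak type inequality and exchange sum and integral. At each point the heights below
2|f| form a geometric sum with exponent p - 1, dominated by (2|f|)^{p-1}; positivity of p - 1 is
essential here. -/
lemma levelSum_le (hf : BddSupp f) (hμ : 0 < μ) (N : ℕ) {p : ℝ} (hp : 1 < p) :
    levelSum f D μ N p ≤ 2 ^ p * geomConst (p - 1) * ∫ x, ‖f x‖ ^ p := by
  have hp1 : 0 < p - 1 := by linarith
  have hm : ∀ t : ℝ, AEStronglyMeasurable ({x | t < 2 * ‖f x‖}.indicator fun x => ‖f x‖) := by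
    intro t
    obtain ⟨f', hf', hff'⟩ := hf.meas
    refine ⟨{x | t < 2 * ‖f' x‖}.indicator (fun x => ‖f' x‖), ?_, ?_⟩
    · exact (hf'.norm.indicator (measurableSet_lt measurable_const
        (hf'.norm.measurable.const_mul 2)))
    · filter_upwards [hff'] with x hx
      simp only [Set.indicator, Set.mem_ofPred_eq, hx]
  have hi : ∀ t : ℝ, Integrable ({x | t < 2 * ‖f x‖}.indicator fun x => ‖f x‖) := by
    intro t
    refine hf.integrable.norm.mono' (hm t) (Eventually.of_forall fun x => ?_)
    rw [Real.norm_eq_abs, abs_of_nonneg (Set.indicator_nonneg (fun _ _ => norm_nonneg _) x)]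
    exact Set.indicator_le_self' (fun _ _ => norm_nonneg _) x
  have h1 : levelSum f D μ N p ≤ ∫ x, ∑ j ∈ Finset.range N, 2 * ((μ * 2 ^ j) ^ (p - 1) *
      {x | μ * 2 ^ j < 2 * ‖f x‖}.indicator (fun x => ‖f x‖) x) := by
    rw [integral_finsetSum _ fun j _ => ((hi _).const_mul _).const_mul _]
    refine Finset.sum_le_sum fun j _ => ?_
    rw [integral_const_mul, integral_const_mul]
    have h0 : 0 < μ * 2 ^ j := by positivity
    have h2 := mul_le_mul_of_nonneg_left (volume_Lev_le (D := D) hf h0)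
      (Real.rpow_nonneg h0.le (p - 1))
    have h3 : (μ * 2 ^ j) ^ p = (μ * 2 ^ j) ^ (p - 1) * (μ * 2 ^ j) := by
      rw [← Real.rpow_add_one h0.ne', sub_add_cancel]
    rw [h3]; linarith
  refine h1.trans ?_
  rw [← integral_const_mul]
  refine integral_mono (integrable_finsetSum _ fun j _ => ((hi _).const_mul _).const_mul _)
    ((hf.integrable_rpow (by linarith)).const_mul _) fun x => ?_
  simp only
  set S := (Finset.range N).filter fun j => μ * 2 ^ j < 2 * ‖f x‖ with hS
  have h2 : ∑ j ∈ Finset.range N, 2 * ((μ * 2 ^ j) ^ (p - 1) *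
      {x | μ * 2 ^ j < 2 * ‖f x‖}.indicator (fun x => ‖f x‖) x) =
      2 * ‖f x‖ * ∑ j ∈ S, (μ * 2 ^ j) ^ (p - 1) := by
    rw [hS, Finset.sum_filter, Finset.mul_sum]
    refine Finset.sum_congr rfl fun j _ => ?_
    by_cases hj : μ * 2 ^ j < 2 * ‖f x‖
    · rw [Set.indicator_of_mem (by exact hj), if_pos hj]; ring
    · rw [Set.indicator_of_notMem (by exact hj), if_neg hj]; ring
  rw [h2]
  have hg := geomConst_pos hp1
  rcases S.eq_empty_or_nonempty with h | h
  · rw [h, Finset.sum_empty, mul_zero]; positivity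
  · obtain ⟨L, hL, hle⟩ := sum_rpow_le hp1 hμ h
    have hL' : μ * 2 ^ L < 2 * ‖f x‖ := (Finset.mem_filter.1 hL).2
    have hf0 : 0 < 2 * ‖f x‖ := lt_trans (by positivity) hL'
    calc 2 * ‖f x‖ * ∑ j ∈ S, (μ * 2 ^ j) ^ (p - 1)
        ≤ 2 * ‖f x‖ * (geomConst (p - 1) * (2 * ‖f x‖) ^ (p - 1)) := by
          refine mul_le_mul_of_nonneg_left (hle.trans ?_) hf0.le
          gcongr
      _ = geomConst (p - 1) * ((2 * ‖f x‖) ^ (p - 1) * (2 * ‖f x‖)) := by ring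
      _ = 2 ^ p * geomConst (p - 1) * ‖f x‖ ^ p := by
          rw [← Real.rpow_add_one hf0.ne', sub_add_cancel,
            Real.mul_rpow (by norm_num) (norm_nonneg _)]; ring

lemma BddSupp.zero : BddSupp (fun _ : E n => (0 : ℂ)) :=
  ⟨aestronglyMeasurable_const, 0, 0, by simp, by simp⟩

lemma BddSupp.add {u v : E n → ℂ} (hu : BddSupp u) (hv : BddSupp v) :
    BddSupp (fun x => u x + v x) := by
  have := hu.sub (BddSupp.zero.sub hv)
  simpa using this

lemma BddSupp.const_mul {u : E n → ℂ} (hu : BddSupp u) (c : ℂ) : BddSupp (fun x => c * u x) := by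
  obtain ⟨M, R, hM, hR⟩ := hu.bdd
  refine ⟨hu.meas.const_mul c, ‖c‖ * M, R, fun x => ?_, fun x hx => hR fun h => hx (by simp [h])⟩
  rw [norm_mul]; exact mul_le_mul_of_nonneg_left (hM x) (norm_nonneg c)

lemma BddSupp.sum {ι : Type*} (s : Finset ι) {u : ι → E n → ℂ} (hu : ∀ i ∈ s, BddSupp (u i)) :
    BddSupp (fun x => ∑ i ∈ s, u i x) := by
  classical
  induction s using Finset.induction_on with
  | empty => simpa using BddSupp.zero
  | insert i s hi ih =>
    simp only [Finset.sum_insert hi]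
    exact (hu i (Finset.mem_insert_self i s)).add
      (ih fun j hj => hu j (Finset.mem_insert_of_mem hj))

/-- The `L²` bound for a combination of layers. -/
lemma integral_sum_layer_sq_le (hc : CellConst D f) (hf : BddSupp f) (hμ : 0 < μ) (N : ℕ) {p : ℝ}
    (hp : 0 < p) {c : ℕ → ℂ} (hcn : ∀ j, ‖c j‖ ≤ (μ * 2 ^ j) ^ (p / 2 - 1)) :
    ∫ x, ‖∑ j ∈ Finset.range N, c j * layer f D (μ * 2 ^ j) x‖ ^ (2 : ℝ) ≤
      (3 * 2 ^ n * geomConst (p / 2)) ^ 2 * levelSum f D μ N p := by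
  have hlam : ∀ j : ℕ, 0 < μ * 2 ^ j := fun j => by positivity
  have hi : ∀ j : ℕ, Integrable ((Lev f D (μ * 2 ^ j)).indicator fun _ => (μ * 2 ^ j) ^ p) :=
    fun j => (integrable_indicator_iff measurableSet_Lev).2
      (integrableOn_const (volume_Lev_lt_top hf (hlam j).le).ne)
  have h1 : levelSum f D μ N p = ∫ x, ∑ j ∈ Finset.range N,
      (Lev f D (μ * 2 ^ j)).indicator (fun _ => (μ * 2 ^ j) ^ p) x := by
    rw [integral_finsetSum _ fun j _ => hi j]
    refine Finset.sum_congr rfl fun j _ => ?_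
    rw [integral_indicator measurableSet_Lev, setIntegral_const, smul_eq_mul, mul_comm]
  rw [h1, ← integral_const_mul]
  refine integral_mono ((BddSupp.sum _ fun j _ => (hf.layer hc (hlam j).le).const_mul
    (c j)).integrable_rpow two_pos) ((integrable_finsetSum _ fun j _ => hi j).const_mul _)
    fun x => ?_
  classical
  simp only
  set S := (Finset.range N).filter fun j => x ∈ Lev f D (μ * 2 ^ j) with hS
  have hg := geomConst_pos (half_pos hp)
  have h2 : ‖∑ j ∈ Finset.range N, c j * layer f D (μ * 2 ^ j) x‖ ≤
      3 * 2 ^ n * ∑ j ∈ S, (μ * 2 ^ j) ^ (p / 2) := by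
    rw [hS, Finset.sum_filter, Finset.mul_sum]
    refine norm_sum_le_of_le _ fun j _ => ?_
    by_cases hj : x ∈ Lev f D (μ * 2 ^ j)
    · rw [if_pos hj, norm_mul]
      calc ‖c j‖ * ‖layer f D (μ * 2 ^ j) x‖
          ≤ (μ * 2 ^ j) ^ (p / 2 - 1) * (3 * 2 ^ n * (μ * 2 ^ j)) :=
            mul_le_mul (hcn j) (norm_layer_le hc hf (hlam j).le x) (norm_nonneg _)
              (Real.rpow_nonneg (hlam j).le _)
        _ = 3 * 2 ^ n * (μ * 2 ^ j) ^ (p / 2) := by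
            rw [Real.rpow_sub_one (hlam j).ne']; field_simp
    · rw [if_neg hj, layer_of_notMem (hlam j).le hj]; simp
  rw [Real.rpow_two]
  rcases S.eq_empty_or_nonempty with h | h
  · rw [h, Finset.sum_empty, mul_zero] at h2
    rw [le_antisymm h2 (norm_nonneg _), zero_pow two_ne_zero]
    have : ∀ j ∈ Finset.range N,
        0 ≤ (Lev f D (μ * 2 ^ j)).indicator (fun _ => (μ * 2 ^ j) ^ p) x := fun j _ =>
      Set.indicator_nonneg (fun _ _ => Real.rpow_nonneg (hlam j).le p) x
    have := Finset.sum_nonneg this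
    positivity
  -- No orthogonality of the layers is needed. At a fixed point the terms grow geometrically in the
  -- height, so the square of the sum is comparable to the p-th power of the largest height present,
  -- a single summand of the right side.
  · obtain ⟨L, hL, hle⟩ := sum_rpow_le (half_pos hp) hμ h
    have h3 : ‖∑ j ∈ Finset.range N, c j * layer f D (μ * 2 ^ j) x‖ ≤
        3 * 2 ^ n * geomConst (p / 2) * (μ * 2 ^ L) ^ (p / 2) := by
      refine h2.trans ?_
      rw [mul_assoc _ (geomConst _)]
      exact mul_le_mul_of_nonneg_left hle (by positivity)
    refine (pow_le_pow_left₀ (norm_nonneg _) h3 2).trans ?_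
    rw [mul_pow _ ((μ * 2 ^ L) ^ (p / 2)), ← Real.rpow_natCast ((μ * 2 ^ L) ^ (p / 2)),
      ← Real.rpow_mul (hlam L).le]
    refine mul_le_mul_of_nonneg_left ?_ (by positivity)
    have h4 : (Lev f D (μ * 2 ^ L)).indicator (fun _ => (μ * 2 ^ L) ^ p) x = (μ * 2 ^ L) ^ p :=
      Set.indicator_of_mem (Finset.mem_filter.1 hL).2 _
    have h5 : p / 2 * ((2 : ℕ) : ℝ) = p := by push_cast; ring
    rw [h5, ← h4]
    exact Finset.single_le_sum (f := fun j =>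
      (Lev f D (μ * 2 ^ j)).indicator (fun _ => (μ * 2 ^ j) ^ p) x)
      (fun j _ => Set.indicator_nonneg (fun _ _ => Real.rpow_nonneg (hlam j).le p) x)
      (Finset.mem_filter.1 hL).1

/-- The bound for the part of a layer in a selected cube, by testing on atoms. -/
lemma norm_Bil_layer_cube_le (hn : 1 ≤ n) {Φ : E3 n → ℝ} {A : E3 n → ℂ} {C : ℝ}
    (h : ∀ (u v : E n → ℂ) (x₀ : E n) (r : ℝ), AEStronglyMeasurable u → SizeCond x₀ r u →
      2 * r ≤ 2 * n → (1 ≤ 2 * r ∨ ∫ x, u x = 0) → BddSupp v → (∀ x, ‖v x‖ ≤ 1) →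
      ‖Bil Φ A u v‖ ≤ C) (hc : CellConst D f) (hf : BddSupp f) (hl : 0 < lam) {v : E n → ℂ}
    (hv : BddSupp v) (hv1 : ∀ x, ‖v x‖ ≤ 1) {k : ℕ} {y : E n}
    (hQ : cube k (cell k y) ⊆ Sel f lam k) :
    ‖Bil Φ A ((cube k (cell k y)).indicator (layer f D lam)) v‖ ≤
      C * (3 * 2 ^ n * n ^ n * lam) * volume.real (cube k (cell k y) : Set (E n)) := by
  have hn0 : (1 : ℝ) ≤ n := by exact_mod_cast hn
  set Q : Set (E n) := cube k (cell k y) with hQdef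
  set r : ℝ := n * (2 ^ k)⁻¹ with hr
  have hr0 : 0 < r := by positivity
  -- The factor by which the restricted layer exceeds a normalised atom of radius r = n 2^{-k};
  -- since r^n = n^n |Q| it is proportional to lam |Q|.
  set K : ℝ := 3 * 2 ^ n * lam * r ^ n with hK
  have hK0 : 0 < K := by positivity
  have hKv : K = 3 * 2 ^ n * n ^ n * lam * volume.real Q := by
    rw [hK, volume_real_cube, hr, mul_pow, inv_pow]; ring
  set u : E n → ℂ := fun x => ((K⁻¹ : ℝ) : ℂ) * Q.indicator (layer f D lam) x with hu
  have hlay := hf.layer hc hl.le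
  have hsize : SizeCond y r u := by
    refine ⟨hr0, fun x hx => ?_, fun x => ?_⟩
    · have hxQ : x ∈ Q := by
        by_contra hxQ
        exact hx (by simp [hu, Set.indicator_of_notMem hxQ])
      rw [Metric.mem_closedBall, dist_eq_norm]
      exact norm_sub_le_of_cell_eq hxQ
    · have h1 : ‖Q.indicator (layer f D lam) x‖ ≤ 3 * 2 ^ n * lam :=
        (norm_indicator_le_norm_self _ _).trans (norm_layer_le hc hf hl.le x)
      have h2 : (r ^ n)⁻¹ = K⁻¹ * (3 * 2 ^ n * lam) := by
        rw [hK]; field_simp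
      rw [hu, norm_mul, Complex.norm_real, Real.norm_eq_abs, abs_of_pos (inv_pos.2 hK0), h2]
      exact mul_le_mul_of_nonneg_left h1 (inv_pos.2 hK0).le
  -- At level 0 the layer need not have mean zero, but there r = n ≥ 1 and the atom counts as large.
  have hmean : 1 ≤ 2 * r ∨ ∫ x, u x = 0 := by
    rcases k with _ | k
    · left; rw [hr, pow_zero, inv_one, mul_one]; linarith
    · right
      rw [hu, integral_const_mul, integral_indicator (measurableSet_cube _ _),
        setIntegral_layer hc hf hl.le (Nat.succ_pos k) hQ, mul_zero]
  have hr1 : 2 * r ≤ 2 * n := by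
    have : ((2 : ℝ) ^ k)⁻¹ ≤ 1 := inv_le_one_of_one_le₀ (one_le_pow₀ (by norm_num))
    nlinarith
  have hb := h u v y r ((hlay.meas.indicator (measurableSet_cube _ _)).const_mul _) hsize hr1 hmean
    hv hv1
  rw [hu, Bil_smul_left, norm_mul, Complex.norm_real, Real.norm_eq_abs,
    abs_of_pos (inv_pos.2 hK0), inv_mul_le_iff₀ hK0] at hb
  refine hb.trans (le_of_eq ?_)
  rw [hKv]; ring

/-- The layer is the finite sum of its restrictions to the disjoint stopping cubes; each contributes
a constant times lam |Q|, and the volumes add up to that of `Lev`. -/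
lemma norm_Bil_layer_le (hn : 1 ≤ n) {Φ : E3 n → ℝ} (hΦ : Continuous Φ) {A : E3 n → ℂ}
    {G : E n → ℝ} (hA : AmpDom A G) {C : ℝ}
    (h : ∀ (u v : E n → ℂ) (x₀ : E n) (r : ℝ), AEStronglyMeasurable u → SizeCond x₀ r u →
      2 * r ≤ 2 * n → (1 ≤ 2 * r ∨ ∫ x, u x = 0) → BddSupp v → (∀ x, ‖v x‖ ≤ 1) →
      ‖Bil Φ A u v‖ ≤ C) (hc : CellConst D f) (hf : BddSupp f) (hl : 0 < lam) {v : E n → ℂ}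
    (hv : BddSupp v) (hv1 : ∀ x, ‖v x‖ ≤ 1) :
    ‖Bil Φ A (layer f D lam) v‖ ≤
      C * (3 * 2 ^ n * n ^ n * lam) * volume.real (Lev f D lam) := by
  obtain ⟨M, R, hM, hR⟩ := hf.bdd
  have hlay := hf.layer hc hl.le
  have hfin : ∀ k ∈ Finset.range (D + 1), (cell k '' Sel f lam k).Finite := fun k hk =>
    (finite_cells k (R + n)).subset (Set.image_mono ((Sel_subset_Lev
      (by simpa [Nat.lt_succ_iff] using hk)).trans (Lev_subset_ball hl.le hR)))
  have hcub : ∀ k ∈ Finset.range (D + 1), ∃ T : Finset (Fin n → ℤ),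
      (∀ c ∈ T, ∃ y, c = cell k y ∧ cube k (cell k y) ⊆ Sel f lam k) ∧
      Sel f lam k = ⋃ c ∈ T, cube k c := by
    intro k hk
    refine ⟨(hfin k hk).toFinset, fun c hc' => ?_, ?_⟩
    · obtain ⟨y, hy, rfl⟩ := (hfin k hk).mem_toFinset.1 hc'
      exact ⟨y, rfl, fun x hx => (cellConst_Sel k y x hx.symm).mp hy⟩
    · ext x
      simp only [Set.Finite.mem_toFinset, Set.mem_iUnion, mem_cube, exists_prop, exists_eq_right']
      exact Set.ext_iff.1 (cellConst_Sel k).eq_preimage x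
  have hdisj : ∀ (k : ℕ) (T : Set (Fin n → ℤ)), T.PairwiseDisjoint (cube (n := n) k) :=
    fun k T c _ c' _ hcc => Set.disjoint_left.2 fun x hx hx' => hcc (hx.symm.trans hx')
  have hk : ∀ k ∈ Finset.range (D + 1), ‖Bil Φ A ((Sel f lam k).indicator (layer f D lam)) v‖ ≤
      C * (3 * 2 ^ n * n ^ n * lam) * volume.real (Sel f lam k) := by
    intro k hk
    obtain ⟨T, hT1, hT2⟩ := hcub k hk
    rw [hT2, Finset.indicator_biUnion T (cube k) (hdisj k _),
      measureReal_biUnion_finset (hdisj k _) (fun c _ => measurableSet_cube k c)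
      (fun c _ => volume_cube_ne_top k c), Finset.mul_sum,
      Bil_sum_left hΦ hA T (fun c _ => hlay.integrable.indicator (measurableSet_cube k c))
        hv.integrable]
    refine norm_sum_le_of_le _ fun c hcT => ?_
    obtain ⟨y, rfl, hy⟩ := hT1 c hcT
    exact norm_Bil_layer_cube_le hn h hc hf hl hv hv1 hy
  have hsum : layer f D lam = fun x => ∑ k ∈ Finset.range (D + 1),
      (Sel f lam k).indicator (layer f D lam) x := by
    rw [← Finset.indicator_biUnion _ _ (pairwiseDisjoint_Sel _), ← Lev_eq_biUnion]
    refine (Set.indicator_eq_self.2 fun x hx => ?_).symm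
    by_contra hx'
    exact hx (layer_of_notMem hl.le hx')
  rw [hsum, Bil_sum_left hΦ hA _ (fun k _ => hlay.integrable.indicator (measurableSet_Sel k))
    hv.integrable, volume_Lev_eq_sum hf hl.le, Finset.mul_sum]
  exact norm_sum_le_of_le _ hk

end Layers

/-! ### Integrals depending holomorphically on a parameter. -/

section Holomorphic

variable {Ω : Type*} [MeasurableSpace Ω] {ν : Measure Ω} {H : ℂ → Ω → ℂ} {B : Ω → ℝ} {U : Set ℂ}

/-- An integral depending holomorphically on a parameter is holomorphic. -/
lemma diffContOnCl_integral (hU : IsOpen U)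
    (hm : ∀ z ∈ closure U, AEStronglyMeasurable (H z) ν)
    (hb : ∀ z ∈ closure U, ∀ o, ‖H z o‖ ≤ B o) (hB : Integrable B ν)
    (hd : ∀ o, Differentiable ℂ fun z => H z o) :
    DiffContOnCl ℂ (fun z => ∫ o, H z o ∂ν) U := by
  refine ⟨fun z hz => ?_, continuousOn_of_dominated hm
    (fun z hz => Eventually.of_forall fun o => hb z hz o) hB
    (Eventually.of_forall fun o => (hd o).continuous.continuousOn)⟩
  obtain ⟨r, hr, hrU⟩ := Metric.isOpen_iff.1 hU z hz
  have hsub : ∀ w ∈ Metric.ball z (r / 2), Metric.closedBall w (r / 4) ⊆ closure U := by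
    intro w hw y hy
    refine subset_closure (hrU ?_)
    rw [Metric.mem_ball] at hw ⊢
    rw [Metric.mem_closedBall] at hy
    have := dist_triangle y w z
    linarith
  have hzU : z ∈ closure U := subset_closure hz
  have hnhds : Metric.ball z (r / 2) ∈ 𝓝 z := Metric.ball_mem_nhds z (by positivity)
  have hmU : ∀ w ∈ Metric.ball z (r / 2), w ∈ closure U := fun w hw =>
    hsub w hw (Metric.mem_closedBall_self (by positivity))
  -- The z-derivative is measurable as a limit of difference quotients along a sequence staying in
  -- the closure of U.
  have hderiv : AEStronglyMeasurable (fun o => deriv (fun w => H w o) z) ν := by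
    obtain ⟨s, hs⟩ : ∃ s : ℕ → ℂ, (∀ k, s k ≠ 0 ∧ z + s k ∈ closure U) ∧
        Tendsto s atTop (𝓝 0) := by
      refine ⟨fun k => ((r / 4 * (1 / ((k : ℝ) + 1)) : ℝ) : ℂ), fun k => ⟨?_, ?_⟩, ?_⟩
      · have : (0 : ℝ) < r / 4 * (1 / ((k : ℝ) + 1)) := by positivity
        exact Complex.ofReal_ne_zero.2 this.ne'
      · refine hsub z (Metric.mem_ball_self (by positivity)) ?_
        rw [Metric.mem_closedBall, dist_eq_norm, add_sub_cancel_left, Complex.norm_real,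
          Real.norm_eq_abs, abs_of_pos (by positivity)]
        have : 1 / ((k : ℝ) + 1) ≤ 1 := by
          rw [div_le_one (by positivity)]
          have : (0 : ℝ) ≤ k := Nat.cast_nonneg k
          linarith
        nlinarith
      · have h1 := (tendsto_one_div_add_atTop_nhds_zero_nat (𝕜 := ℝ)).const_mul (r / 4)
        rw [mul_zero] at h1
        exact_mod_cast (Complex.continuous_ofReal.tendsto 0).comp h1
    refine aestronglyMeasurable_of_tendsto_ae atTop
      (f := fun k o => (s k)⁻¹ • (H (z + s k) o - H z o)) (fun k => ?_)
      (Eventually.of_forall fun o => ?_)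
    · exact AEStronglyMeasurable.const_smul ((hm _ (hs.1 k).2).sub (hm z hzU)) (s k)⁻¹
    · have h1 := hasDerivAt_iff_tendsto_slope_zero.1 (hd o z).hasDerivAt
      exact h1.comp (tendsto_nhdsWithin_iff.2 ⟨hs.2, Eventually.of_forall fun k => (hs.1 k).1⟩)
  -- The Cauchy estimate on discs of radius r/4 turns the majorant B of H into the majorant B/(r/4)
  -- of its derivative.
  refine ((hasDerivAt_integral_of_dominated_loc_of_deriv_le
    (F := fun w o => H w o) (F' := fun w o => deriv (fun w => H w o) w)
    (bound := fun o => B o / (r / 4)) hnhds ?_ ?_ hderiv ?_ (hB.div_const _)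
    ?_).2.differentiableAt).differentiableWithinAt
  · filter_upwards [hnhds] with w hw using hm w (hmU w hw)
  · exact hB.mono' (hm z hzU) (Eventually.of_forall fun o => hb z hzU o)
  · refine Eventually.of_forall fun o w hw => ?_
    refine Complex.norm_deriv_le_of_forall_mem_sphere_norm_le (by positivity)
      (hd o).diffContOnCl fun y hy => ?_
    exact hb y (hsub w hw (Metric.sphere_subset_closedBall hy)) o
  · exact Eventually.of_forall fun o w _ => (hd o w).hasDerivAt

end Holomorphic

/-! ### The analytic families through f and v. -/

section AnalyticFamily

variable {n : ℕ} {f v : E n → ℂ} {D : ℕ} {μ p q : ℝ}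

/-- The coefficient `lam ^ (p (1 + z) / 2 - 1)`. -/
def layerCoef (p lam : ℝ) (z : ℂ) : ℂ :=
  Complex.exp ((Real.log lam : ℂ) * (p * (1 + z) / 2 - 1))

lemma norm_layerCoef {lam : ℝ} (hl : 0 < lam) (z : ℂ) :
    ‖layerCoef p lam z‖ = lam ^ (p * (1 + z.re) / 2 - 1) := by
  rw [layerCoef, Complex.norm_exp, Real.rpow_def_of_pos hl, Complex.re_ofReal_mul]
  congr 2
  have : ((p : ℂ) * (1 + z) / 2 - 1) = ((p / 2 : ℝ) : ℂ) * (1 + z) - 1 := by push_cast; ring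
  rw [this, Complex.sub_re, Complex.re_ofReal_mul]
  simp; ring

lemma norm_layerCoef_le {lam : ℝ} (hl : 0 < lam) (hp : 0 ≤ p) {z : ℂ} (h0 : 0 ≤ z.re)
    (h1 : z.re ≤ 1) : ‖layerCoef p lam z‖ ≤ Real.exp (|Real.log lam| * (p + 1)) := by
  rw [norm_layerCoef hl, Real.rpow_def_of_pos hl, Real.exp_le_exp]
  refine (le_abs_self _).trans ?_
  rw [abs_mul]
  refine mul_le_mul_of_nonneg_left (abs_le.2 ⟨?_, ?_⟩) (abs_nonneg _) <;> nlinarith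

/-- The analytic family through a linear combination of layers. -/
def layerFam (f : E n → ℂ) (D : ℕ) (μ : ℝ) (N : ℕ) (p : ℝ) (z : ℂ) (y : E n) : ℂ :=
  ∑ j ∈ Finset.range N, layerCoef p (μ * 2 ^ j) z * layer f D (μ * 2 ^ j) y

/-- The analytic family `|v| ^ (q (1 - z) / 2) sgn v`. -/
def dualFam (v : E n → ℂ) (q : ℝ) (z : ℂ) (x : E n) : ℂ :=
  Complex.exp ((Real.log ‖v x‖ : ℂ) * (q * (1 - z) / 2)) * (v x / ‖v x‖)

lemma norm_dualFam_of_ne {z : ℂ} {x : E n} (hx : v x ≠ 0) :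
    ‖dualFam v q z x‖ = ‖v x‖ ^ (q * (1 - z.re) / 2) := by
  have h0 : 0 < ‖v x‖ := norm_pos_iff.2 hx
  rw [dualFam, norm_mul, Complex.norm_exp, Real.rpow_def_of_pos h0, Complex.re_ofReal_mul, norm_div,
    Complex.norm_real, norm_norm, div_self h0.ne', mul_one]
  congr 2
  have : ((q : ℂ) * (1 - z) / 2) = ((q / 2 : ℝ) : ℂ) * (1 - z) := by push_cast; ring
  rw [this, Complex.re_ofReal_mul]
  simp; ring

lemma dualFam_of_eq {z : ℂ} {x : E n} (hx : v x = 0) : dualFam v q z x = 0 := by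
  simp [dualFam, hx]

lemma bddSupp_layerFam (hc : CellConst D f) (hf : BddSupp f) (hμ : 0 < μ) (N : ℕ) (z : ℂ) :
    BddSupp (layerFam f D μ N p z) :=
  BddSupp.sum _ fun j _ => (hf.layer hc (by positivity)).const_mul _

lemma norm_layerFam_le (hμ : 0 < μ) (N : ℕ) (hp : 0 ≤ p)
    {z : ℂ} (h0 : 0 ≤ z.re) (h1 : z.re ≤ 1) (y : E n) :
    ‖layerFam f D μ N p z y‖ ≤ ∑ j ∈ Finset.range N,
      Real.exp (|Real.log (μ * 2 ^ j)| * (p + 1)) * ‖layer f D (μ * 2 ^ j) y‖ := by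
  refine norm_sum_le_of_le _ fun j _ => ?_
  rw [norm_mul]
  exact mul_le_mul_of_nonneg_right (norm_layerCoef_le (by positivity) hp h0 h1) (norm_nonneg _)

lemma norm_dualFam_le {M R : ℝ} (hM : ∀ x, ‖v x‖ ≤ M)
    (hR : Function.support v ⊆ Metric.closedBall 0 R) (hq : 0 ≤ q) {z : ℂ} (h0 : 0 ≤ z.re)
    (h1 : z.re ≤ 1) (x : E n) :
    ‖dualFam v q z x‖ ≤ (Metric.closedBall 0 R).indicator (fun _ => (max 1 M) ^ (q / 2)) x := by
  by_cases hx : v x = 0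
  · rw [dualFam_of_eq hx, norm_zero]
    exact Set.indicator_nonneg (fun _ _ => by positivity) x
  · rw [Set.indicator_of_mem (hR hx), norm_dualFam_of_ne hx]
    calc ‖v x‖ ^ (q * (1 - z.re) / 2) ≤ (max 1 M) ^ (q * (1 - z.re) / 2) :=
          Real.rpow_le_rpow (norm_nonneg _) ((hM x).trans (le_max_right _ _))
            (by have : 0 ≤ 1 - z.re := by linarith
                positivity)
      _ ≤ (max 1 M) ^ (q / 2) := Real.rpow_le_rpow_of_exponent_le (le_max_left _ _) (by nlinarith)

lemma aesm_dualFam (hv : AEStronglyMeasurable v) (z : ℂ) :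
    AEStronglyMeasurable (dualFam v q z) := by
  have h1 : AEMeasurable v := hv.aemeasurable
  have h2 : AEMeasurable fun x => ((Real.log ‖v x‖ : ℝ) : ℂ) :=
    Complex.measurable_ofReal.comp_aemeasurable (Real.measurable_log.comp_aemeasurable h1.norm)
  have h3 : AEMeasurable fun x => ((‖v x‖ : ℝ) : ℂ) :=
    Complex.measurable_ofReal.comp_aemeasurable h1.norm
  exact ((Complex.measurable_exp.comp_aemeasurable (h2.mul_const _)).mul
    (h1.div h3)).aestronglyMeasurable

lemma bddSupp_dualFam (hv : BddSupp v) (hq : 0 ≤ q) {z : ℂ} (h0 : 0 ≤ z.re) (h1 : z.re ≤ 1) :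
    BddSupp (dualFam v q z) := by
  obtain ⟨M, R, hM, hR⟩ := hv.bdd
  refine ⟨aesm_dualFam hv.meas z, (max 1 M) ^ (q / 2), R, fun x => ?_, fun x hx => ?_⟩
  · refine (norm_dualFam_le hM hR hq h0 h1 x).trans ?_
    exact Set.indicator_le_self' (fun _ _ => by positivity) x
  · exact hR fun h => hx (dualFam_of_eq h)

lemma nrm_two_dualFam {z : ℂ} (hq : 0 < q) (hz : z.re = 0) :
    nrm 2 (dualFam v q z) = (∫ x, ‖v x‖ ^ q) ^ (1 / (2 : ℝ)) := by
  rw [nrm]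
  congr 2
  funext x
  by_cases hx : v x = 0
  · rw [dualFam_of_eq hx, hx, norm_zero, Real.zero_rpow two_ne_zero, Real.zero_rpow hq.ne']
  · rw [norm_dualFam_of_ne hx, ← Real.rpow_mul (norm_nonneg _), hz]
    congr 1; ring

lemma norm_dualFam_le_one {z : ℂ} (hz : z.re = 1) (x : E n) : ‖dualFam v q z x‖ ≤ 1 := by
  by_cases hx : v x = 0
  · rw [dualFam_of_eq hx, norm_zero]; exact zero_le_one
  · rw [norm_dualFam_of_ne hx, hz]; simp

/-- At z = 2/p - 1 the exponent p(1 + z)/2 - 1 vanishes and all coefficients are 1. -/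
lemma layerFam_eq (hp : 0 < p) (N : ℕ) (y : E n) :
    layerFam f D μ N p ((2 / p - 1 : ℝ) : ℂ) y =
      ∑ j ∈ Finset.range N, layer f D (μ * 2 ^ j) y := by
  refine Finset.sum_congr rfl fun j _ => ?_
  have : (p : ℂ) * (1 + ((2 / p - 1 : ℝ) : ℂ)) / 2 - 1 = 0 := by
    have : (p : ℂ) ≠ 0 := by exact_mod_cast hp.ne'
    push_cast; field_simp; ring
  rw [layerCoef, this, mul_zero, Complex.exp_zero, one_mul]

/-- At z = 2/p - 1 conjugacy of p and q gives q(1 - z)/2 = 1, so modulus and sign recombine to v. -/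
lemma dualFam_eq (hpq : 1 / p + 1 / q = 1) (hq : 0 < q) (x : E n) :
    dualFam v q ((2 / p - 1 : ℝ) : ℂ) x = v x := by
  by_cases hx : v x = 0
  · rw [dualFam_of_eq hx, hx]
  have h0 : 0 < ‖v x‖ := norm_pos_iff.2 hx
  have h1 : q * (1 - (2 / p - 1)) / 2 = 1 := by
    have : 1 / p = 1 - 1 / q := by linarith
    have h2 : 2 / p = 2 * (1 - 1 / q) := by rw [← this]; ring
    rw [h2]; field_simp; ring
  have h2 : (q : ℂ) * (1 - ((2 / p - 1 : ℝ) : ℂ)) / 2 = 1 := by exact_mod_cast congrArg (fun t : ℝ => (t : ℂ)) h1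
  rw [dualFam, h2, mul_one, ← Complex.ofReal_exp, Real.exp_log h0, mul_div_cancel₀]
  exact_mod_cast h0.ne'

end AnalyticFamily

/-! ### The three lines theorem for the regularised forms. -/

section Interpolation

variable {n : ℕ} {f v : E n → ℂ} {D : ℕ} {μ p q m : ℝ} {Φ : E3 n → ℝ} {a : E3 n → ℂ}
  {g : E n → ℂ}

/-- The analytic family of amplitudes. -/
def ampFam (m θ : ℝ) (g : E n → ℂ) (a : E3 n → ℂ) (z : ℂ) (p : E3 n) : ℂ :=
  japC (m * (θ - z)) p.2.2 * (g p.2.2 * a p)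

/-- For Re z ≥ 0 the weight is at most ⟨ξ⟩^{mθ}. Its growth is harmless against the compactly
supported cut-off, so one function of ξ dominates the whole strip; only qualitative use is made of
it. -/
lemma ampDom_ampFam {C θ : ℝ} (hm : 0 ≤ m) (hg : IsTest g) (hac : Continuous a)
    (hC : ∀ p, ‖a p‖ ≤ C) {z : ℂ} (h0 : 0 ≤ z.re) :
    AmpDom (ampFam m θ g a z) (fun ξ => jap ξ ^ (m * θ) * (C * ‖g ξ‖)) where
  cont := ((contDiff_lift (contDiff_japC _)).continuous).mul
    ((hg.1.continuous.comp (by fun_prop)).mul hac)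
  int := by
    have h1 : Continuous fun ξ : E n => jap ξ ^ (m * θ) := by
      have := (contDiff_japC (n := n) ((m * θ : ℝ) : ℂ)).continuous.norm
      simpa only [norm_japC, Complex.ofReal_re] using this
    refine Continuous.integrable_of_hasCompactSupport
      (h1.mul (continuous_const.mul hg.1.continuous.norm)) ?_
    exact (hg.2.norm.mul_left (f := fun _ => C)).mul_left
  le p := by
    rw [ampFam, norm_mul, norm_mul, norm_japC, mul_comm C]
    have h1 : (m * (θ - z)).re = m * (θ - z.re) := by
      rw [Complex.re_ofReal_mul]; simp
    rw [h1]
    have h2 : jap p.2.2 ^ (m * (θ - z.re)) ≤ jap p.2.2 ^ (m * θ) :=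
      Real.rpow_le_rpow_of_exponent_le (one_le_jap _) (by nlinarith)
    have h3 := hC p
    have h4 : 0 < jap p.2.2 := jap_pos _
    gcongr

/-- The interpolation of the endpoint estimates along the analytic families. -/
lemma norm_Bil_le_interp (hΦ : Continuous Φ) (hm : 0 ≤ m) (hp1 : 1 < p) (hp2 : p < 2)
    (hpq : 1 / p + 1 / q = 1) (hg : IsTest g) (hac : Continuous a) {Ca : ℝ}
    (hCa : ∀ p, ‖a p‖ ≤ Ca) (hc : CellConst D f) (hf : BddSupp f) (hv : BddSupp v) (hμ : 0 < μ)
    {N : ℕ} {X Y : ℝ}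
    (hX : ∀ z : ℂ, z.re = 0 → ‖Complex.exp (z ^ 2) * Bil Φ (ampFam m (2 / p - 1) g a z)
      (layerFam f D μ N p z) (dualFam v q z)‖ ≤ X)
    (hY : ∀ z : ℂ, z.re = 1 → ‖Complex.exp (z ^ 2) * Bil Φ (ampFam m (2 / p - 1) g a z)
      (layerFam f D μ N p z) (dualFam v q z)‖ ≤ Y)
    (hN : ∀ x, f x = ∑ j ∈ Finset.range N, layer f D (μ * 2 ^ j) x) :
    ‖Bil Φ (fun p => g p.2.2 * a p) f v‖ ≤ X ^ (1 - (2 / p - 1)) * Y ^ (2 / p - 1) := by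
  set θ := 2 / p - 1 with hθ
  have hp0 : 0 < p := by linarith
  have hθ0 : 0 ≤ θ := by
    rw [hθ, sub_nonneg, le_div_iff₀ hp0]; linarith
  have hθ1 : θ ≤ 1 := by
    rw [hθ, sub_le_iff_le_add, div_le_iff₀ hp0]; linarith
  have hq0 : 0 < q := by
    have h1 : 1 / p < 1 := by rw [div_lt_one hp0]; exact hp1
    have h2 : 0 < 1 / q := by linarith
    exact one_div_pos.1 h2
  obtain ⟨M, R, hM, hR⟩ := hv.bdd
  -- An integrable majorant valid on the whole closed strip. It gives holomorphy inside, continuity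
  -- up to the edges, and the a priori boundedness required by the three lines theorem; its size
  -- does not enter the final constant.
  set Bd : E3 n → ℝ := fun w =>
    (Metric.closedBall (0 : E n) R).indicator (fun _ => (max 1 M) ^ (q / 2)) w.1 *
      ((∑ j ∈ Finset.range N, Real.exp (|Real.log (μ * 2 ^ j)| * (p + 1)) *
        ‖layer f D (μ * 2 ^ j) w.2.1‖) * (jap w.2.2 ^ (m * θ) * (Ca * ‖g w.2.2‖))) with hBd
  have hadm : ∀ z : ℂ, 0 ≤ z.re → AmpDom (ampFam m θ g a z)
      (fun ξ => jap ξ ^ (m * θ) * (Ca * ‖g ξ‖)) := fun z hz => ampDom_ampFam hm hg hac hCa hz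
  have hBint : Integrable Bd := by
    have h1 : Integrable fun y => ∑ j ∈ Finset.range N,
        Real.exp (|Real.log (μ * 2 ^ j)| * (p + 1)) * ‖layer f D (μ * 2 ^ j) y‖ :=
      integrable_finsetSum _ fun j _ =>
        ((hf.layer hc (by positivity)).integrable.norm).const_mul _
    exact integrable_triple (integrable_ball_const 0 R _) h1 (hadm 0 le_rfl).int
  have hle : ∀ z : ℂ, 0 ≤ z.re → z.re ≤ 1 → ∀ w, ‖bilInt Φ (ampFam m θ g a z)
      (layerFam f D μ N p z) (dualFam v q z) w‖ ≤ Bd w := by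
    intro z h0 h1 w
    refine (bilInt_le (hadm z h0) w).trans ?_
    have hG0 : 0 ≤ jap w.2.2 ^ (m * θ) * (Ca * ‖g w.2.2‖) :=
      (norm_nonneg _).trans ((hadm z h0).le w)
    have e1 := norm_dualFam_le hM hR hq0.le h0 h1 w.1
    have e2 := norm_layerFam_le (f := f) (D := D) hμ N hp0.le h0 h1 w.2.1
    exact mul_le_mul e1 (mul_le_mul_of_nonneg_right e2 hG0)
      (mul_nonneg (norm_nonneg _) hG0) ((norm_nonneg _).trans e1)
  have hclos : closure (Complex.HadamardThreeLines.verticalStrip 0 1) ⊆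
      Complex.HadamardThreeLines.verticalClosedStrip 0 1 :=
    closure_minimal (fun z hz => Set.Ioo_subset_Icc_self hz)
      (isClosed_Icc.preimage Complex.continuous_re)
  have hopen : IsOpen (Complex.HadamardThreeLines.verticalStrip 0 1) :=
    isOpen_Ioo.preimage Complex.continuous_re
  have hdiff : DiffContOnCl ℂ (fun z => Bil Φ (ampFam m θ g a z) (layerFam f D μ N p z)
      (dualFam v q z)) (Complex.HadamardThreeLines.verticalStrip 0 1) := by
    refine diffContOnCl_integral (B := Bd) hopen (fun z hz => ?_) (fun z hz => ?_) hBint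
      fun w => ?_
    · exact aesm_bilInt hΦ (hadm z (hclos hz).1).cont (bddSupp_layerFam hc hf hμ N z).meas
        (aesm_dualFam hv.meas z)
    · exact hle z (hclos hz).1 (hclos hz).2
    · simp only [bilInt, ampFam, layerFam, dualFam, japC, layerCoef]
      fun_prop
  have hexp : ∀ z : ℂ, 0 ≤ z.re → z.re ≤ 1 → ‖Complex.exp (z ^ 2)‖ ≤ Real.exp 1 := by
    intro z h0 h1
    rw [Complex.norm_exp, Real.exp_le_exp, sq, Complex.mul_re]
    nlinarith [mul_self_nonneg z.im]
  have hmain := Complex.HadamardThreeLines.norm_le_interp_of_mem_verticalClosedStrip'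
    (f := fun z => Complex.exp (z ^ 2) * Bil Φ (ampFam m θ g a z) (layerFam f D μ N p z)
      (dualFam v q z)) (z := ((θ : ℝ) : ℂ)) zero_lt_one ⟨by simpa using hθ0, by simpa using hθ1⟩
    ?_ ?_ (fun z hz => hX z hz) (fun z hz => hY z hz)
  · have h1 : Bil Φ (ampFam m θ g a (θ : ℂ)) (layerFam f D μ N p (θ : ℂ)) (dualFam v q (θ : ℂ)) =
        Bil Φ (fun p => g p.2.2 * a p) f v := by
      congr 1
      · funext w
        simp [ampFam, japC]
      · funext y
        rw [hθ, layerFam_eq hp0, ← hN]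
      · funext x
        rw [hθ, dualFam_eq hpq hq0]
    simp only [h1, norm_mul, Complex.ofReal_re, sub_zero, div_one] at hmain
    refine le_trans ?_ hmain
    -- At z = θ the auxiliary factor is e^{θ²} ≥ 1 and can be dropped.
    have h2 : 1 ≤ ‖Complex.exp ((θ : ℂ) ^ 2)‖ := by
      rw [Complex.norm_exp, ← Complex.ofReal_pow, Complex.ofReal_re]
      exact Real.one_le_exp (sq_nonneg θ)
    exact le_mul_of_one_le_left (norm_nonneg _) h2
  · exact DiffContOnCl.smul (f := fun z => Bil Φ (ampFam m θ g a z) (layerFam f D μ N p z)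
      (dualFam v q z)) (c := fun z => Complex.exp (z ^ 2))
      (Differentiable.diffContOnCl (by fun_prop)) hdiff
  · refine ⟨Real.exp 1 * ∫ w, Bd w, ?_⟩
    rintro _ ⟨z, hz, rfl⟩
    simp only [Function.comp, norm_mul]
    refine mul_le_mul (hexp z hz.1 hz.2) ?_ (norm_nonneg _) (Real.exp_pos _).le
    refine (norm_integral_le_integral_norm _).trans ?_
    refine integral_mono_of_nonneg (Eventually.of_forall fun _ => norm_nonneg _) hBint
      (Eventually.of_forall fun w => hle z hz.1 hz.2 w)

end Interpolation

/-! ### Endpoint estimates, uniform in Im z and in the cut-off. -/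

section Endpoints

variable {n : ℕ} {Φ : E3 n → ℝ} {p q m : ℝ} {a : E3 n → ℂ} {g : E n → ℂ}

/-- The family of amplitudes `e^{-t²} ⟨ξ⟩^{-imt} g(εξ)`. -/
def famAmp (m : ℝ) (g : E n → ℂ) (i : ℝ × Set.Ioc (0 : ℝ) 1) (p : E3 n) : ℂ :=
  (Real.exp (-i.1 ^ 2) : ℂ) * japC (-(m * (Complex.I * i.1))) p.2.2 * g ((i.2 : ℝ) • p.2.2)

lemma contDiff_famAmp (hg : IsTest g) (i : ℝ × Set.Ioc (0 : ℝ) 1) :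
    ContDiff ℝ ∞ (famAmp m g i) :=
  (contDiff_const.mul (contDiff_lift (contDiff_japC _))).mul
    (contDiff_lift (hg.comp_smul i.2.2.1.ne').1)

lemma symE3_famAmp (m : ℝ) (hg : IsTest g) (k : ℕ) : SymE3 k 0 (famAmp (n := n) m g) := by
  have h1 := (symE3_japC_family (n := n) (-m) k 0 0).reindex
    (Prod.fst : ℝ × Set.Ioc (0 : ℝ) 1 → ℝ)
  have h2 := (symE3_cutoff_family k 0 g hg).reindex
    (Prod.snd : ℝ × Set.Ioc (0 : ℝ) 1 → Set.Ioc (0 : ℝ) 1)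
  have h3 := SymB.mul (fun p : E3 n => jap_pos p.2.2)
    (fun i => contDiff_const.mul (contDiff_lift (contDiff_japC _)))
    (fun i => contDiff_const.mul (contDiff_lift (hg.comp_smul i.2.2.1.ne').1)) h1 h2
  convert h3 using 1
  · simp
  · funext i p
    simp only [famAmp, pow_zero, one_mul, Complex.ofReal_zero, zero_add, Complex.ofReal_neg]
    congr 3
    ring

lemma ampDom_famAmp (hg : IsTest g) {A : E3 n → ℂ} (hA : IsSymbol 0 A ∨ IsSymbol (-m) A)
    (hm : 0 ≤ m) (i : ℝ × Set.Ioc (0 : ℝ) 1) :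
    ∃ G, AmpDom (fun p => famAmp m g i p * A p) G := by
  obtain ⟨C, hc, hC⟩ : ∃ C : ℝ, Continuous A ∧ ∀ p, ‖A p‖ ≤ C := by
    rcases hA with h | h
    · obtain ⟨C, -, hC⟩ := h.bdd le_rfl
      exact ⟨C, h.1.continuous, hC⟩
    · obtain ⟨C, -, hC⟩ := h.bdd (by linarith)
      exact ⟨C, h.1.continuous, hC⟩
  set b : E n → ℂ := fun ξ => ((Real.exp (-i.1 ^ 2) : ℂ) * japC (-(m * (Complex.I * i.1))) ξ) *
    g ((i.2 : ℝ) • ξ)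
  have hb : IsTest b := ⟨(contDiff_const.mul (contDiff_japC _)).mul (hg.comp_smul i.2.2.1.ne').1,
    (hg.comp_smul i.2.2.1.ne').2.mul_left⟩
  exact ⟨_, ampDom_cutoff hc hC hb⟩

lemma norm_integral_mul_le (hpq : p.HolderConjugate q) {f v : E n → ℂ}
    (hf : MemLp f (ENNReal.ofReal p)) (hv : MemLp v (ENNReal.ofReal q)) :
    ‖∫ x, f x * v x‖ ≤ nrm p f * nrm q v := by
  refine (norm_integral_le_integral_norm _).trans ?_
  simp only [norm_mul]
  exact integral_mul_norm_le_Lp_mul_Lq hpq hf hv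

lemma nrm_le_of_eLpNorm_le {f u : E n → ℂ} (hp : 0 < p) (hf : MemLp f (ENNReal.ofReal p))
    (hu : MemLp u (ENNReal.ofReal p)) {C : ℝ≥0}
    (h : eLpNorm f (ENNReal.ofReal p) volume ≤ C * eLpNorm u (ENNReal.ofReal p) volume) :
    nrm p f ≤ C * nrm p u := by
  rw [FourierInt.MemLp.eLpNorm_eq_nrm hp hf, FourierInt.MemLp.eLpNorm_eq_nrm hp hu,
    ← ENNReal.ofReal_coe_nnreal, ← ENNReal.ofReal_mul (NNReal.coe_nonneg C)] at h
  exact (ENNReal.ofReal_le_ofReal_iff (mul_nonneg (NNReal.coe_nonneg C) (nrm_nonneg _ _))).1 h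

/-- Hypothesis (A2) for each amplitude, made uniform over `famAmp` by `uniform_of_forall` with
weight ‖u‖₂‖v‖₂, then extended from test functions to bounded ones. -/
lemma exists_L2_bound (hΦ : Continuous Φ)
    (hA2 : ∀ a : E3 n → ℂ, IsSymbol 0 a → LpBounded 2 Φ a) (hm : 0 ≤ m)
    {A : E3 n → ℂ} (hA : IsSymbol 0 A) (hg : IsTest g) :
    ∃ C : ℝ, 0 ≤ C ∧ ∀ i u v, BddSupp u → BddSupp v →
      ‖Bil Φ (fun p => famAmp m g i p * A p) u v‖ ≤ C * (nrm 2 u * nrm 2 v) := by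
  have hA2' : ∀ a : E3 n → ℂ, IsSymbol 0 a → LpBounded (ENNReal.ofReal 2) Φ a := by
    have h2 : ENNReal.ofReal 2 = 2 := by simp
    rw [h2]; exact hA2
  obtain ⟨C, hC0, hC⟩ := uniform_of_forall hΦ le_rfl hA (contDiff_famAmp (m := m) hg)
    (symE3_famAmp m hg) (ampDom_famAmp hg (Or.inl hA) hm)
    (𝒰 := {w | IsTest w.1 ∧ IsTest w.2}) (fun w hw => hw)
    (N := fun w => nrm 2 w.1 * nrm 2 w.2)
    (fun w => mul_nonneg (nrm_nonneg _ _) (nrm_nonneg _ _)) (fun A' hA' => by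
      obtain ⟨C, hC⟩ := hA2' A' hA'
      refine ⟨C, fun w hw => ?_⟩
      obtain ⟨f, hf, hf2, hle⟩ := hC w.1 hw.1
      refine ⟨f, hf, ?_⟩
      have h3 := nrm_le_of_eLpNorm_le two_pos hf2 (hw.1.bddSupp.memLp _) hle
      refine (norm_integral_mul_le Real.HolderConjugate.two_two hf2 (hw.2.bddSupp.memLp _)).trans ?_
      rw [← mul_assoc]
      exact mul_le_mul_of_nonneg_right h3 (nrm_nonneg _ _))
  refine ⟨C, hC0, fun i u v hu hv => ?_⟩
  obtain ⟨G, hG⟩ := ampDom_famAmp hg (Or.inl hA) hm i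
  exact Bil_le_of_test hΦ hG two_pos two_pos (fun u v hu hv => hC i (u, v) ⟨hu, hv⟩) hu hv

/-- The atomic bound is made uniform over `famAmp` with weight 1, the admissible pairs being smooth
atoms of radius at most 2n with test functions bounded by 1. It passes to rough atoms by
mollification and to layers through their stopping cubes. -/
lemma exists_layer_bound (hn : 1 ≤ n) (hΦ : ContDiff ℝ ∞ Φ)
    (hA1 : ∀ j, IsSymbol 0 (partialXi Φ j)) (hm : 0 ≤ m)
    (hA2 : ∀ a : E3 n → ℂ, IsSymbol 0 a → LpBounded 2 Φ a)
    (hA3 : ∀ a : E3 n → ℂ, IsSymbol (-m) a → UnifLocHardyBounded Φ a)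
    {A : E3 n → ℂ} (hA : IsSymbol (-m) A) (hg : IsTest g) :
    ∃ C : ℝ, 0 ≤ C ∧ ∀ i (f v : E n → ℂ) (D : ℕ) (lam : ℝ), CellConst D f → BddSupp f → 0 < lam →
      BddSupp v → (∀ x, ‖v x‖ ≤ 1) → ‖Bil Φ (fun p => famAmp m g i p * A p) (layer f D lam) v‖ ≤
        C * (lam * volume.real (Lev f D lam)) := by
  obtain ⟨C, hC0, hC⟩ := uniform_of_forall hΦ.continuous (neg_nonpos.2 hm) hA
    (contDiff_famAmp (m := m) hg) (symE3_famAmp m hg) (ampDom_famAmp hg (Or.inr hA) hm)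
    (𝒰 := {w | IsTest w.1 ∧ IsTest w.2 ∧ ∃ x₀ r, SizeCond x₀ r w.1 ∧ r ≤ 2 * n ∧
      (1 ≤ r ∨ ∫ x, w.1 x = 0) ∧ ∀ x, ‖w.2 x‖ ≤ 1}) (fun w hw => ⟨hw.1, hw.2.1⟩)
    (N := fun _ => 1) (fun _ => zero_le_one) (fun A' hA' => by
      obtain ⟨C, hC⟩ := exists_atom_bound hΦ hA1 (neg_nonpos.2 hm) hA2 hA3 hA'
        (R₀ := 2 * n) (by positivity)
      refine ⟨C, fun w hw => ?_⟩
      obtain ⟨h1, h2, x₀, r, h3, h4, h5, h6⟩ := hw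
      rw [mul_one]
      exact hC w.1 w.2 x₀ r h1 h2 h3 h4 h5 h6)
  refine ⟨2 ^ n * C * (3 * 2 ^ n * n ^ n), by positivity,
    fun i f v D lam hc hf hl hv hv1 => ?_⟩
  obtain ⟨G, hG⟩ := ampDom_famAmp hg (Or.inr hA) hm i
  refine (norm_Bil_layer_le hn hΦ.continuous hG (C := 2 ^ n * C) ?_ hc hf hl hv hv1).trans
    (le_of_eq (by ring))
  intro u v x₀ r hu hs hr hor hv hv1
  refine Bil_atom_le_of_test hΦ.continuous hG (R₀ := 2 * n) ?_ hu hs hr hor hv hv1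
  intro u v x₀ r hu hv hs hr hor hv1
  have := hC i (u, v) ⟨hu, hv, x₀, r, hs, hr, hor, hv1⟩
  rwa [mul_one] at this

/-- With z = s + it the modulus of e^{z²} is e^{s²}e^{-t²}, and ⟨ξ⟩^{m(θ-z)} =
⟨ξ⟩^{m(θ-s)}⟨ξ⟩^{-imt}. So e^{-t²}, the imaginary power and the cut-off form `famAmp`, while the
real power fixes the order of the amplitude on each edge. -/
lemma norm_exp_mul_Bil_ampFam (Φ : E3 n → ℝ) (a : E3 n → ℂ) (g : E n → ℂ) (m θ : ℝ) (z : ℂ)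
    (ε : Set.Ioc (0 : ℝ) 1) (u v : E n → ℂ) :
    ‖Complex.exp (z ^ 2) * Bil Φ (ampFam m θ (fun ξ => g ((ε : ℝ) • ξ)) a z) u v‖ =
      Real.exp (z.re ^ 2) * ‖Bil Φ (fun p => famAmp m g (z.im, ε) p *
        (a p * japC ((m * (θ - z.re) : ℝ) : ℂ) p.2.2)) u v‖ := by
  have h1 : Complex.exp (z ^ 2) = Complex.exp (z.re ^ 2 + 2 * z.re * z.im * Complex.I) *
      (Real.exp (-z.im ^ 2) : ℂ) := by
    rw [Complex.ofReal_exp, ← Complex.exp_add]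
    congr 1
    nth_rewrite 1 [← Complex.re_add_im z]
    push_cast
    ring_nf
    rw [Complex.I_sq]
    ring
  have h2 : ∀ p : E3 n, japC (m * (θ - z)) p.2.2 = japC (-(m * (Complex.I * z.im))) p.2.2 *
      japC ((m * (θ - z.re) : ℝ) : ℂ) p.2.2 := by
    intro p
    rw [← japC_add]
    congr 1
    nth_rewrite 1 [← Complex.re_add_im z]
    push_cast
    ring
  have h3 : ‖Complex.exp ((z.re : ℂ) ^ 2 + 2 * z.re * z.im * Complex.I)‖ = Real.exp (z.re ^ 2) := by
    rw [Complex.norm_exp]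
    congr 1
    have : ((z.re : ℂ) ^ 2 + 2 * z.re * z.im * Complex.I) =
      ((z.re ^ 2 : ℝ) : ℂ) + ((2 * z.re * z.im : ℝ) : ℂ) * Complex.I := by push_cast; ring
    rw [this, Complex.add_re, Complex.re_ofReal_mul, Complex.ofReal_re, Complex.I_re, mul_zero,
      add_zero]
  rw [h1, mul_assoc, norm_mul, h3, ← Bil_smul_amp]
  congr 3
  funext p
  simp only [ampFam, famAmp, h2]
  ring

end Endpoints

/-! ### The L^p estimate for 1 < p < 2. -/

section Strong

variable {n : ℕ} {Φ : E3 n → ℝ} {p q m : ℝ} {a : E3 n → ℂ} {g : E n → ℂ}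

/-- The exponents match because (1 - θ)/2 = 1/q and 1/q + θ = 1/p. The case P = 0 is separate, since
powers of 0 do not add. -/
lemma rpow_interp_le {C₀ C₁ K P V θ : ℝ} (h0 : 0 ≤ C₀) (h1 : 0 ≤ C₁) (hP : 0 ≤ P) (hV : 0 ≤ V)
    (hp1 : 1 < p) (hpq : 1 / p + 1 / q = 1) (hθ : θ = 2 / p - 1) (hK : K = C₀ ^ (1 - θ) * C₁ ^ θ) :
    (C₀ * (P ^ (1 / (2 : ℝ)) * V ^ (1 / (2 : ℝ)))) ^ (1 - θ) * (C₁ * P) ^ θ ≤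
      K * (P ^ (1 / p) * V ^ (1 / q)) := by
  have e1 : 1 / (2 : ℝ) * (1 - θ) = 1 / q := by
    rw [hθ, ← sub_eq_of_eq_add' hpq.symm]; ring
  rw [Real.mul_rpow h0 (by positivity), Real.mul_rpow (by positivity) (by positivity),
    Real.mul_rpow h1 hP, ← Real.rpow_mul hP, ← Real.rpow_mul hV, e1, hK]
  have e2 : P ^ (1 / q) * P ^ θ = P ^ (1 / p) := by
    rcases hP.eq_or_lt with h | h
    · have hp0 : 1 / p ≠ 0 := by positivity
      rw [← h, Real.zero_rpow hp0]
      by_cases h2 : 1 / q = 0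
      · have : θ ≠ 0 := by
          intro h3
          rw [hθ] at h3
          have : 2 / p = 2 * (1 / p) := by ring
          linarith
        rw [Real.zero_rpow this, mul_zero]
      · rw [Real.zero_rpow h2, zero_mul]
    · rw [← Real.rpow_add h]
      congr 1
      rw [hθ, ← sub_eq_of_eq_add' hpq.symm]; ring
  rw [← e2]
  exact le_of_eq (by ring)

/-- The estimate for exponents between `1` and `2`, for regularised operators. -/
lemma exists_interp_bound (hn : 1 ≤ n) (hΦ : ContDiff ℝ ∞ Φ)
    (hA1 : ∀ j, IsSymbol 0 (partialXi Φ j)) (hm : 0 ≤ m)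
    (hA2 : ∀ a : E3 n → ℂ, IsSymbol 0 a → LpBounded 2 Φ a)
    (hA3 : ∀ a : E3 n → ℂ, IsSymbol (-m) a → UnifLocHardyBounded Φ a)
    (hp1 : 1 < p) (hp2 : p < 2) (hpq : 1 / p + 1 / q = 1)
    (ha : IsSymbol (-(m * (2 / p - 1))) a) (hg : IsTest g) :
    ∃ C : ℝ, 0 ≤ C ∧ ∀ (ε : Set.Ioc (0 : ℝ) 1) (f v : E n → ℂ) (D : ℕ), CellConst D f →
      BddSupp f → BddSupp v →
      ‖Bil Φ (fun p => g ((ε : ℝ) • p.2.2) * a p) f v‖ ≤ C * (nrm p f * nrm q v) := by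
  set θ := 2 / p - 1 with hθ
  have hp0 : 0 < p := by linarith
  have hθ0 : 0 ≤ θ := by
    rw [hθ, sub_nonneg, le_div_iff₀ hp0]; linarith
  have hθ1 : θ ≤ 1 := by
    rw [hθ, sub_le_iff_le_add, div_le_iff₀ hp0]; linarith
  have hq0 : 0 < q := by
    have h1 : 1 / p < 1 := by rw [div_lt_one hp0]; exact hp1
    have h2 : 0 < 1 / q := by linarith
    exact one_div_pos.1 h2
  have hS0 : IsSymbol 0 (fun p => a p * japC ((m * θ : ℝ) : ℂ) p.2.2) := by
    have := ha.mul (isSymbol_japC (n := n) (m * θ))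
    rwa [neg_add_cancel] at this
  have hS1 : IsSymbol (-m) (fun p => a p * japC ((m * (θ - 1) : ℝ) : ℂ) p.2.2) := by
    have := ha.mul (isSymbol_japC (n := n) (m * (θ - 1)))
    convert this using 1; ring
  obtain ⟨C₀, hC₀, h0⟩ := exists_L2_bound hΦ.continuous hA2 hm hS0 hg
  obtain ⟨C₁, hC₁, h1⟩ := exists_layer_bound hn hΦ hA1 hm hA2 hA3 hS1 hg
  obtain ⟨Ca, -, hCa⟩ := ha.bdd (neg_nonpos.2 (mul_nonneg hm hθ0))
  set Kp : ℝ := 2 ^ p * geomConst (p - 1) with hKp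
  have hKp0 : 0 < Kp := mul_pos (by positivity) (geomConst_pos (by linarith))
  set K₂ : ℝ := 3 * 2 ^ n * geomConst (p / 2) with hK₂
  have hK₂0 : 0 < K₂ := mul_pos (by positivity) (geomConst_pos (by linarith))
  set B₀ : ℝ := C₀ * (K₂ * Kp ^ (1 / (2 : ℝ))) with hB₀
  set B₁ : ℝ := Real.exp 1 * (C₁ * Kp) with hB₁
  -- The constant involves neither the starting height μ nor the number N of layers, which depend on
  -- f, nor the level D, which later tends to infinity.
  refine ⟨B₀ ^ (1 - θ) * B₁ ^ θ, by positivity, fun ε f v D hc hf hv => ?_⟩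
  obtain ⟨μ, N, hμ, hN⟩ := exists_sum_layer hc hf
  have hlam : ∀ j : ℕ, 0 < μ * 2 ^ j := fun j => by positivity
  set P := ∫ x, ‖f x‖ ^ p with hP
  set V := ∫ x, ‖v x‖ ^ q with hV
  have hP0 : 0 ≤ P := integral_nonneg fun _ => by positivity
  have hV0 : 0 ≤ V := integral_nonneg fun _ => by positivity
  have hlev : levelSum f D μ N p ≤ Kp * P := levelSum_le hf hμ N hp1
  have hlev0 : 0 ≤ levelSum f D μ N p := levelSum_nonneg hμ N p
  refine (norm_Bil_le_interp (g := fun ξ => g ((ε : ℝ) • ξ)) (X := B₀ * (P ^ (1 / (2 : ℝ)) *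
    V ^ (1 / (2 : ℝ)))) (Y := B₁ * P) hΦ.continuous hm hp1 hp2 hpq (hg.comp_smul ε.2.1.ne')
    ha.1.continuous hCa hc hf hv hμ ?_ ?_ hN).trans
    (rpow_interp_le (by positivity) (by positivity) hP0 hV0 hp1 hpq hθ rfl)
  · intro z hz
    rw [norm_exp_mul_Bil_ampFam, hz]
    simp only [ne_eq, OfNat.ofNat_ne_zero, not_false_eq_true, zero_pow, Real.exp_zero, one_mul,
      sub_zero]
    -- On Re z = 0 the coefficients have modulus λ^{p/2-1}, exactly what the L² bound for layers
    -- accepts; the dual family has L² norm ‖v‖_q^{q/2}.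
    have hL : nrm 2 (layerFam f D μ N p z) ≤ K₂ * (Kp ^ (1 / (2 : ℝ)) * P ^ (1 / (2 : ℝ))) := by
      have h2 := integral_sum_layer_sq_le hc hf hμ N hp0 (c := fun j => layerCoef p (μ * 2 ^ j) z)
        (fun j => le_of_eq (by rw [norm_layerCoef (hlam j), hz, add_zero, mul_one]))
      have h3 : nrm 2 (layerFam f D μ N p z) ≤ (K₂ ^ 2 * (Kp * P)) ^ (1 / (2 : ℝ)) :=
        Real.rpow_le_rpow (integral_nonneg fun _ => by positivity)
          (h2.trans (mul_le_mul_of_nonneg_left hlev (by positivity))) (by norm_num)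
      rwa [Real.mul_rpow (by positivity) (by positivity), Real.mul_rpow hKp0.le hP0,
        ← Real.rpow_natCast K₂, ← Real.rpow_mul hK₂0.le, Nat.cast_ofNat, mul_one_div_cancel
        two_ne_zero, Real.rpow_one] at h3
    refine (h0 _ _ _ (bddSupp_layerFam hc hf hμ N z)
      (bddSupp_dualFam hv hq0.le hz.ge (by linarith))).trans ?_
    rw [nrm_two_dualFam hq0 hz, ← hV]
    calc C₀ * (nrm 2 (layerFam f D μ N p z) * V ^ (1 / (2 : ℝ)))
        ≤ C₀ * (K₂ * (Kp ^ (1 / (2 : ℝ)) * P ^ (1 / (2 : ℝ))) * V ^ (1 / (2 : ℝ))) := by gcongr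
      _ = B₀ * (P ^ (1 / (2 : ℝ)) * V ^ (1 / (2 : ℝ))) := by rw [hB₀]; ring
  · intro z hz
    rw [norm_exp_mul_Bil_ampFam, hz, one_pow, hB₁, mul_assoc]
    refine mul_le_mul_of_nonneg_left ?_ (Real.exp_pos _).le
    have hdv := bddSupp_dualFam hv hq0.le (z := z) (by linarith) hz.le
    obtain ⟨G, hG⟩ := ampDom_famAmp hg (Or.inr hS1) hm (z.im, ε)
    -- On Re z = 1 the coefficients have modulus λ^{p-1}. Together with the bound λ|Lev(λ)| of each
    -- layer, the triangle inequality gives the sum of λ^p |Lev(λ)|.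
    unfold layerFam
    rw [Bil_sum_left hΦ.continuous hG _ (fun j _ =>
      ((hf.layer hc (hlam j).le).const_mul _).integrable) hdv.integrable]
    refine (norm_sum_le_of_le (f := fun j => Bil Φ _ (fun y => layerCoef p (μ * 2 ^ j) z *
      layer f D (μ * 2 ^ j) y) (dualFam v q z)) _ (n := fun j => C₁ * ((μ * 2 ^ j) ^ p *
      volume.real (Lev f D (μ * 2 ^ j)))) fun j _ => ?_).trans ?_
    · rw [Bil_smul_left, norm_mul, norm_layerCoef (hlam j), hz]
      refine (mul_le_mul_of_nonneg_left (h1 (z.im, ε) f _ D _ hc hf (hlam j) hdv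
        (norm_dualFam_le_one hz)) (Real.rpow_nonneg (hlam j).le _)).trans (le_of_eq ?_)
      have : p * (1 + 1) / 2 - 1 = p - 1 := by ring
      rw [this, Real.rpow_sub_one (hlam j).ne']
      have := (hlam j).ne'
      field_simp
    · rw [← Finset.mul_sum, mul_assoc]
      exact mul_le_mul_of_nonneg_left hlev hC₁

/-- Approximation of test functions by dyadic step functions. -/
lemma exists_cellConst_approx {u : E n → ℂ} (hu : IsTest u) :
    ∃ (U : ℕ → E n → ℂ) (M R : ℝ), (∀ k, CellConst k (U k)) ∧ (∀ k x, ‖U k x‖ ≤ M) ∧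
      (∀ k, Function.support (U k) ⊆ Metric.closedBall 0 R) ∧
      ∀ x, Tendsto (fun k => U k x) atTop (𝓝 (u x)) := by
  obtain ⟨M, R, hM, hR⟩ := hu.bddSupp.bdd
  refine ⟨fun k => avg k u, M, R + n, fun k => cellConst_avg k u, fun k x =>
    (norm_avg_le k u x).trans (avg_const_le k hu.integrable.norm hM x),
    fun k => support_avg_subset hR, fun x => ?_⟩
  rw [Metric.tendsto_atTop]
  intro δ hδ
  obtain ⟨r, hr, hur⟩ := Metric.continuousAt_iff.1 hu.1.continuous.continuousAt (δ / 2) (half_pos hδ)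
  have h1 : Tendsto (fun k : ℕ => (n : ℝ) * ((2 : ℝ) ^ k)⁻¹) atTop (𝓝 0) := by
    have := (tendsto_inv_atTop_zero.comp (tendsto_pow_atTop_atTop_of_one_lt
      (one_lt_two : (1 : ℝ) < 2))).const_mul (n : ℝ)
    simpa using this
  obtain ⟨k₀, hk₀⟩ := eventually_atTop.1 (h1.eventually_lt_const hr)
  refine ⟨k₀, fun k hk => ?_⟩
  have h2 : (0 : ℝ) < (2 ^ k) ^ n := by positivity
  have h3 : avg k u x - u x = (((2 : ℝ) ^ k) ^ n) • ∫ y in cube k (cell k x), (u y - u x) := by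
    rw [integral_sub hu.integrable.integrableOn (integrableOn_const (volume_cube_ne_top _ _)),
      setIntegral_const, volume_real_cube, smul_sub, smul_smul, mul_inv_cancel₀ h2.ne', one_smul]
    rfl
  rw [dist_eq_norm, h3, norm_smul, Real.norm_eq_abs, abs_of_pos h2]
  have h4 : ‖∫ y in cube k (cell k x), (u y - u x)‖ ≤
      δ / 2 * volume.real (cube k (cell k x) : Set (E n)) := by
    refine norm_setIntegral_le_of_norm_le_const (volume_cube_ne_top _ _).lt_top fun y hy => ?_
    rw [← dist_eq_norm]
    refine (hur ?_).le
    rw [dist_eq_norm]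
    exact (norm_sub_le_of_cell_eq hy).trans_lt (hk₀ k hk)
  rw [volume_real_cube] at h4
  calc ((2 : ℝ) ^ k) ^ n * ‖∫ y in cube k (cell k x), (u y - u x)‖
      ≤ ((2 : ℝ) ^ k) ^ n * (δ / 2 * (((2 : ℝ) ^ k) ^ n)⁻¹) := mul_le_mul_of_nonneg_left h4 h2.le
    _ = δ / 2 := by field_simp
    _ < δ := half_lt_self hδ

/-- A test function is the bounded limit of its dyadic averages, and the constant for step functions
does not depend on their level, so dominated convergence applies for each fixed ε. -/
lemma exists_interp_bound_test (hn : 1 ≤ n) (hΦ : ContDiff ℝ ∞ Φ)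
    (hA1 : ∀ j, IsSymbol 0 (partialXi Φ j)) (hm : 0 ≤ m)
    (hA2 : ∀ a : E3 n → ℂ, IsSymbol 0 a → LpBounded 2 Φ a)
    (hA3 : ∀ a : E3 n → ℂ, IsSymbol (-m) a → UnifLocHardyBounded Φ a)
    (hp1 : 1 < p) (hp2 : p < 2) (hpq : 1 / p + 1 / q = 1)
    (ha : IsSymbol (-(m * (2 / p - 1))) a) (hg : IsTest g) :
    ∃ C : ℝ, 0 ≤ C ∧ ∀ (ε : Set.Ioc (0 : ℝ) 1) (u v : E n → ℂ), IsTest u → IsTest v →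
      ‖Bil Φ (fun p => g ((ε : ℝ) • p.2.2) * a p) u v‖ ≤ C * (nrm p u * nrm q v) := by
  obtain ⟨C, hC0, hC⟩ := exists_interp_bound hn hΦ hA1 hm hA2 hA3 hp1 hp2 hpq ha hg
  have hp0 : 0 < p := by linarith
  have hθ0 : 0 ≤ 2 / p - 1 := by rw [sub_nonneg, le_div_iff₀ hp0]; linarith
  obtain ⟨Ca, -, hCa⟩ := ha.bdd (neg_nonpos.2 (mul_nonneg hm hθ0))
  refine ⟨C, hC0, fun ε u v hu hv => ?_⟩
  obtain ⟨U, M, R, h1, h2, h3, h4⟩ := exists_cellConst_approx hu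
  obtain ⟨M', R', hM', hR'⟩ := hv.bddSupp.bdd
  have hm' : ∀ k, AEStronglyMeasurable (U k) := fun k => (h1 k).measurable.aestronglyMeasurable
  have hl1 := tendsto_Bil_bdd hΦ.continuous
    (ampDom_cutoff ha.1.continuous hCa (hg.comp_smul ε.2.1.ne')) hm' h2 h3
    (Eventually.of_forall h4) (fun _ => hv.bddSupp.meas) (fun _ => hM') (fun _ => hR')
    (Eventually.of_forall fun x => tendsto_const_nhds)
  have hl2 := tendsto_nrm hp0 hm' h2 h3 (Eventually.of_forall h4)
  exact le_of_tendsto_of_tendsto' hl1.norm ((hl2.mul_const (nrm q v)).const_mul C) fun k =>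
    hC ε (U k) v k (h1 k) ⟨hm' k, M, R, h2 k, h3 k⟩ hv.bddSupp

end Strong

/-! ### Converse Hölder inequality, removal of the cut-off, and the adjoint. -/

section Duality

variable {n : ℕ} {Φ : E3 n → ℝ} {p q : ℝ} {a : E3 n → ℂ} {g f u v : E n → ℂ}

/-- Mollifications of v are uniformly bounded with supports in one ball, where f is integrable, so
both sides pass to the limit. The extremal function in the converse of Hölder's inequality is not
smooth, hence this extension. -/
lemma norm_integral_mul_le_of_test (hf : LocallyIntegrable f) (hq : 0 < q) {K : ℝ}
    (h : ∀ v, IsTest v → ‖∫ x, f x * v x‖ ≤ K * nrm q v) (hv : BddSupp v) :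
    ‖∫ x, f x * v x‖ ≤ K * nrm q v := by
  obtain ⟨M, R, hM, hR⟩ := hv.bdd
  obtain ⟨V, hV1, hV2, hV3, -, hV4⟩ := exists_mollify hv.meas hM one_pos hR
  have hl1 : Tendsto (fun k => ∫ x, f x * V k x) atTop (𝓝 (∫ x, f x * v x)) := by
    refine tendsto_integral_of_dominated_convergence
      (fun x => (Metric.closedBall (0 : E n) (R + 1)).indicator (fun x => ‖f x‖ * M) x)
      (fun k => hf.aestronglyMeasurable.mul (hV1 k).1.continuous.aestronglyMeasurable) ?_
      (fun k => Eventually.of_forall fun x => ?_) ?_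
    · exact (integrable_indicator_iff Metric.isClosed_closedBall.measurableSet).2
        ((hf.integrableOn_isCompact (isCompact_closedBall 0 (R + 1))).norm.mul_const M)
    · have h1 := norm_le_ball_indicator (hV2 k) (hV3 k) x
      rw [norm_mul]
      by_cases hx : x ∈ Metric.closedBall (0 : E n) (R + 1)
      · rw [Set.indicator_of_mem hx] at h1 ⊢
        exact mul_le_mul_of_nonneg_left h1 (norm_nonneg _)
      · rw [Set.indicator_of_notMem hx] at h1 ⊢
        rw [le_antisymm h1 (norm_nonneg _), mul_zero]
    · filter_upwards [hV4] with x hx using hx.const_mul _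
  have hl2 := tendsto_nrm hq (fun k => (hV1 k).1.continuous.aestronglyMeasurable) hV2 hV3 hV4
  exact le_of_tendsto_of_tendsto' hl1.norm (hl2.const_mul K) fun k => h (V k) (hV1 k)

/-- The converse of Hölder's inequality. -/
lemma memLp_of_dual (hf : LocallyIntegrable f) (hpq : p.HolderConjugate q) {K : ℝ} (hK : 0 ≤ K)
    (h : ∀ v, IsTest v → ‖∫ x, f x * v x‖ ≤ K * nrm q v) :
    MemLp f (ENNReal.ofReal p) ∧ eLpNorm f (ENNReal.ofReal p) volume ≤ ENNReal.ofReal K := by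
  have hp0 := hpq.pos
  have hq0 := hpq.symm.pos
  have hfm := hf.aestronglyMeasurable
  set T : ℕ → Set (E n) := fun k => {x | ‖f x‖ ≤ k} ∩ Metric.closedBall 0 k with hT
  set w : ℕ → E n → ℂ := fun k => (T k).indicator f with hw
  have hwb : ∀ k, BddSupp (w k) := by
    intro k
    refine ⟨hfm.indicator₀ ((nullMeasurableSet_le hfm.norm.aemeasurable aemeasurable_const).inter
      Metric.isClosed_closedBall.nullMeasurableSet), k, k, fun x => ?_, fun x hx => ?_⟩
    · by_cases hx : x ∈ T k
      · rw [hw]; simp only [Set.indicator_of_mem hx]; exact hx.1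
      · rw [hw]; simp only [Set.indicator_of_notMem hx, norm_zero]; positivity
    · by_contra h1
      exact hx (Set.indicator_of_notMem (fun h2 => h1 h2.2) _)
  have hnrm : ∀ k, nrm p (w k) ≤ K := by
    intro k
    -- The extremal function of Hölder's inequality for the truncation w_k: f vk = |w_k|^p and
    -- |vk|^q = |w_k|^p. Truncation makes the integral of |w_k|^p finite, so that it may be divided
    -- out; Fatou then removes the truncation.
    set vk : E n → ℂ := fun x => star (w k x) * ((‖w k x‖ ^ (p - 2) : ℝ) : ℂ) with hvk
    have hn1 : ∀ x, ‖vk x‖ = ‖w k x‖ ^ (p - 1) := by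
      intro x
      rw [hvk, norm_mul, norm_star, Complex.norm_real, Real.norm_eq_abs,
        abs_of_nonneg (by positivity)]
      rcases (norm_nonneg (w k x)).eq_or_lt with h0 | h0
      · rw [← h0, zero_mul, Real.zero_rpow hpq.sub_one_ne_zero]
      · rw [← Real.rpow_one_add' h0.le (by have := hpq.sub_one_pos; linarith)]
        congr 1; ring
    have hfv : ∀ x, f x * vk x = ((‖w k x‖ ^ p : ℝ) : ℂ) := by
      intro x
      by_cases hx : x ∈ T k
      · have h1 : f x = w k x := (Set.indicator_of_mem hx f).symm
        rw [h1, hvk]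
        simp only
        rw [← mul_assoc]
        have h2 : w k x * star (w k x) = ((‖w k x‖ ^ (2 : ℝ) : ℝ) : ℂ) := by
          rw [Real.rpow_two]
          exact_mod_cast Complex.mul_conj' (w k x)
        rw [h2, ← Complex.ofReal_mul]
        congr 1
        rcases (norm_nonneg (w k x)).eq_or_lt with h0 | h0
        · rw [← h0, Real.zero_rpow two_ne_zero, zero_mul, Real.zero_rpow hp0.ne']
        · rw [← Real.rpow_add h0]; congr 1; ring
      · have h1 : w k x = 0 := Set.indicator_of_notMem hx f
        simp [hvk, h1, Real.zero_rpow hp0.ne']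
    have hvb : BddSupp vk := by
      obtain ⟨M, R, hM, hR⟩ := (hwb k).bdd
      refine ⟨(continuous_star.comp_aestronglyMeasurable (hwb k).meas).mul
        (Complex.measurable_ofReal.comp_aemeasurable
          ((hwb k).meas.norm.aemeasurable.pow_const _)).aestronglyMeasurable,
        M ^ (p - 1), R, fun x => ?_, fun x hx => hR fun h0 => hx (by simp [hvk, h0])⟩
      rw [hn1]
      exact Real.rpow_le_rpow (norm_nonneg _) (hM x) hpq.sub_one_pos.le
    have hI0 : 0 ≤ ∫ x, ‖w k x‖ ^ p := integral_nonneg fun _ => by positivity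
    have h1 := norm_integral_mul_le_of_test hf hq0 h hvb
    have h2 : nrm q vk = (∫ x, ‖w k x‖ ^ p) ^ (1 / q) := by
      rw [nrm]
      congr 2; funext x
      rw [hn1, ← Real.rpow_mul (norm_nonneg _), hpq.sub_one_mul_conj]
    have h4 : ∫ x, f x * vk x = ((∫ x, ‖w k x‖ ^ p : ℝ) : ℂ) := by
      simp only [hfv]; exact integral_ofReal
    rw [h4, h2, Complex.norm_real, Real.norm_eq_abs, abs_of_nonneg hI0] at h1
    rw [nrm]
    rcases hI0.eq_or_lt with h0 | h0
    · rw [← h0, Real.zero_rpow (one_div_ne_zero hp0.ne')]; exact hK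
    · have h3 : (∫ x, ‖w k x‖ ^ p) ^ (1 / p) * (∫ x, ‖w k x‖ ^ p) ^ (1 / q) =
          ∫ x, ‖w k x‖ ^ p := by
        rw [← Real.rpow_add h0, one_div, one_div, hpq.inv_add_inv_eq_one, Real.rpow_one]
      rw [← h3] at h1
      exact le_of_mul_le_mul_right (by rwa [h3] at h1 ⊢) (Real.rpow_pos_of_pos h0 _)
  have hlim : ∀ x, Tendsto (fun k => w k x) atTop (𝓝 (f x)) := by
    intro x
    refine tendsto_const_nhds.congr' ?_
    obtain ⟨k₀, hk₀⟩ := exists_nat_ge (max ‖f x‖ ‖x‖)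
    filter_upwards [eventually_ge_atTop k₀] with k hk
    have h1 : (k₀ : ℝ) ≤ k := by exact_mod_cast hk
    have h2 : x ∈ T k := ⟨((le_max_left _ _).trans hk₀).trans h1,
      mem_closedBall_zero_iff.2 (((le_max_right _ _).trans hk₀).trans h1)⟩
    exact (Set.indicator_of_mem h2 f).symm
  have hle : eLpNorm f (ENNReal.ofReal p) volume ≤ ENNReal.ofReal K := by
    refine (Lp.eLpNorm_lim_le_liminf_eLpNorm (fun k => (hwb k).meas) f
      (Eventually.of_forall hlim)).trans ?_
    refine (Filter.liminf_le_liminf (v := fun _ => ENNReal.ofReal K)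
      (Eventually.of_forall fun k => ?_)).trans (by simp)
    rw [FourierInt.MemLp.eLpNorm_eq_nrm hp0 ((hwb k).memLp _)]
    exact ENNReal.ofReal_le_ofReal (hnrm k)
  exact ⟨⟨hfm, hle.trans_lt ENNReal.ofReal_lt_top⟩, hle⟩

/-- A representing function is supplied by `hex`; its pairings with test functions are limits of the
regularised forms and inherit the uniform bound. The converse of Hölder's inequality then places it
in L^p. -/
lemma lpBounded_of_uniform (hΦ : Continuous Φ) {κ : ℝ} (hκ : κ ≤ 0) (ha : IsSymbol κ a)
    (hex : ∀ u, IsTest u → ∃ f, Represents Φ a u f) (hpq : p.HolderConjugate q) (hg : IsTest g)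
    (hg0 : g 0 = 1) {C : ℝ} (hC : 0 ≤ C)
    (h : ∀ (ε : Set.Ioc (0 : ℝ) 1) (u v : E n → ℂ), IsTest u → IsTest v →
      ‖Bil Φ (fun p => g ((ε : ℝ) • p.2.2) * a p) u v‖ ≤ C * (nrm p u * nrm q v)) :
    LpBounded (ENNReal.ofReal p) Φ a := by
  refine ⟨⟨C, hC⟩, fun u hu => ?_⟩
  obtain ⟨f, hf⟩ := hex u hu
  obtain ⟨h1, h2⟩ := memLp_of_dual hf.1 hpq (K := C * nrm p u) (mul_nonneg hC (nrm_nonneg _ _))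
    fun v hv => by
      refine le_of_tendsto (hf.tendsto hΦ hκ ha hu hg hg0 hv).norm ?_
      filter_upwards [Ioc_mem_nhdsGT zero_lt_one] with ε hε
      rw [mul_assoc]
      exact h ⟨ε, hε⟩ u v hu hv
  refine ⟨f, hf, h1, h2.trans (le_of_eq ?_)⟩
  rw [FourierInt.MemLp.eLpNorm_eq_nrm hpq.pos (hu.bddSupp.memLp _), ENNReal.ofReal_mul hC]
  congr 1
  exact ENNReal.ofReal_eq_coe_nnreal hC

lemma IsTest.star (hu : IsTest u) : IsTest fun x => star (u x) :=
  ⟨(starL' ℝ : ℂ ≃L[ℝ] ℂ).contDiff.comp hu.1, hu.2.comp_left (star_zero ℂ)⟩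

lemma nrm_star (p : ℝ) (u : E n → ℂ) : nrm p (fun x => star (u x)) = nrm p u := by
  simp only [nrm, norm_star]

lemma contDiff_adjPhase (hΦ : ContDiff ℝ ∞ Φ) : ContDiff ℝ ∞ (adjPhase Φ) := by
  have h1 : ContDiff ℝ ∞ fun p : E3 n => ((p.2.1, p.1, p.2.2) : E3 n) := by fun_prop
  exact (hΦ.comp h1).neg

/-- The bounds of the regularised operators follow from those of the adjoint operators. -/
lemma norm_Bil_le_of_adj {C : ℝ}
    (h : ∀ (ε : Set.Ioc (0 : ℝ) 1) (u v : E n → ℂ), IsTest u → IsTest v →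
      ‖Bil (adjPhase Φ) (fun p => star (g ((ε : ℝ) • p.2.2)) * adjAmp a p) u v‖ ≤
        C * (nrm q u * nrm p v)) (ε : Set.Ioc (0 : ℝ) 1) (hu : IsTest u) (hv : IsTest v) :
    ‖Bil Φ (fun p => g ((ε : ℝ) • p.2.2) * a p) u v‖ ≤ C * (nrm p u * nrm q v) := by
  rw [← norm_star, star_Bil]
  have h1 : adjAmp (fun p : E3 n => g ((ε : ℝ) • p.2.2) * a p) =
      fun p => star (g ((ε : ℝ) • p.2.2)) * adjAmp a p := by
    funext p
    simp only [adjAmp, star_mul']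
  rw [h1]
  refine (h ε _ _ hv.star hu.star).trans (le_of_eq ?_)
  rw [nrm_star, nrm_star]; ring

end Duality

end FourierInt
end

/-! ### The theorem. -/

theorem mainTheorem2 {n : ℕ} (hn : 1 ≤ n) (Φ : FourierInt.E3 n → ℝ)
    (hΦ : ContDiff ℝ ∞ Φ)
    (hA1 : ∀ j : Fin n, FourierInt.IsSymbol 0 (FourierInt.partialXi Φ j))
    (hA2 : ∀ a : FourierInt.E3 n → ℂ, FourierInt.IsSymbol 0 a →
      FourierInt.LpBounded 2 Φ a ∧ FourierInt.LpBounded 2 (FourierInt.adjPhase Φ) (FourierInt.adjAmp a))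
    (hA3 : ∀ a : FourierInt.E3 n → ℂ, FourierInt.IsSymbol (-((n : ℝ) - 1) / 2) a →
      FourierInt.UnifLocHardyBounded Φ a ∧
        FourierInt.UnifLocHardyBounded (FourierInt.adjPhase Φ) (FourierInt.adjAmp a))
    (p : ℝ) (hp : 1 < p) (κ : ℝ) (hκ : κ ≤ -((n : ℝ) - 1) * |1 / p - 1 / 2|)
    (a : FourierInt.E3 n → ℂ) (ha : FourierInt.IsSymbol κ a) :
    FourierInt.LpBounded (ENNReal.ofReal p) Φ a := by
  have hn1 : (1 : ℝ) ≤ n := by exact_mod_cast hn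
  obtain ⟨m, hm⟩ : ∃ m : ℝ, m = ((n : ℝ) - 1) / 2 := ⟨_, rfl⟩
  have hm0 : 0 ≤ m := by rw [hm]; linarith
  have hneg : -((n : ℝ) - 1) / 2 = -m := by rw [hm]; ring
  rw [hneg] at hA3
  have hκ0 : κ ≤ 0 := hκ.trans (by
    have := abs_nonneg (1 / p - 1 / 2)
    nlinarith)
  have hp0 : 0 < p := by linarith
  have hpq : p.HolderConjugate (Real.conjExponent p) := Real.HolderConjugate.conjExponent hp
  obtain ⟨q, hq⟩ : ∃ q, q = Real.conjExponent p := ⟨_, rfl⟩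
  rw [← hq] at hpq
  have hpq1 : 1 / p + 1 / q = 1 := by
    rw [one_div, one_div]; exact hpq.inv_add_inv_eq_one
  -- Since κ ≤ 0, the L² hypothesis already gives existence of the oscillatory integral; only its
  -- L^p norm remains to be bounded.
  have hex : ∀ u, FourierInt.IsTest u → ∃ f, FourierInt.Represents Φ a u f := by
    obtain ⟨C, hC⟩ := (hA2 a (ha.mono hκ0)).1
    intro u hu
    obtain ⟨f, hf, -⟩ := hC u hu
    exact ⟨f, hf⟩
  obtain ⟨g, hg, hg0, -⟩ := FourierInt.exists_cutoff n
  rcases lt_trichotomy p 2 with h2 | h2 | h2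
  -- For p < 2, (n - 1)|1/p - 1/2| = m(2/p - 1), so the critical order is the one met at z = θ.
  · have ha' : FourierInt.IsSymbol (-(m * (2 / p - 1))) a := by
      refine ha.mono (hκ.trans (le_of_eq ?_))
      have : 1 / 2 ≤ 1 / p := one_div_le_one_div_of_le hp0 h2.le
      rw [abs_of_nonneg (by linarith), hm]; ring
    obtain ⟨C, hC0, hC⟩ := FourierInt.exists_interp_bound_test hn hΦ hA1 hm0
      (fun b hb => (hA2 b hb).1) (fun b hb => (hA3 b hb).1) hp h2 hpq1 ha' hg
    exact FourierInt.lpBounded_of_uniform hΦ.continuous hκ0 ha hex hpq hg hg0 hC0 hC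
  · have h3 : ENNReal.ofReal p = 2 := by rw [h2]; simp
    rw [h3]
    exact (hA2 a (ha.mono hκ0)).1
  -- For p > 2 the bound with exponent q < 2 is used for the adjoint. Duality is applied to the
  -- regularised forms, so no adjoint of an extended operator is involved.
  · have hq1 : 1 < q := hpq.symm.lt
    have hq2 : q < 2 := by
      have h3 : 1 / p < 1 / 2 := one_div_lt_one_div_of_lt two_pos h2
      have h4 : 1 / 2 < 1 / q := by linarith
      exact lt_of_one_div_lt_one_div two_pos h4
    have hqp1 : 1 / q + 1 / p = 1 := by linarith
    have ha' : FourierInt.IsSymbol (-(m * (2 / q - 1))) (FourierInt.adjAmp a) := by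
      refine (ha.mono (hκ.trans (le_of_eq ?_))).adjAmp
      have h3 : 1 / p ≤ 1 / 2 := one_div_le_one_div_of_le two_pos h2.le
      have h5 : 1 / q = 1 - 1 / p := by linarith
      have h4 : 2 / q = 2 * (1 - 1 / p) := by rw [← h5]; ring
      rw [abs_of_nonpos (by linarith), hm, h4]; ring
    obtain ⟨C, hC0, hC⟩ := FourierInt.exists_interp_bound_test hn
      (FourierInt.contDiff_adjPhase hΦ)
      (fun j => FourierInt.isSymbol_partialXi_adjPhase hΦ j (hA1 j)) hm0
      -- Every amplitude is the adjoint of its own adjoint, so the adjoint halves of (A2) and (A3)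
      -- cover all amplitudes of the adjoint phase.
      (fun b hb => by
        rw [← FourierInt.adjAmp_adjAmp b]; exact (hA2 _ hb.adjAmp).2)
      (fun b hb => by
        rw [← FourierInt.adjAmp_adjAmp b]; exact (hA3 _ hb.adjAmp).2) hq1 hq2 hqp1 ha' hg.star
    exact FourierInt.lpBounded_of_uniform hΦ.continuous hκ0 ha hex hpq hg hg0 hC0
      fun ε u v hu hv => FourierInt.norm_Bil_le_of_adj hC ε hu hv
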